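/- Let $\mathcal O$ be a Lie group and let $P\to M$ be a smooth (right) principal $\mathcal O$-bundle of finite-dimensional manifolds (Hausdorff, second countable, without boundary), with action $\Phi_g:P\to P$, $g\in\mathcal O$. Assume that $P$ is connected and carries an exact symplectic form $\omega=-\mathbf d\theta$, where $\theta$ is a smooth one-form with $\Phi_g^*\theta=\theta$ for all $g\in\mathcal O$. For $h\in C^\infty(P)$ let $X_h$ be the Hamiltonian vector field defined by $\mathbf i_{X_h}\omega=\mathbf dh$. Let $\mathrm{Diff}_{\rm ham}(P)$ be the set of Hamiltonian diffeomorphisms, that is, of the time-one maps $\psi_1$ of smooth isotopies $(\psi_t)$ of $P$ with $\psi_0=\mathrm{id}$ and $\frac{d}{dt}\psi_t=X_{h_t}\circ\psi_t$ for some smooth time-dependent Hamiltonian $(h_t)$ (no condition on supports), and let $\mathcal Aut_{\rm ham}(P)$ be the set of those $\varphi\in\mathrm{Diff}_{\rm ham}(P)$ with $\varphi\circ\Phi_g=\Phi_g\circ\varphi$ for all $g\in\mathcal O$. Let $\mathrm{Hom}(\mathcal O,\mathbb R)$ be the additive group of group homomorphisms $\mathcal O\to\mathbb R$. Then $\mathcal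 Aut_{\rm ham}(P)$ is a group under composition. For every $\varphi\in\mathcal Aut_{\rm ham}(P)$ there is $F_\varphi\in C^\infty(P)$ with $\mathbf dF_\varphi=\varphi^*\theta-\theta$; for every $g\in\mathcal O$ the function $\Psi(\varphi)(g):=F_\varphi-F_\varphi\circ\Phi_g$ is a constant, independent of the choice of $F_\varphi$; $\Psi(\varphi)$ belongs to $\mathrm{Hom}(\mathcal O,\mathbb R)$; and $$\Psi:\mathcal Aut_{\rm ham}(P)\to\mathrm{Hom}(\mathcal O,\mathbb R)$$ is a group homomorphism. Moreover, let the formal Lie algebra of a group $K$ of diffeomorphisms of $P$ be the set of velocities $\frac{d}{dt}\big|_{t=0}\psi_t$ of smooth curves $t\mapsto\psi_t$ in $K$ with $\psi_0=\mathrm{id}$, where smooth means that $(t,p)\mapsto(t,\psi_t(p))$ is a diffeomorphism of $\mathbb R\times P$. Then the formal Lie algebra of the normal subgroup $\ker\Psi\subset\mathcal Aut_{\rm ham}(P)$ (the special Hamiltonian automorphisms) is $$\{X_h\mid h\in C^\infty(P),\ h\circ\Phi_g=h\ \text{for all } g\in\mathcal O\}.$$ -/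

import Mathlib

open scoped Manifold ContDiff
open Bundle

noncomputable section

namespace PrincipalHam

/-! ### Differential forms and vector fields

All manifolds are modelled on finite-dimensional real vector spaces `E`, without boundary. -/

section Forms

variable {E : Type*} [NormedAddCommGroup E] [NormedSpace ℝ E]
  {P : Type*} [TopologicalSpace P] [ChartedSpace E P]

variable (E P) in
/-- A (not necessarily smooth) vector field on `P`. -/
abbrev VectorField := (p : P) → TangentSpace 𝓘(ℝ, E) p

variable (E P) in
/-- A (not necessarily smooth) one-form on `P`. -/
abbrev OneForm := (p : P) → (TangentSpace 𝓘(ℝ, E) p →L[ℝ] ℝ)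

/-- Smoothness of a one-form, as a section of the cotangent bundle. -/
def IsSmoothOneForm [IsManifold 𝓘(ℝ, E) ∞ P] (θ : OneForm E P) : Prop :=
  ContMDiff 𝓘(ℝ, E) (𝓘(ℝ, E).prod 𝓘(ℝ, E →L[ℝ] ℝ)) ∞
    (fun p ↦ TotalSpace.mk' (E →L[ℝ] ℝ)
      (E := fun p : P ↦ (TangentSpace 𝓘(ℝ, E) p →L[ℝ] ℝ)) p (θ p))

/-- The pull-back `φ^* θ` of a one-form. -/
def pullback (φ : P → P) (θ : OneForm E P) : OneForm E P :=
  fun p ↦ (θ (φ p)).comp (mfderiv 𝓘(ℝ, E) 𝓘(ℝ, E) φ p)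

/-- The differential `dF` of a real function. -/
def differential (F : P → ℝ) : OneForm E P :=
  fun p ↦ mvfderiv 𝓘(ℝ, E) F p

/-- The expression of a one-form in the chart centred at `x`. -/
def chartExpr (θ : OneForm E P) (x : P) (y : E) : E →L[ℝ] ℝ :=
  (θ ((extChartAt 𝓘(ℝ, E) x).symm y)).comp
    ((mfderiv 𝓘(ℝ, E) 𝓘(ℝ, E) (extChartAt 𝓘(ℝ, E) x).symm y).comp
      (NormedSpace.fromTangentSpace (𝕜 := ℝ) y).symm.toContinuousLinearMap)

/-- The exterior derivative `dθ` of a one-form, computed at `x` in the chart centred at `x`: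
`dθ(u, v) = D_u θ (v) - D_v θ (u)`. -/
def extDerivOneForm (θ : OneForm E P) (x : P) (u v : TangentSpace 𝓘(ℝ, E) x) : ℝ :=
  fderiv ℝ (chartExpr θ x) (extChartAt 𝓘(ℝ, E) x x)
      (mvfderiv 𝓘(ℝ, E) (extChartAt 𝓘(ℝ, E) x) x u)
      (mvfderiv 𝓘(ℝ, E) (extChartAt 𝓘(ℝ, E) x) x v)
    - fderiv ℝ (chartExpr θ x) (extChartAt 𝓘(ℝ, E) x x)
      (mvfderiv 𝓘(ℝ, E) (extChartAt 𝓘(ℝ, E) x) x v)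
      (mvfderiv 𝓘(ℝ, E) (extChartAt 𝓘(ℝ, E) x) x u)

/-- The two-form `ω = -dθ`. -/
def symplForm (θ : OneForm E P) (x : P) (u v : TangentSpace 𝓘(ℝ, E) x) : ℝ :=
  -extDerivOneForm θ x u v

/-- `θ` is a smooth one-form and `ω = -dθ` is nondegenerate: `(P, -dθ)` is an exact symplectic
manifold (closedness of `ω` being automatic). -/
structure IsExactSymplectic [IsManifold 𝓘(ℝ, E) ∞ P] (θ : OneForm E P) : Prop where
  smooth : IsSmoothOneForm θ
  nondegenerate : ∀ (p : P) (u : TangentSpace 𝓘(ℝ, E) p), (∀ v, symplForm θ p u v = 0) → u = 0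

/-- `X` is the Hamiltonian vector field `X_h` of `h`, that is, `i_X ω = dh` with `ω = -dθ`. -/
def IsHamiltonianVectorField (θ : OneForm E P) (h : P → ℝ) (X : VectorField E P) : Prop :=
  ∀ (p : P) (v : TangentSpace 𝓘(ℝ, E) p), symplForm θ p (X p) v = differential h p v

end Forms

/-! ### Diffeomorphism groups -/

section Diffeos

variable (E : Type*) [NormedAddCommGroup E] [NormedSpace ℝ E]
  (P : Type*) [TopologicalSpace P] [ChartedSpace E P]

/-- The set of smooth diffeomorphisms of `P`. -/
abbrev Diff := P ≃ₘ⟮𝓘(ℝ, E), 𝓘(ℝ, E)⟯ P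

/-- Diffeomorphisms form a group under composition, `φ * ψ = φ ∘ ψ`. -/
instance : Group (Diff E P) where
  mul φ ψ := ψ.trans φ
  one := Diffeomorph.refl 𝓘(ℝ, E) P ∞
  inv φ := φ.symm
  mul_assoc _ _ _ := rfl
  one_mul _ := rfl
  mul_one _ := rfl
  inv_mul_cancel φ := φ.self_trans_symm

variable {E P}

/-- A smooth curve `t ↦ ψ_t` of diffeomorphisms: `(t, p) ↦ (t, ψ_t p)` is a diffeomorphism of
`ℝ × P`. -/
structure IsSmoothCurve (ψ : ℝ → Diff E P) : Prop where
  smooth : ContMDiff (𝓘(ℝ, ℝ).prod 𝓘(ℝ, E)) 𝓘(ℝ, E) ∞ (fun x : ℝ × P ↦ ψ x.1 x.2)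
  smooth_symm : ContMDiff (𝓘(ℝ, ℝ).prod 𝓘(ℝ, E)) 𝓘(ℝ, E) ∞ (fun x : ℝ × P ↦ (ψ x.1).symm x.2)

/-- `X` is the velocity of the curve `ψ` at time `t`, that is, `∂_t ψ_t = X ∘ ψ_t`. -/
def HasVelocityAt (ψ : ℝ → Diff E P) (t : ℝ) (X : VectorField E P) : Prop :=
  ∀ p : P, HasMFDerivAt 𝓘(ℝ, ℝ) 𝓘(ℝ, E) (fun s : ℝ ↦ ψ s p) t
    ((1 : ℝ →L[ℝ] ℝ).smulRight (X (ψ t p)))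

/-- `φ` is a Hamiltonian diffeomorphism of `(P, -dθ)`: it is the time-one map of a smooth isotopy,
starting at the identity, generated by a smooth time-dependent Hamiltonian. No compactness of
supports is required. -/
def IsHamiltonianDiffeo (θ : OneForm E P) (φ : Diff E P) : Prop :=
  ∃ (h : ℝ → P → ℝ) (X : ℝ → VectorField E P) (ψ : ℝ → Diff E P),
    ContMDiff (𝓘(ℝ, ℝ).prod 𝓘(ℝ, E)) 𝓘(ℝ, ℝ) ∞ (fun x : ℝ × P ↦ h x.1 x.2) ∧
    (∀ t, IsHamiltonianVectorField θ (h t) (X t)) ∧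
    IsSmoothCurve ψ ∧ (∀ t, HasVelocityAt ψ t (X t)) ∧ ψ 0 = 1 ∧ ψ 1 = φ

/-- The formal Lie algebra of a group `K` of diffeomorphisms: all velocities at the identity of
smooth curves in `K`. -/
def formalLieAlgebra (K : Subgroup (Diff E P)) : Set (VectorField E P) :=
  {X | ∃ ψ : ℝ → Diff E P, IsSmoothCurve ψ ∧ (∀ t, ψ t ∈ K) ∧ ψ 0 = 1 ∧ HasVelocityAt ψ 0 X}

end Diffeos

/-! ### Principal bundles and their automorphisms -/

section Bundles

variable {E : Type*} [NormedAddCommGroup E] [NormedSpace ℝ E]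
  {P : Type*} [TopologicalSpace P] [ChartedSpace E P]
  {B : Type*} [NormedAddCommGroup B] [NormedSpace ℝ B]
  {M : Type*} [TopologicalSpace M] [ChartedSpace B M]
  {L : Type*} [NormedAddCommGroup L] [NormedSpace ℝ L]
  {O : Type*} [TopologicalSpace O] [ChartedSpace L O] [Group O]

variable (E B L) in
/-- `pr : P → M` is a smooth right principal bundle with structure group `O` acting on `P` by
`Φ g p = p · g`: the action is smooth and there are equivariant smooth local trivializations
`pr⁻¹(U) ≅ U × O`, with `O` acting on itself by right translations. -/
structure IsPrincipalBundle (Φ : O → P → P) (pr : P → M) : Prop where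
  smooth_proj : ContMDiff 𝓘(ℝ, E) 𝓘(ℝ, B) ∞ pr
  smooth_action : ContMDiff (𝓘(ℝ, L).prod 𝓘(ℝ, E)) 𝓘(ℝ, E) ∞ (fun x : O × P ↦ Φ x.1 x.2)
  action_one : ∀ p, Φ 1 p = p
  action_mul : ∀ g h p, Φ (g * h) p = Φ h (Φ g p)
  locally_trivial : ∀ x : M, ∃ (U : Set M) (e : OpenPartialHomeomorph P (M × O)),
    IsOpen U ∧ x ∈ U ∧ e.source = pr ⁻¹' U ∧ e.target = U ×ˢ Set.univ ∧
    ContMDiffOn 𝓘(ℝ, E) (𝓘(ℝ, B).prod 𝓘(ℝ, L)) ∞ e e.source ∧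
    ContMDiffOn (𝓘(ℝ, B).prod 𝓘(ℝ, L)) 𝓘(ℝ, E) ∞ e.symm e.target ∧
    (∀ p ∈ e.source, (e p).1 = pr p) ∧
    (∀ g, ∀ p ∈ e.source, Φ g p ∈ e.source ∧ e (Φ g p) = ((e p).1, (e p).2 * g))

/-- `Φ_g^* θ = θ` for all `g`. -/
def IsInvariantOneForm (Φ : O → P → P) (θ : OneForm E P) : Prop :=
  ∀ g, pullback (Φ g) θ = θ

variable (E) in
/-- The automorphism group `Aut(P)` of equivariant diffeomorphisms. -/
def Aut (Φ : O → P → P) : Subgroup (Diff E P) where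
  carrier := {φ | ∀ g p, φ (Φ g p) = Φ g (φ p)}
  one_mem' _ _ := rfl
  mul_mem' {φ ψ} hφ hψ g p := by
    change φ (ψ (Φ g p)) = Φ g (φ (ψ p))
    rw [hψ, hφ]
  inv_mem' {φ} hφ g p := by
    change φ.symm (Φ g p) = Φ g (φ.symm p)
    apply φ.injective
    change φ (φ.symm (Φ g p)) = φ (Φ g (φ.symm p))
    rw [hφ, φ.apply_symm_apply, φ.apply_symm_apply]

/-- The set `Aut_ham(P) = Aut(P) ∩ Diff_ham(P)` of Hamiltonian automorphisms. -/
def hamAut (Φ : O → P → P) (θ : OneForm E P) : Set (Diff E P) :=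
  {φ | φ ∈ Aut E Φ ∧ IsHamiltonianDiffeo θ φ}

/-- The Hamiltonian vector fields `X_h` with `O`-invariant smooth Hamiltonian `h`. -/
def invariantHamiltonianVectorFields (Φ : O → P → P) (θ : OneForm E P) :
    Set (VectorField E P) :=
  {X | ∃ h : P → ℝ, ContMDiff 𝓘(ℝ, E) 𝓘(ℝ, ℝ) ∞ h ∧ (∀ g p, h (Φ g p) = h p) ∧
    IsHamiltonianVectorField θ h X}

end Bundles

end PrincipalHam

end

noncomputable section

/-! Let `ψ_t` be an isotopy with velocity `X_t`. Cartan's formula reads `d/dt ψ_t^*θ = d(θ(X_t) ∘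
ψ_t) + ψ_t^*(i_{X_t} dθ)`. If `X_t` has Hamiltonian `h_t`, the last term is `-d(h_t ∘ ψ_t)`, so the
time integral of `(θ(X_t) - h_t) ∘ ψ_t` is a primitive of `ψ_t^*θ - θ`. Conversely, a smooth family
`F_t` of primitives returns the Hamiltonian `θ(X_t) - (∂_t F_t) ∘ ψ_t⁻¹`. Hence Hamiltonian
diffeomorphisms are the endpoints of isotopies with a smooth family of primitives
(`isHamiltonianDiffeo_iff`), and the group laws follow from the cocycle rule `F_{φψ} = F_φ ∘ ψ +
F_ψ`.

If `φ` commutes with the action and `θ` is invariant, `F_φ ∘ Φ_g` is again a primitive of `φ^*θ -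
θ`, so it differs from `F_φ` by a constant on the connected manifold `P`. This constant telescopes
in `g` and is additive in `φ` by the cocycle rule. The kernel consists of the `φ` with invariant
`F_φ`.

For a curve in the kernel, the primitives normalized at a base point form a smooth family
(`IsPotentialFamily.of_slices`). The recovered Hamiltonian at time zero is then invariant, because
`θ`, the velocity and the `F_t` behave well under the action.

The reverse inclusion must face incomplete fields `X_h`. Take an exhaustion function `f` of `M` and
write `h = c(f) h + (1 - c(f)) h`, where `c` vanishes near arbitrarily high levels and equals one
near others. The Hamiltonian field of each summand vanishes near arbitrarily high levels of `f`, so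
no integral curve crosses them. Over a compact part of the base an invariant field has integral
curves for a uniform time, since the group carries one point of a fibre to all others; so both
fields are complete (`IsInvariantField.isCompleteField_of_levels`). Their flows lie in the kernel,
and the product of the two flows has velocity `X_h` at time zero.

Smoothness of flows comes from the implicit function theorem in a Banach space of continuous curves
(`exists_smooth_localFlow`). -/

namespace PrincipalHam

open scoped Manifold ContDiff Topology
open Bundle Set Filter

set_option linter.unusedSectionVars false

/-! ### Smoothness of superposition operators on spaces of continuous functions -/

section Postcomposition

set_option synthInstance.maxHeartbeats 400000
set_option maxHeartbeats 800000

universe u v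

variable {K : Type v} [TopologicalSpace K] [CompactSpace K]
  {E F : Type*} [NormedAddCommGroup E] [NormedSpace ℝ E] [NormedAddCommGroup F] [NormedSpace ℝ F]

/-- Pointwise application of operator-valued continuous functions, as a bilinear map. -/
def pointwiseApply : C(K, E →L[ℝ] F) →L[ℝ] C(K, E) →L[ℝ] C(K, F) :=
  LinearMap.mkContinuous₂
    (LinearMap.mk₂ ℝ (fun (A : C(K, E →L[ℝ] F)) (u : C(K, E)) ↦
        (⟨fun s ↦ A s (u s), A.continuous.clm_apply u.continuous⟩ : C(K, F)))
      (fun _ _ _ ↦ by ext; simp) (fun _ _ _ ↦ by ext; simp)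
      (fun _ _ _ ↦ by ext; simp) (fun _ _ _ ↦ by ext; simp)) 1
    (fun A u ↦ by
      rw [one_mul, ContinuousMap.norm_le _ (by positivity)]
      intro s
      exact (A s).le_of_opNorm_le_of_le (A.norm_coe_le_norm s) (u.norm_coe_le_norm s))

/-- The mean value inequality is applied at each point of `K`. The bound is uniform in the point
because postcomposition with `f'` is continuous for the sup norm. -/
theorem hasFDerivAt_postcomp {f : E → F} {f' : E → E →L[ℝ] F} (hf : Continuous f)
    (hf' : Continuous f') (h : ∀ x, HasFDerivAt f (f' x) x) (u : C(K, E)) :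
    HasFDerivAt (fun u : C(K, E) ↦ (⟨f, hf⟩ : C(E, F)).comp u)
      (pointwiseApply ((⟨f', hf'⟩ : C(E, E →L[ℝ] F)).comp u)) u := by
  rw [hasFDerivAt_iff_isLittleO, Asymptotics.isLittleO_iff]
  intro c hc
  have hcont := (ContinuousMap.continuous_postcomp (X := K) (⟨f', hf'⟩ : C(E, E →L[ℝ] F)))
  obtain ⟨δ, hδ, H⟩ :=
    (Metric.continuous_iff (α := C(K, E)) (β := C(K, E →L[ℝ] F))).1 hcont u c hc
  filter_upwards [Metric.ball_mem_nhds u hδ] with w hw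
  rw [ContinuousMap.norm_le _ (by positivity)]
  intro s
  have key : ∀ y ∈ segment ℝ (u s) (w s), ‖f' y - f' (u s)‖ ≤ c := by
    intro y hy
    obtain ⟨r, hr, rfl⟩ := (segment_eq_image_lineMap ℝ (u s) (w s)) ▸ hy
    -- The point `y` is the value at `s` of the function `u + r • (w - u)`, which lies in the ball
    -- around `u`; so one `δ` serves all `s`.
    have h1 : dist (u + r • (w - u)) u < δ := by
      rw [dist_eq_norm, add_sub_cancel_left, norm_smul]
      refine lt_of_le_of_lt ?_ (mem_ball_iff_norm.1 hw)
      have : ‖r‖ ≤ 1 := by rw [Real.norm_eq_abs, abs_le]; constructor <;> linarith [hr.1, hr.2]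
      nlinarith [norm_nonneg (w - u)]
    have h2 := (ContinuousMap.dist_lt_iff hc).1 (H _ h1) s
    rw [dist_eq_norm] at h2
    refine le_of_eq_of_le ?_ h2.le
    simp [AffineMap.lineMap_apply, add_comm]
  have := (convex_segment (u s) (w s)).norm_image_sub_le_of_norm_hasFDerivWithin_le'
    (fun y _ ↦ (h y).hasFDerivWithinAt) key (left_mem_segment ℝ _ _) (right_mem_segment ℝ _ _)
  refine this.trans ?_
  gcongr
  exact (w - u).norm_coe_le_norm s

/-- The derivative is postcomposition with `fderiv ℝ f` followed by the bounded linear map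
`pointwiseApply`, so induction on the order works. It replaces `F` by `E →L[ℝ] F`, whence the common
universe. -/
theorem contDiff_postcomp {E F : Type u} [NormedAddCommGroup E] [NormedSpace ℝ E]
    [NormedAddCommGroup F] [NormedSpace ℝ F] {f : E → F} (hf : ContDiff ℝ ∞ f) :
    ContDiff ℝ ∞ (fun u : C(K, E) ↦ (⟨f, hf.continuous⟩ : C(E, F)).comp u) := by
  rw [contDiff_infty]
  intro n
  induction n generalizing F with
  | zero => exact contDiff_zero.2 (ContinuousMap.continuous_postcomp _)
  | succ n ih =>
    have hf' : ContDiff ℝ ∞ (fderiv ℝ f) := hf.fderiv_right (by simp)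
    refine contDiff_succ_iff_hasFDerivAt.2 ⟨_, pointwiseApply.contDiff.comp (ih hf'), fun u ↦ ?_⟩
    exact hasFDerivAt_postcomp _ _ (fun x ↦ (hf.differentiable (by simp) x).hasFDerivAt) u

end Postcomposition

/-! ### Globalizing smooth functions by cutoffs -/

section Cutoff

variable {E F : Type*} [NormedAddCommGroup E] [NormedSpace ℝ E] [FiniteDimensional ℝ E]
  [NormedAddCommGroup F] [NormedSpace ℝ F]

/-- A smooth function on an open set agrees near a given compact subset with a globally smooth
function. -/
theorem exists_contDiff_eqOn_nhds_of_isCompact {f : E → F} {V C : Set E} (hV : IsOpen V)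
    (hC : IsCompact C) (hCV : C ⊆ V) (hf : ContDiffOn ℝ ∞ f V) :
    ∃ g : E → F, ContDiff ℝ ∞ g ∧ ∃ U, IsOpen U ∧ C ⊆ U ∧ U ⊆ V ∧ EqOn g f U := by
  obtain ⟨C', hC', hCC', hC'V⟩ := exists_compact_between hC hV hCV
  obtain ⟨χ, h1, h0, -⟩ := exists_contMDiffMap_one_nhds_of_subset_interior 𝓘(ℝ, E) (n := (⊤ : ℕ∞))
    hC.isClosed hCC'
  have hχ : ContDiff ℝ ∞ χ := contMDiff_iff_contDiff.1 χ.contMDiff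
  rw [Filter.Eventually, mem_nhdsSet_iff_exists] at h1
  obtain ⟨U, hU, hCU, hU1⟩ := h1
  refine ⟨fun x ↦ χ x • f x, ?_, U ∩ V, hU.inter hV, subset_inter hCU hCV,
    inter_subset_right, fun x hx ↦ ?_⟩
  · rw [contDiff_iff_contDiffAt]
    intro x
    by_cases hx : x ∈ V
    · exact hχ.contDiffAt.smul (hf.contDiffAt (hV.mem_nhds hx))
    · have : ∀ᶠ y in 𝓝 x, χ y • f y = 0 := by
        filter_upwards [hC'.isClosed.isOpen_compl.mem_nhds (fun h ↦ hx (hC'V h))] with y hy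
        rw [h0 y hy, zero_smul]
      exact (contDiffAt_const (c := (0 : F))).congr_of_eventuallyEq this
  · have : χ x = 1 := hU1 hx.1
    simp [this]

end Cutoff

/-! ### Integration as a bounded operator on continuous curves -/

section IntegralOperator

variable {E : Type*} [NormedAddCommGroup E] [NormedSpace ℝ E]

/-- The compact time interval on which curves are considered. -/
abbrev TimeInterval : Type := Icc (-2 : ℝ) 2

/-- Restriction of a time to the compact time interval. -/
def clampTime : ℝ → TimeInterval := projIcc (-2) 2 (by norm_num)

theorem continuous_clampTime : Continuous clampTime := continuous_projIcc

theorem coe_clampTime {s : ℝ} (hs : s ∈ Icc (-2 : ℝ) 2) : (clampTime s : ℝ) = s := by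
  rw [clampTime, projIcc_of_mem _ hs]

omit [NormedSpace ℝ E] in
theorem continuous_comp_clampTime (u : C(TimeInterval, E)) :
    Continuous (fun s ↦ u (clampTime s)) := u.continuous.comp continuous_clampTime

/-- The operator of integration from time zero. -/
def integralOperator [CompleteSpace E] : C(TimeInterval, E) →L[ℝ] C(TimeInterval, E) :=
  LinearMap.mkContinuous
    { toFun := fun u ↦ ⟨fun t ↦ ∫ s in (0 : ℝ)..t, u (clampTime s),
        (intervalIntegral.continuous_primitive
          (fun _ _ ↦ (continuous_comp_clampTime u).intervalIntegrable _ _) 0).comp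
            continuous_subtype_val⟩
      map_add' := fun u w ↦ by
        ext t
        simp only [ContinuousMap.add_apply, ContinuousMap.coe_mk]
        exact intervalIntegral.integral_add ((continuous_comp_clampTime u).intervalIntegrable _ _)
          ((continuous_comp_clampTime w).intervalIntegrable _ _)
      map_smul' := fun c u ↦ by
        ext t
        simp }
    2 (fun u ↦ by
      rw [ContinuousMap.norm_le _ (by positivity)]
      intro t
      have h := intervalIntegral.norm_integral_le_of_norm_le_const (a := 0) (b := t)
        (f := fun s ↦ u (clampTime s)) (C := ‖u‖) (fun s _ ↦ u.norm_coe_le_norm _)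
      refine h.trans ?_
      rw [mul_comm, sub_zero]
      gcongr
      exact abs_le.2 t.2)

theorem integralOperator_apply [CompleteSpace E] (u : C(TimeInterval, E)) (t : TimeInterval) :
    integralOperator u t = ∫ s in (0 : ℝ)..t, u (clampTime s) := rfl

/-- Constant functions, as a continuous linear map. -/
def constCLM (K : Type*) [TopologicalSpace K] [CompactSpace K] : E →L[ℝ] C(K, E) :=
  LinearMap.mkContinuous
    { toFun := fun x ↦ ContinuousMap.const K x
      map_add' := fun _ _ ↦ rfl
      map_smul' := fun _ _ ↦ rfl } 1
    (fun x ↦ by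
      rw [ContinuousMap.norm_le _ (by positivity)]
      exact fun s ↦ (one_mul ‖x‖).ge)

@[simp]
theorem constCLM_apply (K : Type*) [TopologicalSpace K] [CompactSpace K] (x : E) (s : K) :
    constCLM K x s = x := rfl

end IntegralOperator

/-! ### Smooth dependence of integrals on parameters -/

section ParametricIntegral

universe u

variable {Z : Type u} [NormedAddCommGroup Z] [NormedSpace ℝ Z] [FiniteDimensional ℝ Z]

omit [FiniteDimensional ℝ Z] in
-- The integral is a composite of smooth maps: an affine map `z ↦ (s ↦ (s, z))` into a space of
-- curves, postcomposition with `k`, integration, and evaluation at time one. Lifting `ℝ` meets the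
-- universe constraint of `contDiff_postcomp`.
theorem contDiff_intervalIntegral_of_contDiff {k : ℝ × Z → ℝ} (hk : ContDiff ℝ ∞ k) :
    ContDiff ℝ ∞ (fun z ↦ ∫ s in (0 : ℝ)..1, k (s, z)) := by
  let f : ULift.{u} ℝ × Z → ULift.{u} ℝ := fun x ↦ ULift.up (k (x.1.down, x.2))
  let L := ContinuousLinearEquiv.ulift (R₁ := ℝ) (M₁ := ℝ)
  have hup : ContDiff ℝ ∞ (ULift.up : ℝ → ULift.{u} ℝ) := L.symm.contDiff
  have hdown : ContDiff ℝ ∞ (ULift.down : ULift.{u} ℝ → ℝ) := L.contDiff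
  have hf : ContDiff ℝ ∞ f :=
    hup.comp (hk.comp ((hdown.comp contDiff_fst).prodMk contDiff_snd))
  -- Adding the constant curve `(0, z)` to `τ` gives the curve `s ↦ (s, z)`.
  let τ : C(TimeInterval, ULift.{u} ℝ × Z) :=
    ⟨fun s ↦ (ULift.up s, 0), by fun_prop⟩
  have hg : ContDiff ℝ ∞ (fun z : Z ↦ τ + constCLM TimeInterval ((0 : ULift.{u} ℝ), z)) :=
    contDiff_const.add ((constCLM TimeInterval).contDiff.comp
      ((contDiff_const (c := (0 : ULift.{u} ℝ))).prodMk (contDiff_id (E := Z))))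
  have h1 : (1 : ℝ) ∈ Icc (-2 : ℝ) 2 := by norm_num
  let ev : C(TimeInterval, ULift.{u} ℝ) →L[ℝ] ULift.{u} ℝ := ContinuousMap.evalCLM ℝ ⟨1, h1⟩
  have := hdown.comp (ev.contDiff.comp (integralOperator.contDiff.comp
    ((contDiff_postcomp (K := TimeInterval) hf).comp hg)))
  convert this using 1
  funext z
  symm
  change L (∫ s in (0 : ℝ)..1, _) = _
  rw [← ContinuousLinearEquiv.coe_coe, ← ContinuousLinearMap.intervalIntegral_comp_comm]
  · refine intervalIntegral.integral_congr fun s hs ↦ ?_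
    rw [uIcc_of_le zero_le_one] at hs
    have : (clampTime s : ℝ) = s := coe_clampTime ⟨by linarith [hs.1], by linarith [hs.2]⟩
    simp [L, f, τ, this]
    rfl
  · exact (continuous_comp_clampTime _).intervalIntegrable _ _

/-- A cutoff makes `k` globally smooth without changing it near the compact segment over `z₀`; by
the tube lemma the integrals then agree for all `z` near `z₀`. -/
theorem contDiffAt_intervalIntegral {k : ℝ × Z → ℝ} {V : Set (ℝ × Z)} (hV : IsOpen V)
    (hk : ContDiffOn ℝ ∞ k V) {z₀ : Z} (h : ∀ s ∈ Icc (0 : ℝ) 1, (s, z₀) ∈ V) :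
    ContDiffAt ℝ ∞ (fun z ↦ ∫ s in (0 : ℝ)..1, k (s, z)) z₀ := by
  have hC : IsCompact (Icc (0 : ℝ) 1 ×ˢ {z₀}) := isCompact_Icc.prod isCompact_singleton
  obtain ⟨g, hg, U, hU, hCU, -, hgU⟩ := exists_contDiff_eqOn_nhds_of_isCompact hV hC
    (by rintro ⟨s, z⟩ ⟨hs, rfl⟩; exact h s hs) hk
  obtain ⟨A, W, -, hW, hA, hzW, hAW⟩ :=
    generalized_tube_lemma isCompact_Icc isCompact_singleton hU hCU
  refine (contDiff_intervalIntegral_of_contDiff hg).contDiffAt.congr_of_eventuallyEq ?_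
  filter_upwards [hW.mem_nhds (hzW rfl)] with z hz
  refine intervalIntegral.integral_congr fun s hs ↦ ?_
  rw [uIcc_of_le zero_le_one] at hs
  exact (hgU (hAW ⟨hA hs, hz⟩)).symm

end ParametricIntegral

/-! ### Local flows by the implicit function theorem -/

section LocalFlow

universe u

variable {E : Type u} [NormedAddCommGroup E] [NormedSpace ℝ E] [CompleteSpace E]

/-- The solutions `s ↦ S (τ, x) s` of `u' = τ V(u)`, `u 0 = x`, exist on `(-2, 2)` for `τ` near `0`
and depend smoothly on `(τ, x)`. -/
theorem exists_smooth_localFlow {V : E → E} (hV : ContDiff ℝ ∞ V) (x₀ : E) :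
    ∃ S : ℝ × E → ℝ → E, ContDiffAt ℝ ∞ (fun z ↦ S z 1) (0, x₀) ∧
      ∀ r > 0, ∀ᶠ z in 𝓝 ((0 : ℝ), x₀), S z 0 = z.2 ∧
        ∀ s ∈ Ioo (-2 : ℝ) 2, HasDerivAt (S z) (z.1 • V (S z s)) s ∧ S z s ∈ Metric.ball x₀ r := by
  let N : C(TimeInterval, E) → C(TimeInterval, E) := fun u ↦ (⟨V, hV.continuous⟩ : C(E, E)).comp u
  have hN : ContDiff ℝ ∞ N := contDiff_postcomp hV
  -- The zeros of `G` are the solutions of the integral equation `u = x + τ ∫ V(u)`.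
  let G : (ℝ × E) × C(TimeInterval, E) → C(TimeInterval, E) := fun p ↦
    p.2 - constCLM TimeInterval p.1.2 - p.1.1 • integralOperator (N p.2)
  have hc : ContDiff ℝ ∞ (fun p : (ℝ × E) × C(TimeInterval, E) ↦ constCLM TimeInterval p.1.2) :=
    (constCLM (E := E) TimeInterval).contDiff.comp (contDiff_snd.comp contDiff_fst)
  have hI : ContDiff ℝ ∞ (fun p : (ℝ × E) × C(TimeInterval, E) ↦
      p.1.1 • integralOperator (N p.2)) :=
    (contDiff_fst.comp contDiff_fst).smul
      (integralOperator.contDiff.comp (hN.comp contDiff_snd))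
  have hG : ContDiff ℝ ∞ G := (contDiff_snd.sub hc).sub hI
  let u₀ : C(TimeInterval, E) := constCLM TimeInterval x₀
  have hG0 : G ((0, x₀), u₀) = 0 := by simp [G, u₀]
  have hcd : ContDiffAt ℝ ∞ G ((0, x₀), u₀) := hG.contDiffAt
  -- At `τ = 0` the map `G` is `u ↦ u - x`, so its partial derivative in `u` is the identity
  -- whatever `V` is.
  have hid : fderiv ℝ G ((0, x₀), u₀) ∘L .inr ℝ (ℝ × E) C(TimeInterval, E)
      = ContinuousLinearMap.id ℝ _ := by
    have h1 : HasFDerivAt (fun w : C(TimeInterval, E) ↦ (((0 : ℝ), x₀), w))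
        (.inr ℝ (ℝ × E) C(TimeInterval, E)) u₀ := hasFDerivAt_prodMk_right _ _
    have h2 := (hG.differentiable (by simp) ((0, x₀), u₀)).hasFDerivAt.comp u₀ h1
    have h3 : HasFDerivAt (G ∘ fun w : C(TimeInterval, E) ↦ (((0 : ℝ), x₀), w))
        (ContinuousLinearMap.id ℝ _) u₀ := by
      have : (G ∘ fun w : C(TimeInterval, E) ↦ (((0 : ℝ), x₀), w)) = fun w ↦ w - u₀ := by
        funext w; simp [G, u₀]
      rw [this]
      exact (hasFDerivAt_id u₀).sub_const u₀
    exact h2.unique h3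
  have hinv : (fderiv ℝ G ((0, x₀), u₀) ∘L .inr ℝ (ℝ × E) C(TimeInterval, E)).IsInvertible := by
    rw [hid]
    exact ⟨ContinuousLinearEquiv.refl ℝ _, rfl⟩
  let ψ := hcd.implicitFunction (by simp) hinv
  have hψ : ContDiffAt ℝ ∞ ψ (0, x₀) := hcd.contDiffAt_implicitFunction (by simp) hinv
  have hψ0 : ψ (0, x₀) = u₀ := hcd.implicitFunction_apply_self (by simp) hinv
  have hsol : ∀ᶠ z in 𝓝 ((0 : ℝ), x₀), G (z, ψ z) = 0 := by
    have := hcd.eventually_apply_implicitFunction (by simp) hinv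
    rwa [hG0] at this
  refine ⟨fun z s ↦ ψ z (clampTime s), ?_, fun r hr ↦ ?_⟩
  · exact (ContinuousMap.evalCLM ℝ (clampTime 1) :
      C(TimeInterval, E) →L[ℝ] E).contDiff.contDiffAt.comp (0, x₀) hψ
  have hball : ∀ᶠ z in 𝓝 ((0 : ℝ), x₀), ψ z ∈ Metric.ball u₀ r :=
    hψ.continuousAt.eventually_mem (by rw [hψ0]; exact Metric.ball_mem_nhds _ hr)
  filter_upwards [hsol, hball] with z hz hzr
  have key : ∀ s ∈ Icc (-2 : ℝ) 2, ψ z (clampTime s) =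
      z.2 + z.1 • ∫ σ in (0 : ℝ)..s, V (ψ z (clampTime σ)) := by
    intro s hs
    have h := DFunLike.congr_fun hz (clampTime s)
    simp only [G, ContinuousMap.sub_apply, ContinuousMap.smul_apply, constCLM_apply,
      integralOperator_apply, ContinuousMap.zero_apply, coe_clampTime hs] at h
    rw [sub_sub, sub_eq_zero] at h
    exact h
  refine ⟨by rw [key 0 (by norm_num)]; simp, fun s hs ↦ ⟨?_, ?_⟩⟩
  · have hcont : Continuous fun σ ↦ V (ψ z (clampTime σ)) :=
      hV.continuous.comp (continuous_comp_clampTime (ψ z))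
    have h1 := ((hcont.integral_hasStrictDerivAt 0 s).hasDerivAt.const_smul z.1).const_add z.2
    refine h1.congr_of_eventuallyEq ?_
    filter_upwards [Icc_mem_nhds hs.1 hs.2] with σ hσ using key σ hσ
  · exact (ContinuousMap.dist_apply_le_dist (f := ψ z) (g := u₀) (clampTime s)).trans_lt hzr

end LocalFlow

/-! ### The exterior derivative on vector spaces -/

section VectorCalculus

variable {E F : Type*} [NormedAddCommGroup E] [NormedSpace ℝ E]
  [NormedAddCommGroup F] [NormedSpace ℝ F]

/-- The exterior derivative of a one-form on a vector space. -/
def vectorExtDeriv (τ : E → E →L[ℝ] ℝ) (x u v : E) : ℝ :=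
  fderiv ℝ τ x u v - fderiv ℝ τ x v u

/-- The exterior derivative commutes with pull-backs. -/
theorem vectorExtDeriv_pullback {τ : F → F →L[ℝ] ℝ} {g : E → F} {x : E}
    (hτ : DifferentiableAt ℝ τ (g x)) (hg : ContDiffAt ℝ ∞ g x) (u v : E) :
    vectorExtDeriv (fun y ↦ (τ (g y)).comp (fderiv ℝ g y)) x u v =
      vectorExtDeriv τ (g x) (fderiv ℝ g x u) (fderiv ℝ g x v) := by
  have hg1 : DifferentiableAt ℝ g x := hg.differentiableAt (by simp)
  have hg2 : DifferentiableAt ℝ (fderiv ℝ g) x :=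
    (hg.fderiv_right (m := ∞) (by simp)).differentiableAt (by simp)
  have hτg : HasFDerivAt (fun y ↦ τ (g y)) ((fderiv ℝ τ (g x)).comp (fderiv ℝ g x)) x :=
    hτ.hasFDerivAt.comp x hg1.hasFDerivAt
  have h := hτg.clm_comp hg2.hasFDerivAt
  -- The terms with second derivatives of `g` cancel by symmetry.
  have hsymm : IsSymmSndFDerivAt ℝ g x :=
    hg.isSymmSndFDerivAt (by
      rw [minSmoothness_of_isRCLikeNormedField]
      exact WithTop.coe_le_coe.2 (le_top : (2 : ℕ∞) ≤ ⊤))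
  rw [vectorExtDeriv, vectorExtDeriv, h.fderiv]
  simp [hsymm.eq u v]

end VectorCalculus

/-! ### Forms, functions and curves in charts -/

section Charts

variable {E : Type*} [NormedAddCommGroup E] [NormedSpace ℝ E]
  {P : Type*} [TopologicalSpace P] [ChartedSpace E P]
  {F : Type*} [NormedAddCommGroup F] [NormedSpace ℝ F]

/-- The derivative at `q` of the chart centred at `x`. -/
def chartDeriv (x q : P) : TangentSpace 𝓘(ℝ, E) q →L[ℝ] E :=
  mvfderiv 𝓘(ℝ, E) (extChartAt 𝓘(ℝ, E) x) q

/-- The derivative of the inverse of the chart centred at `x`. -/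
def chartSymmDeriv (x : P) (y : E) :
    E →L[ℝ] TangentSpace 𝓘(ℝ, E) ((extChartAt 𝓘(ℝ, E) x).symm y) :=
  (mfderiv 𝓘(ℝ, E) 𝓘(ℝ, E) (extChartAt 𝓘(ℝ, E) x).symm y).comp
    (NormedSpace.fromTangentSpace (𝕜 := ℝ) y).symm.toContinuousLinearMap

theorem chartExpr_apply (θ : OneForm E P) (x : P) (y w : E) :
    chartExpr θ x y w = θ ((extChartAt 𝓘(ℝ, E) x).symm y) (chartSymmDeriv x y w) := rfl

theorem extDerivOneForm_eq (θ : OneForm E P) (x : P) (u v : TangentSpace 𝓘(ℝ, E) x) :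
    extDerivOneForm θ x u v = vectorExtDeriv (chartExpr θ x) (extChartAt 𝓘(ℝ, E) x x)
      (chartDeriv x x u) (chartDeriv x x v) := rfl

theorem isOpen_chart_target (x : P) : IsOpen (extChartAt 𝓘(ℝ, E) x).target :=
  isOpen_extChartAt_target x

theorem exists_chart_symm_eq {x q : P} (hq : q ∈ (extChartAt 𝓘(ℝ, E) x).source) :
    ∃ y ∈ (extChartAt 𝓘(ℝ, E) x).target, (extChartAt 𝓘(ℝ, E) x).symm y = q :=
  ⟨_, (extChartAt 𝓘(ℝ, E) x).map_source hq, (extChartAt 𝓘(ℝ, E) x).left_inv hq⟩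

theorem mvfderiv_comp_mfderiv {E' : Type*} [NormedAddCommGroup E'] [NormedSpace ℝ E']
    {P' : Type*} [TopologicalSpace P'] [ChartedSpace E' P'] {f : P → F} {φ : P' → P} {p : P'}
    (hf : MDifferentiableAt 𝓘(ℝ, E) 𝓘(ℝ, F) f (φ p))
    (hφ : MDifferentiableAt 𝓘(ℝ, E') 𝓘(ℝ, E) φ p) (u : TangentSpace 𝓘(ℝ, E') p) :
    mvfderiv 𝓘(ℝ, E') (f ∘ φ) p u =
      mvfderiv 𝓘(ℝ, E) f (φ p) (mfderiv 𝓘(ℝ, E') 𝓘(ℝ, E) φ p u) := by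
  have := congrArg (fun A ↦ A u) (mfderiv_comp p hf hφ)
  exact this

variable [IsManifold 𝓘(ℝ, E) ∞ P]

theorem contMDiffAt_chart {x q : P} (hq : q ∈ (extChartAt 𝓘(ℝ, E) x).source) :
    ContMDiffAt 𝓘(ℝ, E) 𝓘(ℝ, E) ∞ (extChartAt 𝓘(ℝ, E) x) q :=
  contMDiffAt_extChartAt' (by rwa [extChartAt_source] at hq)

theorem contMDiffAt_chart_symm {x : P} {y : E} (hy : y ∈ (extChartAt 𝓘(ℝ, E) x).target) :
    ContMDiffAt 𝓘(ℝ, E) 𝓘(ℝ, E) ∞ (extChartAt 𝓘(ℝ, E) x).symm y :=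
  (contMDiffOn_extChartAt_symm x).contMDiffAt ((isOpen_chart_target x).mem_nhds hy)

theorem chartDeriv_chartSymmDeriv {x : P} {y : E} (hy : y ∈ (extChartAt 𝓘(ℝ, E) x).target)
    (w : E) : chartDeriv x ((extChartAt 𝓘(ℝ, E) x).symm y) (chartSymmDeriv x y w) = w := by
  have h := mfderiv_extChartAt_comp_mfderivWithin_extChartAt_symm (I := 𝓘(ℝ, E)) hy
  rw [ModelWithCorners.range_eq_univ, mfderivWithin_univ] at h
  exact congrArg (fun A ↦ A w) h

theorem chartSymmDeriv_chartDeriv {x : P} {y : E} (hy : y ∈ (extChartAt 𝓘(ℝ, E) x).target)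
    (u : TangentSpace 𝓘(ℝ, E) ((extChartAt 𝓘(ℝ, E) x).symm y)) :
    chartSymmDeriv x y (chartDeriv x ((extChartAt 𝓘(ℝ, E) x).symm y) u) = u := by
  have h := mfderivWithin_extChartAt_symm_comp_mfderiv_extChartAt (I := 𝓘(ℝ, E)) hy
  rw [ModelWithCorners.range_eq_univ, mfderivWithin_univ] at h
  exact congrArg (fun A ↦ A u) h

theorem chartExpr_chartDeriv (θ : OneForm E P) {x q : P}
    (hq : q ∈ (extChartAt 𝓘(ℝ, E) x).source) (u : TangentSpace 𝓘(ℝ, E) q) :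
    chartExpr θ x (extChartAt 𝓘(ℝ, E) x q) (chartDeriv x q u) = θ q u := by
  obtain ⟨y, hy, rfl⟩ := exists_chart_symm_eq hq
  rw [(extChartAt 𝓘(ℝ, E) x).right_inv hy, chartExpr_apply, chartSymmDeriv_chartDeriv hy]

theorem chartDeriv_surjective {x q : P} (hq : q ∈ (extChartAt 𝓘(ℝ, E) x).source) :
    Function.Surjective (chartDeriv x q : TangentSpace 𝓘(ℝ, E) q → E) := by
  obtain ⟨y, hy, rfl⟩ := exists_chart_symm_eq hq
  exact Function.RightInverse.surjective (chartDeriv_chartSymmDeriv hy)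

theorem mvfderiv_eq_fderiv_chart {f : P → F} {x q : P}
    (hq : q ∈ (extChartAt 𝓘(ℝ, E) x).source)
    (hf : MDifferentiableAt 𝓘(ℝ, E) 𝓘(ℝ, F) f q) (u : TangentSpace 𝓘(ℝ, E) q) :
    mvfderiv 𝓘(ℝ, E) f q u = fderiv ℝ (f ∘ (extChartAt 𝓘(ℝ, E) x).symm)
      (extChartAt 𝓘(ℝ, E) x q) (chartDeriv x q u) := by
  obtain ⟨y, hy, rfl⟩ := exists_chart_symm_eq hq
  rw [(extChartAt 𝓘(ℝ, E) x).right_inv hy]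
  have h := mvfderiv_comp_mfderiv (f := f) (φ := (extChartAt 𝓘(ℝ, E) x).symm) (p := y) hf
    ((contMDiffAt_chart_symm hy).mdifferentiableAt (by simp))
    ((NormedSpace.fromTangentSpace (𝕜 := ℝ) y).symm
      (chartDeriv x ((extChartAt 𝓘(ℝ, E) x).symm y) u))
  have h2 : mfderiv 𝓘(ℝ, E) 𝓘(ℝ, E) (extChartAt 𝓘(ℝ, E) x).symm y
    ((NormedSpace.fromTangentSpace (𝕜 := ℝ) y).symm
      (chartDeriv x ((extChartAt 𝓘(ℝ, E) x).symm y) u)) = u := chartSymmDeriv_chartDeriv hy u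
  rw [h2] at h
  rw [← h, mvfderiv, mfderiv_eq_fderiv]
  rfl

theorem chartDeriv_mfderiv {φ : P → P} {x x' q : P} (hq : q ∈ (extChartAt 𝓘(ℝ, E) x).source)
    (hq' : φ q ∈ (extChartAt 𝓘(ℝ, E) x').source)
    (hφ : MDifferentiableAt 𝓘(ℝ, E) 𝓘(ℝ, E) φ q) (u : TangentSpace 𝓘(ℝ, E) q) :
    chartDeriv x' (φ q) (mfderiv 𝓘(ℝ, E) 𝓘(ℝ, E) φ q u) =
      fderiv ℝ (extChartAt 𝓘(ℝ, E) x' ∘ φ ∘ (extChartAt 𝓘(ℝ, E) x).symm)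
        (extChartAt 𝓘(ℝ, E) x q) (chartDeriv x q u) := by
  have h1 : MDifferentiableAt 𝓘(ℝ, E) 𝓘(ℝ, E) (extChartAt 𝓘(ℝ, E) x') (φ q) :=
    (contMDiffAt_chart hq').mdifferentiableAt (by simp)
  rw [chartDeriv, ← mvfderiv_comp_mfderiv h1 hφ, mvfderiv_eq_fderiv_chart hq (h1.comp q hφ)]
  rfl

theorem hasDerivAt_chart_comp {c : ℝ → P} {t : ℝ} {v : TangentSpace 𝓘(ℝ, E) (c t)} {x : P}
    (hx : c t ∈ (extChartAt 𝓘(ℝ, E) x).source)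
    (hc : HasMFDerivAt 𝓘(ℝ, ℝ) 𝓘(ℝ, E) c t ((1 : ℝ →L[ℝ] ℝ).smulRight v)) :
    HasDerivAt (extChartAt 𝓘(ℝ, E) x ∘ c) (chartDeriv x (c t) v) t := by
  have h1 : MDifferentiableAt 𝓘(ℝ, E) 𝓘(ℝ, E) (extChartAt 𝓘(ℝ, E) x) (c t) :=
    (contMDiffAt_chart hx).mdifferentiableAt (by simp)
  have h2 : HasFDerivAt (extChartAt 𝓘(ℝ, E) x ∘ c)
      ((1 : ℝ →L[ℝ] ℝ).smulRight (chartDeriv x (c t) v)) t := by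
    have h3 : HasMFDerivAt 𝓘(ℝ, ℝ) 𝓘(ℝ, E) (extChartAt 𝓘(ℝ, E) x ∘ c) t
        ((1 : ℝ →L[ℝ] ℝ).smulRight (chartDeriv x (c t) v) : ℝ →L[ℝ] E) := by
      refine (h1.hasMFDerivAt.comp t hc).congr_mfderiv ?_
      ext
      exact (chartDeriv x (c t)).map_smul (1 : ℝ) v
    exact h3.hasFDerivAt
  simpa using h2.hasDerivAt

/-- A curve with the given derivative in a chart. -/
theorem hasMFDerivAt_chart_symm_comp {c : ℝ → E} {t : ℝ} {v : E} {x : P}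
    (hx : c t ∈ (extChartAt 𝓘(ℝ, E) x).target) (hc : HasDerivAt c v t) :
    HasMFDerivAt 𝓘(ℝ, ℝ) 𝓘(ℝ, E) ((extChartAt 𝓘(ℝ, E) x).symm ∘ c) t
      ((1 : ℝ →L[ℝ] ℝ).smulRight (chartSymmDeriv x (c t) v)) := by
  have h1 : MDifferentiableAt 𝓘(ℝ, E) 𝓘(ℝ, E) (extChartAt 𝓘(ℝ, E) x).symm (c t) :=
    (contMDiffAt_chart_symm hx).mdifferentiableAt (by simp)
  have h2 := h1.hasMFDerivAt.comp t hc.hasFDerivAt.hasMFDerivAt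
  refine h2.congr_mfderiv ?_
  ext
  exact (chartSymmDeriv x (c t)).map_smul (1 : ℝ) v

/-- In finite dimension it suffices to evaluate on a fixed vector `w`. The tangent map of the
inverse chart turns the constant field `w` into a smooth section along that map, and `θ` is paired
with this section. -/
theorem contDiffOn_chartExpr [FiniteDimensional ℝ E] {θ : OneForm E P} (hθ : IsSmoothOneForm θ)
    (x : P) : ContDiffOn ℝ ∞ (chartExpr θ x) (extChartAt 𝓘(ℝ, E) x).target := by
  rw [contDiffOn_clm_apply]
  intro w y hy
  refine ContDiffAt.contDiffWithinAt ?_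
  rw [← contMDiffAt_iff_contDiffAt]
  have hs := contMDiffAt_chart_symm (P := P) hy
  have h1 : ContMDiffAt 𝓘(ℝ, E) (𝓘(ℝ, E).prod 𝓘(ℝ, E)) ∞
      (fun z : E ↦ TotalSpace.mk' E (E := (TangentSpace 𝓘(ℝ, E) : P → Type _))
        ((extChartAt 𝓘(ℝ, E) x).symm z) (chartSymmDeriv x z w)) y := by
    have hT := ((contMDiffOn_extChartAt_symm (I := 𝓘(ℝ, E)) (n := ∞) x).contMDiffOn_tangentMapWithin
      (m := ∞) (by simp) (isOpen_chart_target x).uniqueMDiffOn).contMDiffAt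
        (x := (⟨y, w⟩ : TangentBundle 𝓘(ℝ, E) E)) (((isOpen_chart_target x).preimage
          (FiberBundle.continuous_proj E (TangentSpace 𝓘(ℝ, E)))).mem_nhds hy)
    have hw : ContMDiffAt 𝓘(ℝ, E) 𝓘(ℝ, E).tangent ∞
        (fun z : E ↦ (⟨z, w⟩ : TangentBundle 𝓘(ℝ, E) E)) y :=
      contMDiffAt_vectorSpace_iff_contDiffAt.2 contDiffAt_const
    refine (hT.comp y hw).congr_of_eventuallyEq ?_
    filter_upwards [(isOpen_chart_target x).mem_nhds hy] with z hz
    simp only [Function.comp, tangentMapWithin]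
    rw [mfderivWithin_of_isOpen (isOpen_chart_target x) hz]
    rfl
  have h2 := ContMDiffAt.clm_bundle_apply (E₂ := Bundle.Trivial P ℝ) (hθ.contMDiffAt.comp y hs) h1
  exact (Bundle.contMDiffAt_totalSpace.1 h2).2

end Charts

/-! ### Partial derivatives in time and space -/

section PartialDerivatives

variable {E F : Type*} [NormedAddCommGroup E] [NormedSpace ℝ E]
  [NormedAddCommGroup F] [NormedSpace ℝ F]

theorem fderiv_prod_right {g : ℝ × E → F} {t : ℝ} {y : E} (hg : DifferentiableAt ℝ g (t, y))
    (w : E) : fderiv ℝ (fun z ↦ g (t, z)) y w = fderiv ℝ g (t, y) (0, w) := by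
  have h : HasFDerivAt (fun z ↦ g (t, z)) _ y :=
    hg.hasFDerivAt.comp y (hasFDerivAt_prodMk_right t y)
  rw [h.fderiv]
  rfl

theorem hasDerivAt_prod_left {g : ℝ × E → F} {t : ℝ} {y : E}
    (hg : DifferentiableAt ℝ g (t, y)) :
    HasDerivAt (fun s ↦ g (s, y)) (fderiv ℝ g (t, y) (1, 0)) t := by
  have h : HasFDerivAt (fun s ↦ g (s, y)) _ t :=
    hg.hasFDerivAt.comp t (hasFDerivAt_prodMk_left t y)
  simpa using h.hasDerivAt

/-- This is the equality of mixed partial derivatives, read off from the symmetry of the second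
derivative of `g` on the vectors `(1, 0)` and `(0, w)`. -/
theorem hasDerivAt_fderiv_prod_right {g : ℝ × E → F} {t : ℝ} {y : E}
    (hg : ContDiffAt ℝ ∞ g (t, y)) (w : E) :
    HasDerivAt (fun s ↦ fderiv ℝ (fun z ↦ g (s, z)) y w)
      (fderiv ℝ (fun z ↦ deriv (fun s ↦ g (s, z)) t) y w) t := by
  have hd : ∀ᶠ z in 𝓝 (t, y), DifferentiableAt ℝ g z :=
    ((hg.of_le (m := 1) (by simp)).eventually (by simp)).mono
      fun z hz ↦ hz.differentiableAt (by simp)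
  have hg2 : DifferentiableAt ℝ (fderiv ℝ g) (t, y) :=
    (hg.fderiv_right (m := ∞) (by simp)).differentiableAt (by simp)
  have hsymm : IsSymmSndFDerivAt ℝ g (t, y) :=
    hg.isSymmSndFDerivAt (by
      rw [minSmoothness_of_isRCLikeNormedField]
      exact WithTop.coe_le_coe.2 (le_top : (2 : ℕ∞) ≤ ⊤))
  have h1 : (fun s ↦ fderiv ℝ (fun z ↦ g (s, z)) y w) =ᶠ[𝓝 t]
      fun s ↦ fderiv ℝ g (s, y) (0, w) := by
    filter_upwards [(Continuous.prodMk_left y).continuousAt.eventually hd] with s hs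
    exact fderiv_prod_right hs w
  have h2 : (fun z ↦ deriv (fun s ↦ g (s, z)) t) =ᶠ[𝓝 y] fun z ↦ fderiv ℝ g (t, z) (1, 0) := by
    filter_upwards [(Continuous.prodMk_right t).continuousAt.eventually hd] with z hz
    exact (hasDerivAt_prod_left hz).deriv
  rw [h2.fderiv_eq]
  refine HasDerivAt.congr_of_eventuallyEq ?_ h1
  have h3 := ((hasDerivAt_prod_left hg2).clm_apply (hasDerivAt_const t ((0 : ℝ), w)))
  refine h3.congr_deriv ?_
  have h4 : HasFDerivAt (fun z ↦ fderiv ℝ g (t, z) (1, 0)) _ y :=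
    (hg2.hasFDerivAt.comp y (hasFDerivAt_prodMk_right t y)).clm_apply
      (hasFDerivAt_const ((1 : ℝ), (0 : E)) y)
  rw [h4.fderiv]
  simp [hsymm.eq (1, 0) (0, w)]

end PartialDerivatives

/-! ### Naturality and chart independence of the exterior derivative -/

section Naturality

variable {E : Type*} [NormedAddCommGroup E] [NormedSpace ℝ E] [FiniteDimensional ℝ E]
  {P : Type*} [TopologicalSpace P] [ChartedSpace E P] [IsManifold 𝓘(ℝ, E) ∞ P]

theorem vectorExtDeriv_congr {τ τ' : E → E →L[ℝ] ℝ} {y : E} (h : τ =ᶠ[𝓝 y] τ') (u v : E) :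
    vectorExtDeriv τ y u v = vectorExtDeriv τ' y u v := by
  rw [vectorExtDeriv, vectorExtDeriv, h.fderiv_eq]

theorem contDiffAt_chartExpr {θ : OneForm E P} (hθ : IsSmoothOneForm θ) {x : P} {y : E}
    (hy : y ∈ (extChartAt 𝓘(ℝ, E) x).target) : ContDiffAt ℝ ∞ (chartExpr θ x) y :=
  (contDiffOn_chartExpr hθ x).contDiffAt ((isOpen_chart_target x).mem_nhds hy)

omit [FiniteDimensional ℝ E] in
theorem chartExpr_pullback (θ : OneForm E P) {φ : P → P} {x x' : P} {y : E}
    (hy : y ∈ (extChartAt 𝓘(ℝ, E) x).target)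
    (hφ : MDifferentiableAt 𝓘(ℝ, E) 𝓘(ℝ, E) φ ((extChartAt 𝓘(ℝ, E) x).symm y))
    (hy' : φ ((extChartAt 𝓘(ℝ, E) x).symm y) ∈ (extChartAt 𝓘(ℝ, E) x').source) :
    chartExpr (pullback φ θ) x y =
      (chartExpr θ x' ((extChartAt 𝓘(ℝ, E) x' ∘ φ ∘ (extChartAt 𝓘(ℝ, E) x).symm) y)).comp
        (fderiv ℝ (extChartAt 𝓘(ℝ, E) x' ∘ φ ∘ (extChartAt 𝓘(ℝ, E) x).symm) y) := by
  ext w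
  have hq := (extChartAt 𝓘(ℝ, E) x).map_target hy
  change θ _ (mfderiv 𝓘(ℝ, E) 𝓘(ℝ, E) φ _ (chartSymmDeriv x y w)) = _
  rw [← chartExpr_chartDeriv θ hy', chartDeriv_mfderiv hq hy' hφ, chartDeriv_chartSymmDeriv hy,
    (extChartAt 𝓘(ℝ, E) x).right_inv hy]
  rfl

omit [FiniteDimensional ℝ E] in
theorem eventually_mem_chart_target (p : P) :
    ∀ᶠ y in 𝓝 (extChartAt 𝓘(ℝ, E) p p), y ∈ (extChartAt 𝓘(ℝ, E) p).target :=
  (isOpen_chart_target p).mem_nhds ((extChartAt 𝓘(ℝ, E) p).map_source (mem_extChartAt_source p))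

/-- The chart at `φ p` may be centred at any point `x'`. With `φ = id` this freedom yields chart
independence, and with `x' = φ p` it yields naturality. -/
theorem extDerivOneForm_pullback_chart {θ : OneForm E P} (hθ : IsSmoothOneForm θ) {φ : P → P}
    (hφ : ContMDiff 𝓘(ℝ, E) 𝓘(ℝ, E) ∞ φ) {p x' : P}
    (hx' : φ p ∈ (extChartAt 𝓘(ℝ, E) x').source) (u v : TangentSpace 𝓘(ℝ, E) p) :
    extDerivOneForm (pullback φ θ) p u v =
      vectorExtDeriv (chartExpr θ x') (extChartAt 𝓘(ℝ, E) x' (φ p))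
        (chartDeriv x' (φ p) (mfderiv 𝓘(ℝ, E) 𝓘(ℝ, E) φ p u))
        (chartDeriv x' (φ p) (mfderiv 𝓘(ℝ, E) 𝓘(ℝ, E) φ p v)) := by
  have hp : p ∈ (extChartAt 𝓘(ℝ, E) p).source := mem_extChartAt_source p
  have hy₀ := (extChartAt 𝓘(ℝ, E) p).map_source hp
  have hsymm : ContMDiffAt 𝓘(ℝ, E) 𝓘(ℝ, E) ∞ (extChartAt 𝓘(ℝ, E) p).symm
    (extChartAt 𝓘(ℝ, E) p p) := contMDiffAt_chart_symm hy₀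
  have hinv : (extChartAt 𝓘(ℝ, E) p).symm (extChartAt 𝓘(ℝ, E) p p) = p :=
    (extChartAt 𝓘(ℝ, E) p).left_inv hp
  have hc : ContMDiffAt 𝓘(ℝ, E) 𝓘(ℝ, E) ∞ (φ ∘ (extChartAt 𝓘(ℝ, E) p).symm)
    (extChartAt 𝓘(ℝ, E) p p) := hφ.contMDiffAt.comp _ hsymm
  have hev : chartExpr (pullback φ θ) p =ᶠ[𝓝 (extChartAt 𝓘(ℝ, E) p p)] fun y ↦
      (chartExpr θ x' ((extChartAt 𝓘(ℝ, E) x' ∘ φ ∘ (extChartAt 𝓘(ℝ, E) p).symm) y)).comp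
        (fderiv ℝ (extChartAt 𝓘(ℝ, E) x' ∘ φ ∘ (extChartAt 𝓘(ℝ, E) p).symm) y) := by
    filter_upwards [eventually_mem_chart_target p, hc.continuousAt.eventually_mem
      ((isOpen_extChartAt_source (I := 𝓘(ℝ, E)) x').mem_nhds (by simpa [hinv] using hx'))] with y hy hy'
    exact chartExpr_pullback θ hy (hφ.mdifferentiable (by simp) _) hy'
  rw [extDerivOneForm_eq, vectorExtDeriv_congr hev]
  have hg : ContDiffAt ℝ ∞ (extChartAt 𝓘(ℝ, E) x' ∘ φ ∘ (extChartAt 𝓘(ℝ, E) p).symm)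
      (extChartAt 𝓘(ℝ, E) p p) := by
    refine contMDiffAt_iff_contDiffAt.1 ?_
    exact ContMDiffAt.comp _ (contMDiffAt_chart (by simpa [hinv] using hx')) hc
  have hval : (extChartAt 𝓘(ℝ, E) x' ∘ φ ∘ (extChartAt 𝓘(ℝ, E) p).symm) (extChartAt 𝓘(ℝ, E) p p)
      = extChartAt 𝓘(ℝ, E) x' (φ p) := by
    simp only [Function.comp_apply, hinv]
  rw [vectorExtDeriv_pullback _ hg, hval, chartDeriv_mfderiv hp hx' (hφ.mdifferentiable (by simp) _),
    chartDeriv_mfderiv hp hx' (hφ.mdifferentiable (by simp) _)]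
  rw [hval]
  exact (contDiffAt_chartExpr hθ ((extChartAt 𝓘(ℝ, E) x').map_source hx')).differentiableAt
    (by simp)

omit [FiniteDimensional ℝ E] [IsManifold 𝓘(ℝ, E) ∞ P] in
theorem pullback_id (θ : OneForm E P) : pullback id θ = θ := by
  funext p
  rw [pullback, mfderiv_id]
  rfl

/-- The exterior derivative of a one-form can be computed in any chart. -/
theorem extDerivOneForm_eq_chart {θ : OneForm E P} (hθ : IsSmoothOneForm θ) {q x : P}
    (hx : q ∈ (extChartAt 𝓘(ℝ, E) x).source) (u v : TangentSpace 𝓘(ℝ, E) q) :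
    extDerivOneForm θ q u v = vectorExtDeriv (chartExpr θ x) (extChartAt 𝓘(ℝ, E) x q)
      (chartDeriv x q u) (chartDeriv x q v) := by
  have h := extDerivOneForm_pullback_chart hθ (φ := id) contMDiff_id hx u v
  rw [pullback_id, mfderiv_id] at h
  exact h

theorem extDerivOneForm_pullback {θ : OneForm E P} (hθ : IsSmoothOneForm θ) {φ : P → P}
    (hφ : ContMDiff 𝓘(ℝ, E) 𝓘(ℝ, E) ∞ φ) (p : P) (u v : TangentSpace 𝓘(ℝ, E) p) :
    extDerivOneForm (pullback φ θ) p u v = extDerivOneForm θ (φ p)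
      (mfderiv 𝓘(ℝ, E) 𝓘(ℝ, E) φ p u) (mfderiv 𝓘(ℝ, E) 𝓘(ℝ, E) φ p v) :=
  extDerivOneForm_pullback_chart hθ hφ (mem_extChartAt_source _) u v

end Naturality

/-! ### Curves of maps in charts and the space-time pull-back -/

section SmoothCurves

variable {E : Type*} [NormedAddCommGroup E] [NormedSpace ℝ E] [FiniteDimensional ℝ E]
  {P : Type*} [TopologicalSpace P] [ChartedSpace E P] [IsManifold 𝓘(ℝ, E) ∞ P]
  {ψ : ℝ → P → P}

/-- The local expression of a curve of maps. -/
def localCurve (ψ : ℝ → P → P) (x x' : P) (z : ℝ × E) : E :=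
  extChartAt 𝓘(ℝ, E) x' (ψ z.1 ((extChartAt 𝓘(ℝ, E) x).symm z.2))

/-- The pull-back of the local expression of a one-form to `ℝ × E` along a curve of maps. -/
def localPullback (θ : OneForm E P) (ψ : ℝ → P → P) (x x' : P) (z : ℝ × E) : ℝ × E →L[ℝ] ℝ :=
  (chartExpr θ x' (localCurve ψ x x' z)).comp (fderiv ℝ (localCurve ψ x x') z)

omit [FiniteDimensional ℝ E] in
theorem contMDiffAt_chart_symm_prod {x : P} {t : ℝ} {y : E}
    (hy : y ∈ (extChartAt 𝓘(ℝ, E) x).target) :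
    ContMDiffAt 𝓘(ℝ, ℝ × E) (𝓘(ℝ, ℝ).prod 𝓘(ℝ, E)) ∞
      (fun z : ℝ × E ↦ (z.1, (extChartAt 𝓘(ℝ, E) x).symm z.2)) (t, y) := by
  refine ContMDiffAt.prodMk contDiff_fst.contMDiff.contMDiffAt ?_
  exact (contMDiffAt_chart_symm (P := P) hy).comp (t, y)
    (contDiff_snd.contMDiff.contMDiffAt (x := (t, y)))

omit [FiniteDimensional ℝ E] in
theorem contDiffAt_localCurve
    (hψ : ContMDiff (𝓘(ℝ, ℝ).prod 𝓘(ℝ, E)) 𝓘(ℝ, E) ∞ (fun z : ℝ × P ↦ ψ z.1 z.2))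
    {x x' : P} {t : ℝ} {y : E} (hy : y ∈ (extChartAt 𝓘(ℝ, E) x).target)
    (hy' : ψ t ((extChartAt 𝓘(ℝ, E) x).symm y) ∈ (extChartAt 𝓘(ℝ, E) x').source) :
    ContDiffAt ℝ ∞ (localCurve ψ x x') (t, y) := by
  rw [← contMDiffAt_iff_contDiffAt]
  have h1 : ContMDiffAt 𝓘(ℝ, ℝ × E) 𝓘(ℝ, E) ∞
      (fun z : ℝ × E ↦ ψ z.1 ((extChartAt 𝓘(ℝ, E) x).symm z.2)) (t, y) :=
    hψ.contMDiffAt.comp (t, y) (contMDiffAt_chart_symm_prod hy)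
  exact ContMDiffAt.comp (t, y) (contMDiffAt_chart hy') h1

omit [FiniteDimensional ℝ E] in
theorem eventually_localCurve
    (hψ : ContMDiff (𝓘(ℝ, ℝ).prod 𝓘(ℝ, E)) 𝓘(ℝ, E) ∞ (fun z : ℝ × P ↦ ψ z.1 z.2))
    {x x' : P} {t : ℝ} {y : E} (hy : y ∈ (extChartAt 𝓘(ℝ, E) x).target)
    (hy' : ψ t ((extChartAt 𝓘(ℝ, E) x).symm y) ∈ (extChartAt 𝓘(ℝ, E) x').source) :
    ∀ᶠ z : ℝ × E in 𝓝 (t, y), z.2 ∈ (extChartAt 𝓘(ℝ, E) x).target ∧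
      ψ z.1 ((extChartAt 𝓘(ℝ, E) x).symm z.2) ∈ (extChartAt 𝓘(ℝ, E) x').source := by
  have h1 : ContMDiffAt 𝓘(ℝ, ℝ × E) 𝓘(ℝ, E) ∞
      (fun z : ℝ × E ↦ ψ z.1 ((extChartAt 𝓘(ℝ, E) x).symm z.2)) (t, y) :=
    hψ.contMDiffAt.comp (t, y) (contMDiffAt_chart_symm_prod hy)
  exact (continuousAt_snd.eventually_mem ((isOpen_chart_target x).mem_nhds hy)).and
    (h1.continuousAt.eventually_mem ((isOpen_extChartAt_source x').mem_nhds hy'))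

theorem contDiffAt_localPullback {θ : OneForm E P} (hθ : IsSmoothOneForm θ)
    (hψ : ContMDiff (𝓘(ℝ, ℝ).prod 𝓘(ℝ, E)) 𝓘(ℝ, E) ∞ (fun z : ℝ × P ↦ ψ z.1 z.2))
    {x x' : P} {t : ℝ} {y : E} (hy : y ∈ (extChartAt 𝓘(ℝ, E) x).target)
    (hy' : ψ t ((extChartAt 𝓘(ℝ, E) x).symm y) ∈ (extChartAt 𝓘(ℝ, E) x').source) :
    ContDiffAt ℝ ∞ (localPullback θ ψ x x') (t, y) := by
  have hg := contDiffAt_localCurve hψ hy hy'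
  exact ((contDiffAt_chartExpr hθ ((extChartAt 𝓘(ℝ, E) x').map_source hy')).comp (t, y) hg).clm_comp
    (hg.fderiv_right (m := ∞) (by simp))

omit [FiniteDimensional ℝ E] in
-- The spatial part of the space-time form is the pull-back at a fixed time.
theorem chartExpr_pullback_curve (θ : OneForm E P)
    (hψ : ContMDiff (𝓘(ℝ, ℝ).prod 𝓘(ℝ, E)) 𝓘(ℝ, E) ∞ (fun z : ℝ × P ↦ ψ z.1 z.2))
    {x x' : P} {t : ℝ} {y : E} (hy : y ∈ (extChartAt 𝓘(ℝ, E) x).target)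
    (hy' : ψ t ((extChartAt 𝓘(ℝ, E) x).symm y) ∈ (extChartAt 𝓘(ℝ, E) x').source) (w : E) :
    chartExpr (pullback (ψ t) θ) x y w = localPullback θ ψ x x' (t, y) (0, w) := by
  have hψt : ContMDiff 𝓘(ℝ, E) 𝓘(ℝ, E) ∞ (ψ t) :=
    hψ.comp (contMDiff_const.prodMk contMDiff_id)
  rw [chartExpr_pullback θ hy (hψt.mdifferentiable (by simp) _) hy', localPullback,
    ContinuousLinearMap.comp_apply, ContinuousLinearMap.comp_apply,
    ← fderiv_prod_right ((contDiffAt_localCurve hψ hy hy').differentiableAt (by simp))]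
  rfl

omit [FiniteDimensional ℝ E] in
-- The time part of the space-time form is the contraction of `θ` with the velocity, since the
-- velocity is the derivative of the local expression along `(1, 0)`.
theorem oneForm_velocity_eq (θ : OneForm E P)
    (hψ : ContMDiff (𝓘(ℝ, ℝ).prod 𝓘(ℝ, E)) 𝓘(ℝ, E) ∞ (fun z : ℝ × P ↦ ψ z.1 z.2))
    {x x' : P} {t : ℝ} {y : E} (hy : y ∈ (extChartAt 𝓘(ℝ, E) x).target)
    (hy' : ψ t ((extChartAt 𝓘(ℝ, E) x).symm y) ∈ (extChartAt 𝓘(ℝ, E) x').source)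
    {v : TangentSpace 𝓘(ℝ, E) (ψ t ((extChartAt 𝓘(ℝ, E) x).symm y))}
    (hv : HasMFDerivAt 𝓘(ℝ, ℝ) 𝓘(ℝ, E) (fun s ↦ ψ s ((extChartAt 𝓘(ℝ, E) x).symm y)) t
      ((1 : ℝ →L[ℝ] ℝ).smulRight v)) :
    chartDeriv x' _ v = fderiv ℝ (localCurve ψ x x') (t, y) (1, 0) ∧
    θ _ v = localPullback θ ψ x x' (t, y) (1, 0) := by
  have h1 := hasDerivAt_chart_comp (c := fun s ↦ ψ s ((extChartAt 𝓘(ℝ, E) x).symm y)) hy' hv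
  have h2 := hasDerivAt_prod_left ((contDiffAt_localCurve hψ hy hy').differentiableAt (by simp))
  have h3 := h1.unique h2
  refine ⟨h3, ?_⟩
  rw [← chartExpr_chartDeriv θ hy', localPullback, ContinuousLinearMap.comp_apply]
  exact congrArg _ h3

end SmoothCurves

/-! ### Cartan's formula along an isotopy -/

section Cartan

variable {E : Type*} [NormedAddCommGroup E] [NormedSpace ℝ E] [FiniteDimensional ℝ E]
  {P : Type*} [TopologicalSpace P] [ChartedSpace E P] [IsManifold 𝓘(ℝ, E) ∞ P]
  {ψ : ℝ → Diff E P} {X : ℝ → VectorField E P}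

theorem IsSmoothCurve.contMDiff_curve (hψ : IsSmoothCurve ψ) :
    ContMDiff (𝓘(ℝ, ℝ).prod 𝓘(ℝ, E)) 𝓘(ℝ, E) ∞ (fun z : ℝ × P ↦ (fun t ↦ ⇑(ψ t)) z.1 z.2) :=
  hψ.smooth

/-- Near `(t, p)`, the contraction of a one-form with the velocity of a curve of diffeomorphisms is
given by the local pull-back. -/
theorem eventually_oneForm_velocity_eq (θ : OneForm E P) (hψ : IsSmoothCurve ψ)
    (hX : ∀ t, HasVelocityAt ψ t (X t)) (t : ℝ) (p : P) :
    ∀ᶠ z in 𝓝 (t, extChartAt 𝓘(ℝ, E) p p),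
      θ (ψ z.1 ((extChartAt 𝓘(ℝ, E) p).symm z.2))
        (X z.1 (ψ z.1 ((extChartAt 𝓘(ℝ, E) p).symm z.2))) =
      localPullback θ (fun t ↦ ⇑(ψ t)) p (ψ t p) z (1, 0) := by
  have hp : p ∈ (extChartAt 𝓘(ℝ, E) p).source := mem_extChartAt_source p
  have hinv : (extChartAt 𝓘(ℝ, E) p).symm (extChartAt 𝓘(ℝ, E) p p) = p :=
    (extChartAt 𝓘(ℝ, E) p).left_inv hp
  have hy' : ψ t ((extChartAt 𝓘(ℝ, E) p).symm (extChartAt 𝓘(ℝ, E) p p)) ∈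
      (extChartAt 𝓘(ℝ, E) (ψ t p)).source := by
    rw [hinv]; exact mem_extChartAt_source _
  filter_upwards [eventually_localCurve (ψ := fun t ↦ ⇑(ψ t)) (x' := ψ t p) hψ.contMDiff_curve
    ((extChartAt 𝓘(ℝ, E) p).map_source hp) hy'] with z hz
  exact (oneForm_velocity_eq θ hψ.contMDiff_curve (t := z.1) (y := z.2) hz.1 hz.2
    (hX z.1 ((extChartAt 𝓘(ℝ, E) p).symm z.2))).2

theorem contDiffAt_localPullback_center {θ : OneForm E P} (hθ : IsSmoothOneForm θ)
    (hψ : IsSmoothCurve ψ) (t : ℝ) (p : P) :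
    ContDiffAt ℝ ∞ (localPullback θ (fun t ↦ ⇑(ψ t)) p (ψ t p)) (t, extChartAt 𝓘(ℝ, E) p p) := by
  have hp : p ∈ (extChartAt 𝓘(ℝ, E) p).source := mem_extChartAt_source p
  refine contDiffAt_localPullback hθ hψ.contMDiff_curve ((extChartAt 𝓘(ℝ, E) p).map_source hp) ?_
  rw [(extChartAt 𝓘(ℝ, E) p).left_inv hp]
  exact mem_extChartAt_source _

/-- The contraction of a smooth one-form with the velocity of a smooth curve of diffeomorphisms is
smooth in time and space. -/
theorem contMDiff_oneForm_velocity {θ : OneForm E P} (hθ : IsSmoothOneForm θ)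
    (hψ : IsSmoothCurve ψ) (hX : ∀ t, HasVelocityAt ψ t (X t)) :
    ContMDiff (𝓘(ℝ, ℝ).prod 𝓘(ℝ, E)) 𝓘(ℝ, ℝ) ∞
      (fun z : ℝ × P ↦ θ (ψ z.1 z.2) (X z.1 (ψ z.1 z.2))) := by
  rintro ⟨t, p⟩
  have hp : p ∈ (extChartAt 𝓘(ℝ, E) p).source := mem_extChartAt_source p
  have h1 : ContDiffAt ℝ ∞ (fun z ↦ localPullback θ (fun t ↦ ⇑(ψ t)) p (ψ t p) z (1, 0))
      (t, extChartAt 𝓘(ℝ, E) p p) :=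
    (contDiffAt_localPullback_center hθ hψ t p).clm_apply contDiffAt_const
  have h2 : ContMDiffAt (𝓘(ℝ, ℝ).prod 𝓘(ℝ, E)) 𝓘(ℝ, ℝ × E) ∞
      (fun z : ℝ × P ↦ (z.1, extChartAt 𝓘(ℝ, E) p z.2)) (t, p) := by
    refine ContMDiffAt.prodMk_space contMDiffAt_fst ?_
    exact (contMDiffAt_chart hp).comp (t, p) contMDiffAt_snd
  have h3 := ContMDiffAt.comp (t, p) h1.contMDiffAt h2
  refine h3.congr_of_eventuallyEq ?_
  filter_upwards [h2.continuousAt.eventually (eventually_oneForm_velocity_eq θ hψ hX t p),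
    (continuousAt_snd (p := (t, p))).eventually_mem
      ((isOpen_extChartAt_source (I := 𝓘(ℝ, E)) p).mem_nhds hp)] with z hz hz'
  have hz2 : (extChartAt 𝓘(ℝ, E) p).symm (extChartAt 𝓘(ℝ, E) p z.2) = z.2 :=
    (extChartAt 𝓘(ℝ, E) p).left_inv hz'
  rw [hz2] at hz
  exact hz

/-- Cartan's formula for the time derivative of `ψ_t^* θ`. -/
theorem hasDerivAt_pullback {θ : OneForm E P} (hθ : IsSmoothOneForm θ)
    (hψ : IsSmoothCurve ψ) (hX : ∀ t, HasVelocityAt ψ t (X t)) (t : ℝ) (p : P)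
    (w : TangentSpace 𝓘(ℝ, E) p) :
    HasDerivAt (fun s ↦ pullback (ψ s) θ p w)
      (differential (fun q ↦ θ (ψ t q) (X t (ψ t q))) p w +
        extDerivOneForm θ (ψ t p) (X t (ψ t p)) (mfderiv 𝓘(ℝ, E) 𝓘(ℝ, E) (ψ t) p w)) t := by
  have hp : p ∈ (extChartAt 𝓘(ℝ, E) p).source := mem_extChartAt_source p
  have hy : extChartAt 𝓘(ℝ, E) p p ∈ (extChartAt 𝓘(ℝ, E) p).target :=
    (extChartAt 𝓘(ℝ, E) p).map_source hp
  have hinv : (extChartAt 𝓘(ℝ, E) p).symm (extChartAt 𝓘(ℝ, E) p p) = p :=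
    (extChartAt 𝓘(ℝ, E) p).left_inv hp
  have hy' : ψ t ((extChartAt 𝓘(ℝ, E) p).symm (extChartAt 𝓘(ℝ, E) p p)) ∈
      (extChartAt 𝓘(ℝ, E) (ψ t p)).source := by
    rw [hinv]; exact mem_extChartAt_source _
  set y₀ := extChartAt 𝓘(ℝ, E) p p with hy₀
  -- `β` is the pull-back of `θ` under the space-time map `(s, y) ↦ ψ_s(y)`. Naturality computes
  -- `dβ` on `∂_t` and `w` as the pulled-back `dθ`, while by definition it is `∂_t β(w) - ∂_w
  -- β(∂_t)`; comparing the two is Cartan's formula.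
  set β := localPullback θ (fun t ↦ ⇑(ψ t)) p (ψ t p) with hβ
  set w' := chartDeriv p p w with hw'
  have hβd : DifferentiableAt ℝ β (t, y₀) :=
    (contDiffAt_localPullback_center hθ hψ t p).differentiableAt (by simp)
  have hg : ContDiffAt ℝ ∞ (localCurve (fun t ↦ ⇑(ψ t)) p (ψ t p)) (t, y₀) :=
    contDiffAt_localCurve hψ.contMDiff_curve hy hy'
  have h1 : (fun s ↦ pullback (ψ s) θ p w) =ᶠ[𝓝 t] fun s ↦ β (s, y₀) (0, w') := by
    filter_upwards [(Continuous.prodMk_left y₀).continuousAt.eventually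
      (eventually_localCurve (ψ := fun t ↦ ⇑(ψ t)) (x' := ψ t p) hψ.contMDiff_curve hy hy')] with s hs
    rw [← chartExpr_chartDeriv _ hp]
    exact chartExpr_pullback_curve (ψ := fun t ↦ ⇑(ψ t)) (t := s) θ hψ.contMDiff_curve hy hs.2 w'
  refine HasDerivAt.congr_of_eventuallyEq ?_ h1
  have h2 := (hasDerivAt_prod_left hβd).clm_apply (hasDerivAt_const t ((0 : ℝ), w'))
  refine h2.congr_deriv ?_
  have ha : MDifferentiableAt 𝓘(ℝ, E) 𝓘(ℝ, ℝ) (fun q ↦ θ (ψ t q) (X t (ψ t q))) p :=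
    ((contMDiff_oneForm_velocity hθ hψ hX).comp
      (contMDiff_const.prodMk contMDiff_id)).mdifferentiable (by simp) p
  have h3 : ((fun q ↦ θ (ψ t q) (X t (ψ t q))) ∘ (extChartAt 𝓘(ℝ, E) p).symm) =ᶠ[𝓝 y₀]
      fun y ↦ β (t, y) (1, 0) := by
    exact (Continuous.prodMk_right t).continuousAt.eventually
      (eventually_oneForm_velocity_eq θ hψ hX t p)
  have h4 : HasFDerivAt (fun y ↦ β (t, y) (1, 0)) _ y₀ :=
    (hβd.hasFDerivAt.comp y₀ (hasFDerivAt_prodMk_right t y₀)).clm_apply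
      (hasFDerivAt_const ((1 : ℝ), (0 : E)) y₀)
  have h5 : differential (fun q ↦ θ (ψ t q) (X t (ψ t q))) p w = fderiv ℝ β (t, y₀) (0, w') (1, 0) := by
    rw [differential, mvfderiv_eq_fderiv_chart hp ha, h3.fderiv_eq, h4.fderiv]
    simp [hw']
  have h6 := vectorExtDeriv_pullback (τ := chartExpr θ (ψ t p))
    (g := localCurve (fun t ↦ ⇑(ψ t)) p (ψ t p)) (x := (t, y₀))
    ((contDiffAt_chartExpr hθ ((extChartAt 𝓘(ℝ, E) (ψ t p)).map_source hy')).differentiableAt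
      (by simp)) hg (1, 0) (0, w')
  have hX' : HasMFDerivAt 𝓘(ℝ, ℝ) 𝓘(ℝ, E) (fun s ↦ ψ s ((extChartAt 𝓘(ℝ, E) p).symm y₀)) t
      ((1 : ℝ →L[ℝ] ℝ).smulRight (X t (ψ t ((extChartAt 𝓘(ℝ, E) p).symm y₀)))) := hX t _
  have h7 := (oneForm_velocity_eq θ hψ.contMDiff_curve hy hy' hX').1
  have hψt : MDifferentiableAt 𝓘(ℝ, E) 𝓘(ℝ, E) (ψ t) p := (ψ t).contMDiff.mdifferentiable (by simp) p
  have h8 : chartDeriv (ψ t p) (ψ t p) (mfderiv 𝓘(ℝ, E) 𝓘(ℝ, E) (ψ t) p w) =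
      fderiv ℝ (localCurve (fun t ↦ ⇑(ψ t)) p (ψ t p)) (t, y₀) (0, w') := by
    rw [chartDeriv_mfderiv hp (mem_extChartAt_source _) hψt,
      ← fderiv_prod_right (hg.differentiableAt (by simp))]
    rfl
  rw [hinv] at h7
  have h9 : localCurve (fun t ↦ ⇑(ψ t)) p (ψ t p) (t, y₀) =
      extChartAt 𝓘(ℝ, E) (ψ t p) (ψ t p) := by
    simp only [localCurve, hinv]
  rw [h5, extDerivOneForm_eq, h7, h8, ← h9, ← h6]
  change _ = _ + (fderiv ℝ β (t, y₀) (1, 0) (0, w') - fderiv ℝ β (t, y₀) (0, w') (1, 0))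
  simp

end Cartan

/-! ### Time-dependent functions -/

section TimeDependentFunctions

variable {E : Type*} [NormedAddCommGroup E] [NormedSpace ℝ E] [FiniteDimensional ℝ E]
  {P : Type*} [TopologicalSpace P] [ChartedSpace E P] [IsManifold 𝓘(ℝ, E) ∞ P]
  {F : ℝ → P → ℝ}

theorem contDiffAt_timeDependent
    (hF : ContMDiff (𝓘(ℝ, ℝ).prod 𝓘(ℝ, E)) 𝓘(ℝ, ℝ) ∞ (fun z : ℝ × P ↦ F z.1 z.2)) {x : P} {t : ℝ}
    {y : E} (hy : y ∈ (extChartAt 𝓘(ℝ, E) x).target) :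
    ContDiffAt ℝ ∞ (fun z : ℝ × E ↦ F z.1 ((extChartAt 𝓘(ℝ, E) x).symm z.2)) (t, y) :=
  contMDiffAt_iff_contDiffAt.1 (hF.contMDiffAt.comp (t, y) (contMDiffAt_chart_symm_prod hy))

/-- The time derivative of a smooth time-dependent function is smooth. -/
theorem contMDiff_timeDeriv
    (hF : ContMDiff (𝓘(ℝ, ℝ).prod 𝓘(ℝ, E)) 𝓘(ℝ, ℝ) ∞ (fun z : ℝ × P ↦ F z.1 z.2)) :
    ContMDiff (𝓘(ℝ, ℝ).prod 𝓘(ℝ, E)) 𝓘(ℝ, ℝ) ∞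
      (fun z : ℝ × P ↦ deriv (fun s ↦ F s z.2) z.1) := by
  rintro ⟨t, p⟩
  have hp : p ∈ (extChartAt 𝓘(ℝ, E) p).source := mem_extChartAt_source p
  have h1 := contDiffAt_timeDependent (t := t) hF ((extChartAt 𝓘(ℝ, E) p).map_source hp)
  have h2 : ContDiffAt ℝ ∞ (fun z ↦ fderiv ℝ
      (fun z : ℝ × E ↦ F z.1 ((extChartAt 𝓘(ℝ, E) p).symm z.2)) z (1, 0))
      (t, extChartAt 𝓘(ℝ, E) p p) :=
    (h1.fderiv_right (m := ∞) (by simp)).clm_apply contDiffAt_const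
  have h3 : ContMDiffAt (𝓘(ℝ, ℝ).prod 𝓘(ℝ, E)) 𝓘(ℝ, ℝ × E) ∞
      (fun z : ℝ × P ↦ (z.1, extChartAt 𝓘(ℝ, E) p z.2)) (t, p) := by
    refine ContMDiffAt.prodMk_space contMDiffAt_fst ?_
    exact (contMDiffAt_chart hp).comp (t, p) contMDiffAt_snd
  refine (ContMDiffAt.comp (t, p) h2.contMDiffAt h3).congr_of_eventuallyEq ?_
  filter_upwards [(continuousAt_snd (p := (t, p))).eventually_mem
      ((isOpen_extChartAt_source (I := 𝓘(ℝ, E)) p).mem_nhds hp)] with z hz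
  have h4 := hasDerivAt_prod_left ((contDiffAt_timeDependent (t := z.1) hF
    ((extChartAt 𝓘(ℝ, E) p).map_source hz)).differentiableAt (by simp))
  have hz2 : (extChartAt 𝓘(ℝ, E) p).symm (extChartAt 𝓘(ℝ, E) p z.2) = z.2 :=
    (extChartAt 𝓘(ℝ, E) p).left_inv hz
  simp only [hz2] at h4
  exact h4.deriv

/-- The time derivative commutes with the differential. -/
theorem hasDerivAt_differential
    (hF : ContMDiff (𝓘(ℝ, ℝ).prod 𝓘(ℝ, E)) 𝓘(ℝ, ℝ) ∞ (fun z : ℝ × P ↦ F z.1 z.2)) (t : ℝ) (p : P)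
    (w : TangentSpace 𝓘(ℝ, E) p) :
    HasDerivAt (fun s ↦ differential (F s) p w)
      (differential (fun q ↦ deriv (fun s ↦ F s q) t) p w) t := by
  have hp : p ∈ (extChartAt 𝓘(ℝ, E) p).source := mem_extChartAt_source p
  have hFt : ∀ s, MDifferentiableAt 𝓘(ℝ, E) 𝓘(ℝ, ℝ) (F s) p := fun s ↦
    (hF.comp (contMDiff_const.prodMk contMDiff_id)).mdifferentiable (by simp) p
  have hFt' : MDifferentiableAt 𝓘(ℝ, E) 𝓘(ℝ, ℝ) (fun q ↦ deriv (fun s ↦ F s q) t) p :=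
    ((contMDiff_timeDeriv hF).comp
      (contMDiff_const.prodMk contMDiff_id)).mdifferentiable (by simp) p
  simp only [differential]
  simp_rw [fun s ↦ mvfderiv_eq_fderiv_chart hp (hFt s)]
  rw [mvfderiv_eq_fderiv_chart hp hFt']
  exact hasDerivAt_fderiv_prod_right
    (contDiffAt_timeDependent (t := t) hF ((extChartAt 𝓘(ℝ, E) p).map_source hp)) _

end TimeDependentFunctions

/-! ### Calculus of pull-backs and differentials -/

section FormCalculus

variable {E : Type*} [NormedAddCommGroup E] [NormedSpace ℝ E]
  {P : Type*} [TopologicalSpace P] [ChartedSpace E P]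

theorem pullback_apply (φ : P → P) (θ : OneForm E P) (p : P) (v : TangentSpace 𝓘(ℝ, E) p) :
    pullback φ θ p v = θ (φ p) (mfderiv 𝓘(ℝ, E) 𝓘(ℝ, E) φ p v) := rfl

theorem pullback_comp (θ : OneForm E P) {φ ψ : P → P} (hφ : MDifferentiable 𝓘(ℝ, E) 𝓘(ℝ, E) φ)
    (hψ : MDifferentiable 𝓘(ℝ, E) 𝓘(ℝ, E) ψ) :
    pullback (φ ∘ ψ) θ = pullback ψ (pullback φ θ) := by
  funext p
  ext v
  rw [pullback_apply, pullback_apply, pullback_apply, mfderiv_comp p (hφ _) (hψ p)]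
  rfl

theorem pullback_sub (φ : P → P) (α β : OneForm E P) :
    pullback φ (α - β) = pullback φ α - pullback φ β := rfl

theorem differential_comp {F : P → ℝ} {φ : P → P} (hF : MDifferentiable 𝓘(ℝ, E) 𝓘(ℝ, ℝ) F)
    (hφ : MDifferentiable 𝓘(ℝ, E) 𝓘(ℝ, E) φ) :
    differential (F ∘ φ) = pullback φ (differential (E := E) F) := by
  funext p
  ext v
  exact mvfderiv_comp_mfderiv (hF _) (hφ p) v

theorem differential_add {F G : P → ℝ} (hF : MDifferentiable 𝓘(ℝ, E) 𝓘(ℝ, ℝ) F)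
    (hG : MDifferentiable 𝓘(ℝ, E) 𝓘(ℝ, ℝ) G) :
    differential (E := E) (F + G) = differential F + differential G :=
  funext fun p ↦ mvfderiv_add (hF p) (hG p)

theorem differential_sub {F G : P → ℝ} (hF : MDifferentiable 𝓘(ℝ, E) 𝓘(ℝ, ℝ) F)
    (hG : MDifferentiable 𝓘(ℝ, E) 𝓘(ℝ, ℝ) G) :
    differential (E := E) (F - G) = differential F - differential G :=
  funext fun p ↦ mvfderiv_sub (hF p) (hG p)

theorem differential_neg (F : P → ℝ) : differential (E := E) (-F) = -differential F :=
  funext fun _ ↦ mvfderiv_neg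

theorem differential_const (c : ℝ) : differential (E := E) (fun _ : P ↦ c) = 0 :=
  funext fun _ ↦ mvfderiv_const c

theorem Diff.mdifferentiable (φ : Diff E P) : MDifferentiable 𝓘(ℝ, E) 𝓘(ℝ, E) φ :=
  φ.contMDiff.mdifferentiable (by simp)

theorem Diff.exists_mfderiv_eq (φ : Diff E P) (p : P) (v : TangentSpace 𝓘(ℝ, E) (φ p)) :
    ∃ w : TangentSpace 𝓘(ℝ, E) p, mfderiv 𝓘(ℝ, E) 𝓘(ℝ, E) φ p w = v :=
  (φ.mfderivToContinuousLinearEquiv (by simp) p).surjective v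

theorem contMDiff_slice {F : ℝ → P → ℝ}
    (hF : ContMDiff (𝓘(ℝ, ℝ).prod 𝓘(ℝ, E)) 𝓘(ℝ, ℝ) ∞ (fun z : ℝ × P ↦ F z.1 z.2)) (t : ℝ) :
    ContMDiff 𝓘(ℝ, E) 𝓘(ℝ, ℝ) ∞ (F t) :=
  hF.comp (contMDiff_const.prodMk contMDiff_id)

theorem mdifferentiable_slice {F : ℝ → P → ℝ}
    (hF : ContMDiff (𝓘(ℝ, ℝ).prod 𝓘(ℝ, E)) 𝓘(ℝ, ℝ) ∞ (fun z : ℝ × P ↦ F z.1 z.2)) (t : ℝ) :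
    MDifferentiable 𝓘(ℝ, E) 𝓘(ℝ, ℝ) (F t) :=
  (contMDiff_slice hF t).mdifferentiable (by simp)

theorem differentiable_time {F : ℝ → P → ℝ}
    (hF : ContMDiff (𝓘(ℝ, ℝ).prod 𝓘(ℝ, E)) 𝓘(ℝ, ℝ) ∞ (fun z : ℝ × P ↦ F z.1 z.2)) (p : P) :
    Differentiable ℝ (fun t ↦ F t p) := by
  have : ContMDiff 𝓘(ℝ, ℝ) 𝓘(ℝ, ℝ) ∞ (fun t ↦ F t p) :=
    hF.comp (contMDiff_id.prodMk contMDiff_const)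
  exact this.contDiff.differentiable (by simp)

end FormCalculus

/-! ### Primitives in time -/

section TimePrimitive

variable {E : Type*} [NormedAddCommGroup E] [NormedSpace ℝ E] [FiniteDimensional ℝ E]
  {P : Type*} [TopologicalSpace P] [ChartedSpace E P] [IsManifold 𝓘(ℝ, E) ∞ P]
  {k : ℝ → P → ℝ}

/-- The primitive in time, vanishing at time zero, of a time-dependent function. -/
def timePrimitive (k : ℝ → P → ℝ) (t : ℝ) (p : P) : ℝ := ∫ s in (0 : ℝ)..1, t * k (s * t) p

theorem timePrimitive_zero (k : ℝ → P → ℝ) : timePrimitive k 0 = fun _ ↦ 0 := by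
  funext p
  simp [timePrimitive]

/-- The rescaled integral has the fixed domain `[0, 1]`, so time enters only through the integrand
and `contDiffAt_intervalIntegral` gives joint smoothness in a chart. -/
theorem contMDiff_timePrimitive
    (hk : ContMDiff (𝓘(ℝ, ℝ).prod 𝓘(ℝ, E)) 𝓘(ℝ, ℝ) ∞ (fun z : ℝ × P ↦ k z.1 z.2)) :
    ContMDiff (𝓘(ℝ, ℝ).prod 𝓘(ℝ, E)) 𝓘(ℝ, ℝ) ∞ (fun z : ℝ × P ↦ timePrimitive k z.1 z.2) := by
  rintro ⟨t, p⟩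
  have hp : p ∈ (extChartAt 𝓘(ℝ, E) p).source := mem_extChartAt_source p
  have hV : IsOpen {z : ℝ × ℝ × E | z.2.2 ∈ (extChartAt 𝓘(ℝ, E) p).target} :=
    (isOpen_chart_target p).preimage (continuous_snd.comp continuous_snd)
  have h1 : ContDiffOn ℝ ∞ (fun z : ℝ × ℝ × E ↦
      z.2.1 * k (z.1 * z.2.1) ((extChartAt 𝓘(ℝ, E) p).symm z.2.2))
      {z : ℝ × ℝ × E | z.2.2 ∈ (extChartAt 𝓘(ℝ, E) p).target} := by
    rintro ⟨s, t, y⟩ hy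
    refine ContDiffAt.contDiffWithinAt ?_
    refine ContDiffAt.mul (by fun_prop) ?_
    have h2 := contDiffAt_timeDependent (t := s * t) (y := y) hk hy
    exact h2.comp (s, t, y) (f := fun z : ℝ × ℝ × E ↦ (z.1 * z.2.1, z.2.2)) (by fun_prop)
  have h3 : ContDiffAt ℝ ∞ (fun z : ℝ × E ↦ ∫ s in (0 : ℝ)..1,
      z.1 * k (s * z.1) ((extChartAt 𝓘(ℝ, E) p).symm z.2)) (t, extChartAt 𝓘(ℝ, E) p p) :=
    contDiffAt_intervalIntegral hV h1 fun s _ ↦ (extChartAt 𝓘(ℝ, E) p).map_source hp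
  have h4 : ContMDiffAt (𝓘(ℝ, ℝ).prod 𝓘(ℝ, E)) 𝓘(ℝ, ℝ × E) ∞
      (fun z : ℝ × P ↦ (z.1, extChartAt 𝓘(ℝ, E) p z.2)) (t, p) := by
    refine ContMDiffAt.prodMk_space contMDiffAt_fst ?_
    exact (contMDiffAt_chart hp).comp (t, p) contMDiffAt_snd
  refine (ContMDiffAt.comp (t, p) h3.contMDiffAt h4).congr_of_eventuallyEq ?_
  filter_upwards [(continuousAt_snd (p := (t, p))).eventually_mem
      ((isOpen_extChartAt_source (I := 𝓘(ℝ, E)) p).mem_nhds hp)] with z hz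
  have hz2 : (extChartAt 𝓘(ℝ, E) p).symm (extChartAt 𝓘(ℝ, E) p z.2) = z.2 :=
    (extChartAt 𝓘(ℝ, E) p).left_inv hz
  simp only [Function.comp_apply, hz2]
  rfl

theorem hasDerivAt_timePrimitive
    (hk : ContMDiff (𝓘(ℝ, ℝ).prod 𝓘(ℝ, E)) 𝓘(ℝ, ℝ) ∞ (fun z : ℝ × P ↦ k z.1 z.2)) (t : ℝ)
    (p : P) : HasDerivAt (fun s ↦ timePrimitive k s p) (k t p) t := by
  have hc : Continuous fun s ↦ k s p := (differentiable_time hk p).continuous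
  have h : (fun s ↦ timePrimitive k s p) = fun s ↦ ∫ r in (0 : ℝ)..s, k r p := by
    funext s
    rw [timePrimitive, intervalIntegral.integral_const_mul,
      intervalIntegral.mul_integral_comp_mul_right (f := fun r ↦ k r p), zero_mul, one_mul]
  rw [h]
  exact (hc.integral_hasStrictDerivAt 0 t).hasDerivAt

end TimePrimitive

/-! ### Hamiltonian isotopies and families of primitives -/

section HamiltonianIsotopies

variable {E : Type*} [NormedAddCommGroup E] [NormedSpace ℝ E] [FiniteDimensional ℝ E]
  {P : Type*} [TopologicalSpace P] [ChartedSpace E P] [IsManifold 𝓘(ℝ, E) ∞ P]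
  {ψ : ℝ → Diff E P} {X : ℝ → VectorField E P} {θ : OneForm E P}

/-- `F_t` is a smooth family of primitives of `ψ_t^* θ - θ`. -/
structure IsPotentialFamily (θ : OneForm E P) (ψ : ℝ → Diff E P) (F : ℝ → P → ℝ) : Prop where
  smooth : ContMDiff (𝓘(ℝ, ℝ).prod 𝓘(ℝ, E)) 𝓘(ℝ, ℝ) ∞ (fun z : ℝ × P ↦ F z.1 z.2)
  differential_eq : ∀ t, differential (F t) = pullback (ψ t) θ - θ

/-- The Lagrangian `θ(X_t) - h_t` along an isotopy. -/
def actionDensity (θ : OneForm E P) (h : ℝ → P → ℝ) (X : ℝ → VectorField E P) (ψ : ℝ → Diff E P)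
    (t : ℝ) (p : P) : ℝ :=
  θ (ψ t p) (X t (ψ t p)) - h t (ψ t p)

theorem contMDiff_comp_curve {h : ℝ → P → ℝ}
    (hh : ContMDiff (𝓘(ℝ, ℝ).prod 𝓘(ℝ, E)) 𝓘(ℝ, ℝ) ∞ (fun x : ℝ × P ↦ h x.1 x.2))
    (hψ : IsSmoothCurve ψ) :
    ContMDiff (𝓘(ℝ, ℝ).prod 𝓘(ℝ, E)) 𝓘(ℝ, ℝ) ∞ (fun x : ℝ × P ↦ h x.1 (ψ x.1 x.2)) :=
  hh.comp (contMDiff_fst.prodMk hψ.smooth)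

theorem contMDiff_comp_curve_symm {h : ℝ → P → ℝ}
    (hh : ContMDiff (𝓘(ℝ, ℝ).prod 𝓘(ℝ, E)) 𝓘(ℝ, ℝ) ∞ (fun x : ℝ × P ↦ h x.1 x.2))
    (hψ : IsSmoothCurve ψ) :
    ContMDiff (𝓘(ℝ, ℝ).prod 𝓘(ℝ, E)) 𝓘(ℝ, ℝ) ∞ (fun x : ℝ × P ↦ h x.1 ((ψ x.1).symm x.2)) :=
  hh.comp (contMDiff_fst.prodMk hψ.smooth_symm)

/-- The action of a Hamiltonian isotopy is a primitive of `ψ_t^* θ - θ`. -/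
theorem isPotentialFamily_timePrimitive (hθ : IsSmoothOneForm θ) {h : ℝ → P → ℝ}
    (hh : ContMDiff (𝓘(ℝ, ℝ).prod 𝓘(ℝ, E)) 𝓘(ℝ, ℝ) ∞ (fun x : ℝ × P ↦ h x.1 x.2))
    (hX : ∀ t, IsHamiltonianVectorField θ (h t) (X t)) (hψ : IsSmoothCurve ψ)
    (hv : ∀ t, HasVelocityAt ψ t (X t)) (h0 : ψ 0 = 1) :
    IsPotentialFamily θ ψ (timePrimitive (actionDensity θ h X ψ)) := by
  have ha := contMDiff_oneForm_velocity hθ hψ hv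
  have hb := contMDiff_comp_curve hh hψ
  have hk : ContMDiff (𝓘(ℝ, ℝ).prod 𝓘(ℝ, E)) 𝓘(ℝ, ℝ) ∞
      (fun z : ℝ × P ↦ actionDensity θ h X ψ z.1 z.2) := ha.sub hb
  have hF := contMDiff_timePrimitive hk
  refine ⟨hF, fun t ↦ ?_⟩
  funext p
  ext w
  -- By Cartan's formula the derivative of the difference is `-d(h_s ∘ ψ_s)(w) - dθ(X_s, ·)` on the
  -- pushed-forward vector, and this vanishes because `-dθ(X_s, ·) = dh_s`.
  have hderiv : ∀ s, HasDerivAt (fun s ↦ differential (timePrimitive (actionDensity θ h X ψ) s) p w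
      - pullback (ψ s) θ p w) 0 s := by
    intro s
    refine ((hasDerivAt_differential hF s p w).sub
      (hasDerivAt_pullback hθ hψ hv s p w)).congr_deriv ?_
    have h1 : (fun q ↦ deriv (fun s ↦ timePrimitive (actionDensity θ h X ψ) s q) s) =
        (fun q ↦ θ (ψ s q) (X s (ψ s q))) - (h s ∘ ψ s) :=
      funext fun q ↦ (hasDerivAt_timePrimitive hk s q).deriv
    have h2 := hX s (ψ s p) (mfderiv 𝓘(ℝ, E) 𝓘(ℝ, E) (ψ s) p w)
    rw [symplForm] at h2
    rw [h1, differential_sub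
        (mdifferentiable_slice (F := fun t q ↦ θ (ψ t q) (X t (ψ t q))) ha s)
        ((mdifferentiable_slice hh s).comp (ψ s).mdifferentiable),
      differential_comp (mdifferentiable_slice hh s) (ψ s).mdifferentiable]
    change differential _ p w - pullback (ψ s) (differential (h s)) p w - _ = _
    rw [pullback_apply, ← h2]
    ring
  have hconst := is_const_of_deriv_eq_zero (fun s ↦ (hderiv s).differentiableAt)
    (fun s ↦ (hderiv s).deriv) t 0
  have hid : pullback (ψ 0) θ = θ := by
    rw [h0]; exact pullback_id θ
  rw [timePrimitive_zero, differential_const, hid] at hconst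
  change differential _ p w = pullback (ψ t) θ p w - θ p w
  simp only [Pi.zero_apply] at hconst
  rw [sub_eq_iff_eq_add] at hconst
  rw [hconst]
  simp
  ring

/-- The Hamiltonian recovered from a family of primitives. -/
def recoveredHamiltonian (θ : OneForm E P) (X : ℝ → VectorField E P) (ψ : ℝ → Diff E P)
    (F : ℝ → P → ℝ) (t : ℝ) (q : P) : ℝ :=
  θ q (X t q) - deriv (fun s ↦ F s ((ψ t).symm q)) t

theorem recoveredHamiltonian_apply (θ : OneForm E P) (X : ℝ → VectorField E P) (ψ : ℝ → Diff E P)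
    (F : ℝ → P → ℝ) (t : ℝ) (p : P) : recoveredHamiltonian θ X ψ F t (ψ t p) =
      θ (ψ t p) (X t (ψ t p)) - deriv (fun s ↦ F s p) t := by
  rw [recoveredHamiltonian, (ψ t).symm_apply_apply]

theorem contMDiff_recoveredHamiltonian (hθ : IsSmoothOneForm θ) {F : ℝ → P → ℝ}
    (hψ : IsSmoothCurve ψ) (hv : ∀ t, HasVelocityAt ψ t (X t))
    (hF : ContMDiff (𝓘(ℝ, ℝ).prod 𝓘(ℝ, E)) 𝓘(ℝ, ℝ) ∞ (fun z : ℝ × P ↦ F z.1 z.2)) :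
    ContMDiff (𝓘(ℝ, ℝ).prod 𝓘(ℝ, E)) 𝓘(ℝ, ℝ) ∞
      (fun z : ℝ × P ↦ recoveredHamiltonian θ X ψ F z.1 z.2) := by
  have h1 := contMDiff_comp_curve_symm ((contMDiff_oneForm_velocity hθ hψ hv).sub
    (contMDiff_timeDeriv hF)) hψ (h := fun t p ↦ θ (ψ t p) (X t (ψ t p)) - deriv (fun s ↦ F s p) t)
  refine h1.congr fun z ↦ ?_
  conv_lhs => rw [← (ψ z.1).apply_symm_apply z.2]
  rw [recoveredHamiltonian_apply]

/-- Differentiating `dF_t = ψ_t^*θ - θ` in time and inserting Cartan's formula gives `-ψ_t^*(i_{X_t}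
dθ) = d(θ(X_t) ∘ ψ_t - ∂_t F_t)`. Since `ψ_t` is a diffeomorphism, every tangent vector is a
pushed-forward one and the pull-back can be removed. -/
theorem isHamiltonianVectorField_recoveredHamiltonian (hθ : IsSmoothOneForm θ) {F : ℝ → P → ℝ}
    (hψ : IsSmoothCurve ψ) (hv : ∀ t, HasVelocityAt ψ t (X t))
    (hF : IsPotentialFamily θ ψ F) (t : ℝ) :
    IsHamiltonianVectorField θ (recoveredHamiltonian θ X ψ F t) (X t) := by
  intro q v
  obtain ⟨p, rfl⟩ : ∃ p, ψ t p = q := (ψ t).surjective q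
  obtain ⟨w, rfl⟩ := (ψ t).exists_mfderiv_eq p v
  have ha := contMDiff_oneForm_velocity hθ hψ hv
  have hh := contMDiff_recoveredHamiltonian hθ hψ hv hF.smooth
  have h1 := hasDerivAt_pullback hθ hψ hv t p w
  have h2 : HasDerivAt (fun s ↦ pullback (ψ s) θ p w - θ p w) _ t := h1.sub_const _
  have h3 : (fun s ↦ pullback (ψ s) θ p w - θ p w) = fun s ↦ differential (F s) p w := by
    funext s
    rw [hF.differential_eq s]
    rfl
  rw [h3] at h2
  have h4 := h2.unique (hasDerivAt_differential hF.smooth t p w)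
  have h5 : differential (recoveredHamiltonian θ X ψ F t) (ψ t p)
      (mfderiv 𝓘(ℝ, E) 𝓘(ℝ, E) (ψ t) p w) =
      differential (recoveredHamiltonian θ X ψ F t ∘ ψ t) p w := by
    rw [differential_comp (mdifferentiable_slice hh t) (ψ t).mdifferentiable]
    rfl
  have h6 : recoveredHamiltonian θ X ψ F t ∘ ψ t =
      (fun q ↦ θ (ψ t q) (X t (ψ t q))) - fun q ↦ deriv (fun s ↦ F s q) t :=
    funext fun q ↦ recoveredHamiltonian_apply θ X ψ F t q
  rw [h5, h6, differential_sub
    (mdifferentiable_slice (F := fun t q ↦ θ (ψ t q) (X t (ψ t q))) ha t)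
    (mdifferentiable_slice (F := fun t q ↦ deriv (fun s ↦ F s q) t)
      (contMDiff_timeDeriv hF.smooth) t), symplForm]
  change _ = differential _ p w - differential _ p w
  rw [← h4]
  ring

/-- Every smooth curve of diffeomorphisms has a velocity. -/
theorem IsSmoothCurve.exists_velocity (hψ : IsSmoothCurve ψ) :
    ∃ X : ℝ → VectorField E P, ∀ t, HasVelocityAt ψ t (X t) := by
  refine ⟨fun t q ↦ (mfderiv 𝓘(ℝ, ℝ) 𝓘(ℝ, E) (fun s ↦ ψ s ((ψ t).symm q)) t (1 : ℝ) : E),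
    fun t p ↦ ?_⟩
  have h1 : MDifferentiableAt 𝓘(ℝ, ℝ) 𝓘(ℝ, E) (fun s ↦ ψ s p) t := by
    have : ContMDiff 𝓘(ℝ, ℝ) 𝓘(ℝ, E) ∞ (fun s ↦ ψ s p) :=
      hψ.smooth.comp (contMDiff_id.prodMk contMDiff_const)
    exact this.mdifferentiable (by simp) t
  -- The tangent space depends on the point `(ψ t).symm (ψ t p)`; stating the claim for any `q = p`
  -- allows substitution instead of a dependent rewrite.
  have h2 : ∀ q, q = p → HasMFDerivAt 𝓘(ℝ, ℝ) 𝓘(ℝ, E) (fun s ↦ ψ s p) t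
      ((1 : ℝ →L[ℝ] ℝ).smulRight (mfderiv 𝓘(ℝ, ℝ) 𝓘(ℝ, E) (fun s ↦ ψ s q) t (1 : ℝ) : E)) := by
    rintro q rfl
    refine h1.hasMFDerivAt.congr_mfderiv ?_
    ext
    exact (one_smul ℝ (mfderiv 𝓘(ℝ, ℝ) 𝓘(ℝ, E) (fun s ↦ ψ s q) t (1 : ℝ) : E)).symm
  exact h2 _ ((ψ t).symm_apply_apply p)

/-- Trading Hamiltonians for primitives makes products and inverses of isotopies easy: the velocity
of a product never has to be computed. -/
theorem isHamiltonianDiffeo_iff (hθ : IsSmoothOneForm θ) (φ : Diff E P) :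
    IsHamiltonianDiffeo θ φ ↔ ∃ (ψ : ℝ → Diff E P) (F : ℝ → P → ℝ),
      IsSmoothCurve ψ ∧ ψ 0 = 1 ∧ ψ 1 = φ ∧ IsPotentialFamily θ ψ F := by
  constructor
  · rintro ⟨h, X, ψ, hh, hX, hψ, hv, h0, h1⟩
    exact ⟨ψ, _, hψ, h0, h1, isPotentialFamily_timePrimitive hθ hh hX hψ hv h0⟩
  · rintro ⟨ψ, F, hψ, h0, h1, hF⟩
    obtain ⟨X, hX⟩ := hψ.exists_velocity
    exact ⟨recoveredHamiltonian θ X ψ F, X, ψ, contMDiff_recoveredHamiltonian hθ hψ hX hF.smooth,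
      isHamiltonianVectorField_recoveredHamiltonian hθ hψ hX hF, hψ, hX, h0, h1⟩

theorem IsSmoothCurve.mul {ψ' : ℝ → Diff E P} (hψ : IsSmoothCurve ψ) (hψ' : IsSmoothCurve ψ') :
    IsSmoothCurve (fun t ↦ ψ t * ψ' t) :=
  ⟨hψ.smooth.comp (contMDiff_fst.prodMk hψ'.smooth),
    hψ'.smooth_symm.comp (contMDiff_fst.prodMk hψ.smooth_symm)⟩

theorem IsSmoothCurve.inv (hψ : IsSmoothCurve ψ) : IsSmoothCurve (fun t ↦ (ψ t)⁻¹) :=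
  ⟨hψ.smooth_symm, hψ.smooth⟩

theorem isSmoothCurve_one : IsSmoothCurve (fun _ ↦ (1 : Diff E P)) :=
  ⟨contMDiff_snd, contMDiff_snd⟩

/-- The cocycle rule: `(φψ)^*θ - θ = ψ^*(φ^*θ - θ) + (ψ^*θ - θ)`. -/
theorem differential_potential_mul {φ ψ : Diff E P} {F G : P → ℝ}
    (hF : MDifferentiable 𝓘(ℝ, E) 𝓘(ℝ, ℝ) F) (hG : MDifferentiable 𝓘(ℝ, E) 𝓘(ℝ, ℝ) G)
    (hdF : differential F = pullback φ θ - θ) (hdG : differential G = pullback ψ θ - θ) :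
    differential (F ∘ ψ + G) = pullback (φ * ψ : Diff E P) θ - θ := by
  rw [differential_add (hF.comp ψ.mdifferentiable) hG, differential_comp hF ψ.mdifferentiable, hdF,
    hdG, pullback_sub]
  have : pullback (φ * ψ : Diff E P) θ = pullback ψ (pullback φ θ) :=
    pullback_comp θ φ.mdifferentiable ψ.mdifferentiable
  rw [this]
  abel

theorem differential_potential_inv {φ : Diff E P} {F : P → ℝ}
    (hF : MDifferentiable 𝓘(ℝ, E) 𝓘(ℝ, ℝ) F) (hdF : differential F = pullback φ θ - θ) :
    differential (-(F ∘ φ.symm)) = pullback (φ⁻¹ : Diff E P) θ - θ := by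
  rw [differential_neg, differential_comp hF (Diff.mdifferentiable φ.symm), hdF, pullback_sub,
    ← pullback_comp θ φ.mdifferentiable (Diff.mdifferentiable φ.symm)]
  have h1 : (φ ∘ φ.symm : P → P) = id := funext φ.apply_symm_apply
  rw [h1, pullback_id]
  change -(θ - pullback φ.symm θ) = pullback φ.symm θ - θ
  abel

/-- The group of Hamiltonian diffeomorphisms. -/
def hamSubgroup (θ : OneForm E P) (hθ : IsSmoothOneForm θ) : Subgroup (Diff E P) where
  carrier := {φ | IsHamiltonianDiffeo θ φ}
  one_mem' := by
    refine (isHamiltonianDiffeo_iff hθ 1).2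
      ⟨fun _ ↦ 1, fun _ _ ↦ 0, isSmoothCurve_one, rfl, rfl, contMDiff_const, fun t ↦ ?_⟩
    rw [differential_const]
    exact (sub_eq_zero.2 (pullback_id θ)).symm
  mul_mem' {φ φ'} hφ hφ' := by
    obtain ⟨ψ, F, hψ, h0, h1, hF⟩ := (isHamiltonianDiffeo_iff hθ φ).1 hφ
    obtain ⟨ψ', F', hψ', h0', h1', hF'⟩ := (isHamiltonianDiffeo_iff hθ φ').1 hφ'
    refine (isHamiltonianDiffeo_iff hθ _).2 ⟨fun t ↦ ψ t * ψ' t, fun t ↦ F t ∘ ψ' t + F' t,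
      hψ.mul hψ', by simp [h0, h0'], by simp [h1, h1'], ?_, fun t ↦ ?_⟩
    · exact (contMDiff_comp_curve hF.smooth hψ').add hF'.smooth
    · exact differential_potential_mul (mdifferentiable_slice hF.smooth t)
        (mdifferentiable_slice hF'.smooth t) (hF.differential_eq t) (hF'.differential_eq t)
  inv_mem' {φ} hφ := by
    obtain ⟨ψ, F, hψ, h0, h1, hF⟩ := (isHamiltonianDiffeo_iff hθ φ).1 hφ
    refine (isHamiltonianDiffeo_iff hθ _).2 ⟨fun t ↦ (ψ t)⁻¹, fun t ↦ -(F t ∘ (ψ t).symm),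
      hψ.inv, by simp [h0], by simp [h1], ?_, fun t ↦ ?_⟩
    · exact (contMDiff_comp_curve_symm hF.smooth hψ).neg
    · exact differential_potential_inv (mdifferentiable_slice hF.smooth t) (hF.differential_eq t)

end HamiltonianIsotopies

/-! ### Primitives on a connected manifold and their dependence on time -/

section Primitives

variable {E : Type*} [NormedAddCommGroup E] [NormedSpace ℝ E] [FiniteDimensional ℝ E]
  {P : Type*} [TopologicalSpace P] [ChartedSpace E P] [IsManifold 𝓘(ℝ, E) ∞ P]

theorem fderiv_comp_chart_symm {F : P → ℝ} (hF : MDifferentiable 𝓘(ℝ, E) 𝓘(ℝ, ℝ) F) {x : P} {y : E}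
    (hy : y ∈ (extChartAt 𝓘(ℝ, E) x).target) :
    fderiv ℝ (F ∘ (extChartAt 𝓘(ℝ, E) x).symm) y = chartExpr (differential F) x y := by
  ext w
  have h1 : MDifferentiableAt 𝓘(ℝ, E) 𝓘(ℝ, E) (extChartAt 𝓘(ℝ, E) x).symm y :=
    (contMDiffAt_chart_symm hy).mdifferentiableAt (by simp)
  have h2 := mvfderiv_comp_mfderiv (hF _) h1 w
  rw [← mfderiv_eq_fderiv]
  exact h2

/-- A function is recovered from its differential by integration along segments in a chart. -/
theorem sub_eq_integral_differential {F : P → ℝ} (hF : ContMDiff 𝓘(ℝ, E) 𝓘(ℝ, ℝ) ∞ F) {p : P}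
    {r : ℝ} (hr : Metric.ball (extChartAt 𝓘(ℝ, E) p p) r ⊆ (extChartAt 𝓘(ℝ, E) p).target) {y : E}
    (hy : y ∈ Metric.ball (extChartAt 𝓘(ℝ, E) p p) r) :
    F ((extChartAt 𝓘(ℝ, E) p).symm y) - F p = ∫ s in (0 : ℝ)..1,
      chartExpr (differential F) p
        (extChartAt 𝓘(ℝ, E) p p + s • (y - extChartAt 𝓘(ℝ, E) p p))
        (y - extChartAt 𝓘(ℝ, E) p p) := by
  set y₀ := extChartAt 𝓘(ℝ, E) p p with hy₀
  have hr0 : 0 < r := Metric.pos_of_mem_ball hy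
  have hseg : ∀ s ∈ Icc (0 : ℝ) 1, y₀ + s • (y - y₀) ∈ (extChartAt 𝓘(ℝ, E) p).target := by
    intro s hs
    refine hr ((convex_ball y₀ r).segment_subset (Metric.mem_ball_self hr0) hy ?_)
    rw [segment_eq_image']
    exact ⟨s, hs, rfl⟩
  have hf : ∀ z ∈ (extChartAt 𝓘(ℝ, E) p).target,
      ContDiffAt ℝ ∞ (F ∘ (extChartAt 𝓘(ℝ, E) p).symm) z := fun z hz ↦
    contMDiffAt_iff_contDiffAt.1 (hF.contMDiffAt.comp z (contMDiffAt_chart_symm hz))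
  have hline : ∀ s : ℝ, HasDerivAt (fun s : ℝ ↦ y₀ + s • (y - y₀)) (y - y₀) s := fun s ↦ by
    simpa using ((hasDerivAt_id s).smul_const (y - y₀)).const_add y₀
  have hmem : ∀ s ∈ uIcc (0 : ℝ) 1, s ∈ Icc (0 : ℝ) 1 := fun s hs ↦ by
    rwa [uIcc_of_le zero_le_one] at hs
  have hd : ∀ s ∈ uIcc (0 : ℝ) 1, HasDerivAt
      (fun s : ℝ ↦ F ((extChartAt 𝓘(ℝ, E) p).symm (y₀ + s • (y - y₀))))
      (chartExpr (differential F) p (y₀ + s • (y - y₀)) (y - y₀)) s := by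
    intro s hs
    have hz := hseg s (hmem s hs)
    rw [← fderiv_comp_chart_symm (hF.mdifferentiable (by simp)) hz]
    exact ((hf _ hz).differentiableAt (by simp)).hasFDerivAt.comp_hasDerivAt s (hline s)
  have hc : ContinuousOn (fun s : ℝ ↦ chartExpr (differential F) p (y₀ + s • (y - y₀)) (y - y₀))
      (uIcc 0 1) := by
    intro s hs
    have hz := hseg s (hmem s hs)
    have h1 : ContinuousAt (chartExpr (differential F) p) (y₀ + s • (y - y₀)) := by
      refine ((hf _ hz).fderiv_right (m := ∞) (by simp)).continuousAt.congr ?_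
      filter_upwards [(isOpen_chart_target p).mem_nhds hz] with z hz
      exact fderiv_comp_chart_symm (hF.mdifferentiable (by simp)) hz
    have h2 : ContinuousAt (fun s : ℝ ↦ chartExpr (differential F) p (y₀ + s • (y - y₀))) s :=
      ContinuousAt.comp (g := chartExpr (differential F) p) h1 (hline s).continuousAt
    exact (h2.clm_apply continuousAt_const).continuousWithinAt
  rw [intervalIntegral.integral_eq_sub_of_hasDerivAt hd hc.intervalIntegrable]
  simp [hy₀]

theorem exists_chart_ball (p : P) : ∃ r > 0,
    Metric.ball (extChartAt 𝓘(ℝ, E) p p) r ⊆ (extChartAt 𝓘(ℝ, E) p).target :=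
  Metric.isOpen_iff.1 (isOpen_chart_target p) _
    ((extChartAt 𝓘(ℝ, E) p).map_source (mem_extChartAt_source p))

theorem eventually_mem_chart_ball (p : P) {r : ℝ} (hr : 0 < r) :
    ∀ᶠ q in 𝓝 p, q ∈ (extChartAt 𝓘(ℝ, E) p).source ∧
      extChartAt 𝓘(ℝ, E) p q ∈ Metric.ball (extChartAt 𝓘(ℝ, E) p p) r :=
  ((isOpen_extChartAt_source (I := 𝓘(ℝ, E)) p).eventually_mem (mem_extChartAt_source p)).and
    ((continuousAt_extChartAt p).eventually_mem (Metric.ball_mem_nhds _ hr))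

/-- On a connected manifold a function with vanishing differential is constant. -/
theorem eq_of_differential_eq_zero [PreconnectedSpace P] {F : P → ℝ}
    (hF : ContMDiff 𝓘(ℝ, E) 𝓘(ℝ, ℝ) ∞ F) (hd : differential (E := E) F = 0) (p q : P) :
    F p = F q := by
  refine IsLocallyConstant.apply_eq_of_preconnectedSpace
    ((IsLocallyConstant.iff_eventually_eq F).2 fun p ↦ ?_) p q
  obtain ⟨r, hr0, hr⟩ := exists_chart_ball (E := E) p
  filter_upwards [eventually_mem_chart_ball (E := E) p hr0] with q hq
  have h := sub_eq_integral_differential hF hr hq.2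
  rw [hd, (extChartAt 𝓘(ℝ, E) p).left_inv hq.1] at h
  have h0 : ∀ y w : E, chartExpr (0 : OneForm E P) p y w = 0 := fun y w ↦ rfl
  simp only [h0, intervalIntegral.integral_zero] at h
  exact sub_eq_zero.1 h

theorem sub_eq_sub_of_differential_eq [PreconnectedSpace P] {F G : P → ℝ}
    (hF : ContMDiff 𝓘(ℝ, E) 𝓘(ℝ, ℝ) ∞ F) (hG : ContMDiff 𝓘(ℝ, E) 𝓘(ℝ, ℝ) ∞ G)
    (hd : differential (E := E) F = differential G) (p q : P) : F p - G p = F q - G q := by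
  refine eq_of_differential_eq_zero (F := F - G) (hF.sub hG) ?_ p q
  rw [differential_sub (hF.mdifferentiable (by simp)) (hG.mdifferentiable (by simp)), hd, sub_self]

/-- Near each `(t, y)` the pull-back is the spatial part of the space-time form, with the target
chart centred at the image point; that form is jointly smooth. -/
theorem contDiffOn_chartExpr_pullback_sub {θ : OneForm E P} (hθ : IsSmoothOneForm θ)
    {ψ : ℝ → Diff E P} (hψ : IsSmoothCurve ψ) (x : P) :
    ContDiffOn ℝ ∞ (fun z : ℝ × E ↦ chartExpr (pullback (ψ z.1) θ - θ) x z.2)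
      (univ ×ˢ (extChartAt 𝓘(ℝ, E) x).target) := by
  rw [contDiffOn_clm_apply]
  rintro w ⟨t, y⟩ ⟨-, hy⟩
  refine ContDiffAt.contDiffWithinAt ?_
  have hy' : ψ t ((extChartAt 𝓘(ℝ, E) x).symm y) ∈
      (extChartAt 𝓘(ℝ, E) (ψ t ((extChartAt 𝓘(ℝ, E) x).symm y))).source :=
    mem_extChartAt_source _
  have h1 : ContDiffAt ℝ ∞ (fun z : ℝ × E ↦ localPullback θ (fun t ↦ ⇑(ψ t)) x
      (ψ t ((extChartAt 𝓘(ℝ, E) x).symm y)) z (0, w)) (t, y) :=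
    (contDiffAt_localPullback hθ hψ.contMDiff_curve hy hy').clm_apply contDiffAt_const
  have h2 : ContDiffAt ℝ ∞ (fun z : ℝ × E ↦ chartExpr θ x z.2 w) (t, y) := by
    have : ContDiffAt ℝ ∞ (chartExpr θ x) y :=
      (contDiffOn_chartExpr hθ x).contDiffAt ((isOpen_chart_target x).mem_nhds hy)
    exact (this.comp (t, y) contDiffAt_snd).clm_apply contDiffAt_const
  refine (h1.sub h2).congr_of_eventuallyEq ?_
  have h3 : ContinuousAt (fun z : ℝ × E ↦ ψ z.1 ((extChartAt 𝓘(ℝ, E) x).symm z.2)) (t, y) :=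
    ContinuousAt.comp (g := fun z : ℝ × P ↦ ψ z.1 z.2) hψ.smooth.continuous.continuousAt
      (contMDiffAt_chart_symm_prod hy).continuousAt
  filter_upwards [h3.eventually_mem
    ((isOpen_extChartAt_source (I := 𝓘(ℝ, E)) _).mem_nhds hy'),
    continuousAt_snd.eventually_mem ((isOpen_chart_target x).mem_nhds hy)] with z hz hz2
  rw [← chartExpr_pullback_curve θ hψ.contMDiff_curve hz2 hz]
  rfl

/-- A family of primitives of `ψ_t^* θ - θ`, each of them smooth, is a smooth family as soon as it
is normalized at one point. -/
theorem IsPotentialFamily.of_slices [PreconnectedSpace P] {θ : OneForm E P}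
    (hθ : IsSmoothOneForm θ) {ψ : ℝ → Diff E P} (hψ : IsSmoothCurve ψ) {F : ℝ → P → ℝ}
    (hF : ∀ t, ContMDiff 𝓘(ℝ, E) 𝓘(ℝ, ℝ) ∞ (F t))
    (hd : ∀ t, differential (F t) = pullback (ψ t) θ - θ) {p₀ : P} (h0 : ∀ t, F t p₀ = 0) :
    IsPotentialFamily θ ψ F := by
  refine ⟨?_, hd⟩
  -- Locally `F_t q - F_t p` is the integral of `ψ_t^*θ - θ` along a chart segment, a quantity `K`
  -- that is jointly smooth and no longer mentions `F`.
  have hloc : ∀ p : P, ∃ (r : ℝ) (K : ℝ × E → ℝ), 0 < r ∧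
      (∀ t, ∀ y ∈ Metric.ball (extChartAt 𝓘(ℝ, E) p p) r, ContDiffAt ℝ ∞ K (t, y)) ∧
      ∀ t q, q ∈ (extChartAt 𝓘(ℝ, E) p).source →
        extChartAt 𝓘(ℝ, E) p q ∈ Metric.ball (extChartAt 𝓘(ℝ, E) p p) r →
        F t q = F t p + K (t, extChartAt 𝓘(ℝ, E) p q) := by
    intro p
    obtain ⟨r, hr0, hr⟩ := exists_chart_ball (E := E) p
    set y₀ := extChartAt 𝓘(ℝ, E) p p with hy₀
    refine ⟨r, fun z ↦ ∫ s in (0 : ℝ)..1,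
      chartExpr (pullback (ψ z.1) θ - θ) p (y₀ + s • (z.2 - y₀)) (z.2 - y₀), hr0, ?_, ?_⟩
    · intro t y hy
      have hV : IsOpen {z : ℝ × ℝ × E | y₀ + z.1 • (z.2.2 - y₀) ∈
          (extChartAt 𝓘(ℝ, E) p).target} :=
        (isOpen_chart_target p).preimage (by fun_prop)
      refine contDiffAt_intervalIntegral (k := fun z : ℝ × ℝ × E ↦
        chartExpr (pullback (ψ z.2.1) θ - θ) p (y₀ + z.1 • (z.2.2 - y₀)) (z.2.2 - y₀)) hV ?_ ?_
      · intro z hz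
        refine ContDiffAt.contDiffWithinAt ?_
        have h1 : ContDiffAt ℝ ∞ (fun z : ℝ × E ↦ chartExpr (pullback (ψ z.1) θ - θ) p z.2)
            (z.2.1, y₀ + z.1 • (z.2.2 - y₀)) :=
          (contDiffOn_chartExpr_pullback_sub hθ hψ p).contDiffAt
            ((isOpen_univ.prod (isOpen_chart_target p)).mem_nhds ⟨mem_univ _, hz⟩)
        have h2 := h1.comp z (f := fun z : ℝ × ℝ × E ↦ (z.2.1, y₀ + z.1 • (z.2.2 - y₀)))
          (by fun_prop)
        exact h2.clm_apply (by fun_prop)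
      · intro s hs
        refine hr ((convex_ball y₀ r).segment_subset (Metric.mem_ball_self hr0) hy ?_)
        rw [segment_eq_image']
        exact ⟨s, hs, rfl⟩
    · intro t q hq hqr
      have h := sub_eq_integral_differential (hF t) hr hqr
      rw [hd, (extChartAt 𝓘(ℝ, E) p).left_inv hq] at h
      exact sub_eq_iff_eq_add'.1 h
  -- Smoothness in time spreads between nearby points by adding or subtracting `K`. It is thus a
  -- locally constant property, and it holds at `p₀` by the normalization.
  have htime : ∀ p, ContDiff ℝ ∞ fun t ↦ F t p := by
    have hlc : IsLocallyConstant fun p ↦ ContDiff ℝ ∞ fun t ↦ F t p := by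
      refine (IsLocallyConstant.iff_eventually_eq _).2 fun p ↦ ?_
      obtain ⟨r, K, hr0, hK, hFK⟩ := hloc p
      filter_upwards [eventually_mem_chart_ball (E := E) p hr0] with q hq
      have hKt : ContDiff ℝ ∞ fun t ↦ K (t, extChartAt 𝓘(ℝ, E) p q) :=
        contDiff_iff_contDiffAt.2 fun t ↦ (hK t _ hq.2).comp t
          (f := fun t : ℝ ↦ (t, extChartAt 𝓘(ℝ, E) p q)) (by fun_prop)
      have hq2 : (fun t ↦ F t q) = fun t ↦ F t p + K (t, extChartAt 𝓘(ℝ, E) p q) :=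
        funext fun t ↦ hFK t q hq.1 hq.2
      refine propext ⟨fun h ↦ ?_, fun h ↦ ?_⟩
      · have h2 := h.sub hKt
        simp only [fun t ↦ hFK t q hq.1 hq.2, add_sub_cancel_right] at h2
        exact h2
      · rw [hq2]
        exact h.add hKt
    intro p
    rw [hlc.apply_eq_of_preconnectedSpace p p₀]
    simpa only [h0] using contDiff_const
  rintro ⟨t, p⟩
  obtain ⟨r, K, hr0, hK, hFK⟩ := hloc p
  have hp : p ∈ (extChartAt 𝓘(ℝ, E) p).source := mem_extChartAt_source p
  have h4 : ContMDiffAt (𝓘(ℝ, ℝ).prod 𝓘(ℝ, E)) 𝓘(ℝ, ℝ × E) ∞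
      (fun z : ℝ × P ↦ (z.1, extChartAt 𝓘(ℝ, E) p z.2)) (t, p) :=
    ContMDiffAt.prodMk_space contMDiffAt_fst ((contMDiffAt_chart hp).comp (t, p) contMDiffAt_snd)
  have h5 : ContMDiffAt (𝓘(ℝ, ℝ).prod 𝓘(ℝ, E)) 𝓘(ℝ, ℝ) ∞ (fun z : ℝ × P ↦ F z.1 p) (t, p) :=
    ContMDiffAt.comp (t, p) (g := fun t ↦ F t p) (htime p).contMDiff.contMDiffAt contMDiffAt_fst
  refine (h5.add (ContMDiffAt.comp (t, p)
    (hK t _ (Metric.mem_ball_self hr0)).contMDiffAt h4)).congr_of_eventuallyEq ?_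
  filter_upwards [(continuousAt_snd (p := (t, p))).eventually
    (eventually_mem_chart_ball (E := E) p hr0)] with z hz
  exact hFK z.1 z.2 hz.1 hz.2

end Primitives

/-! ### The homomorphism to characters of the structure group and its kernel -/

section FluxHomomorphism

variable {E : Type*} [NormedAddCommGroup E] [NormedSpace ℝ E] [FiniteDimensional ℝ E]
  {P : Type*} [TopologicalSpace P] [ChartedSpace E P] [IsManifold 𝓘(ℝ, E) ∞ P]
  {B : Type*} [NormedAddCommGroup B] [NormedSpace ℝ B]
  {M : Type*} [TopologicalSpace M] [ChartedSpace B M]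
  {L : Type*} [NormedAddCommGroup L] [NormedSpace ℝ L]
  {O : Type*} [TopologicalSpace O] [ChartedSpace L O] [Group O]
  {Φ : O → P → P} {pr : P → M} {θ : OneForm E P}

theorem IsPrincipalBundle.contMDiff_action (hP : IsPrincipalBundle E B L Φ pr) (g : O) :
    ContMDiff 𝓘(ℝ, E) 𝓘(ℝ, E) ∞ (Φ g) :=
  hP.smooth_action.comp (contMDiff_const.prodMk contMDiff_id)

theorem IsPrincipalBundle.mdifferentiable_action (hP : IsPrincipalBundle E B L Φ pr) (g : O) :
    MDifferentiable 𝓘(ℝ, E) 𝓘(ℝ, E) (Φ g) :=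
  (hP.contMDiff_action g).mdifferentiable (by simp)

/-- Since `φ` commutes with `Φ_g` and `Φ_g^*θ = θ`, the form `φ^*θ - θ` is itself invariant under
`Φ_g`. -/
theorem differential_potential_comp_action (hP : IsPrincipalBundle E B L Φ pr)
    (hθ : IsInvariantOneForm Φ θ) {φ : Diff E P} (hφ : φ ∈ Aut E Φ) {F : P → ℝ}
    (hF : MDifferentiable 𝓘(ℝ, E) 𝓘(ℝ, ℝ) F) (hd : differential F = pullback φ θ - θ) (g : O) :
    differential (F ∘ Φ g) = pullback φ θ - θ := by
  have hcomm : (φ ∘ Φ g : P → P) = Φ g ∘ φ := funext fun p ↦ hφ g p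
  rw [differential_comp hF (hP.mdifferentiable_action g), hd, pullback_sub, hθ g,
    ← pullback_comp θ φ.mdifferentiable (hP.mdifferentiable_action g), hcomm,
    pullback_comp θ (hP.mdifferentiable_action g) φ.mdifferentiable, hθ g]

theorem potential_sub_action_eq [PreconnectedSpace P] (hP : IsPrincipalBundle E B L Φ pr)
    (hθ : IsInvariantOneForm Φ θ) {φ : Diff E P} (hφ : φ ∈ Aut E Φ) {F : P → ℝ}
    (hF : ContMDiff 𝓘(ℝ, E) 𝓘(ℝ, ℝ) ∞ F) (hd : differential F = pullback φ θ - θ) (g : O)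
    (p q : P) : F p - F (Φ g p) = F q - F (Φ g q) :=
  sub_eq_sub_of_differential_eq hF (hF.comp (hP.contMDiff_action g))
    (hd.trans (differential_potential_comp_action hP hθ hφ (hF.mdifferentiable (by simp)) hd g).symm)
    p q

theorem exists_potential {φ : Diff E P} (hs : IsSmoothOneForm θ) (hφ : IsHamiltonianDiffeo θ φ) :
    ∃ F : P → ℝ, ContMDiff 𝓘(ℝ, E) 𝓘(ℝ, ℝ) ∞ F ∧ differential F = pullback φ θ - θ := by
  obtain ⟨ψ, F, -, -, rfl, hF⟩ := (isHamiltonianDiffeo_iff hs φ).1 hφ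
  exact ⟨F 1, contMDiff_slice hF.smooth 1, hF.differential_eq 1⟩

/-- The group of Hamiltonian automorphisms. -/
def hamAutGroup (Φ : O → P → P) (hs : IsSmoothOneForm θ) : Subgroup (Diff E P) :=
  Aut E Φ ⊓ hamSubgroup θ hs

/-- A smooth primitive of `φ^* θ - θ`. -/
def potential (hs : IsSmoothOneForm θ) (φ : hamAutGroup Φ hs) : P → ℝ :=
  (exists_potential hs φ.2.2).choose

theorem contMDiff_potential (hs : IsSmoothOneForm θ) (φ : hamAutGroup Φ hs) :
    ContMDiff 𝓘(ℝ, E) 𝓘(ℝ, ℝ) ∞ (potential hs φ) :=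
  (exists_potential hs φ.2.2).choose_spec.1

theorem differential_potential (hs : IsSmoothOneForm θ) (φ : hamAutGroup Φ hs) :
    differential (potential hs φ) = pullback φ.1 θ - θ :=
  (exists_potential hs φ.2.2).choose_spec.2

variable [ConnectedSpace P]

/-- The homomorphism `g ↦ F - F ∘ Φ_g` attached to a Hamiltonian automorphism, where
`dF = φ^* θ - θ`. -/
def fluxCharacter (hP : IsPrincipalBundle E B L Φ pr) (hs : IsSmoothOneForm θ)
    (hθ : IsInvariantOneForm Φ θ) (φ : hamAutGroup Φ hs) : Additive O →+ ℝ where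
  toFun g := potential hs φ (Classical.arbitrary P) -
    potential hs φ (Φ g.toMul (Classical.arbitrary P))
  map_zero' := by
    rw [toMul_zero, hP.action_one, sub_self]
  map_add' g h := by
    rw [toMul_add, hP.action_mul, potential_sub_action_eq hP hθ φ.2.1 (contMDiff_potential hs φ)
      (differential_potential hs φ) h.toMul (Classical.arbitrary P)
      (Φ g.toMul (Classical.arbitrary P))]
    ring

/-- Neither the base point nor the chosen primitive matters: two primitives differ by a constant,
which cancels in `F - F ∘ Φ_g`. -/
theorem fluxCharacter_apply (hP : IsPrincipalBundle E B L Φ pr) (hs : IsSmoothOneForm θ)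
    (hθ : IsInvariantOneForm Φ θ) (φ : hamAutGroup Φ hs) {F : P → ℝ}
    (hF : ContMDiff 𝓘(ℝ, E) 𝓘(ℝ, ℝ) ∞ F) (hd : differential F = pullback φ.1 θ - θ) (g : O)
    (p : P) : fluxCharacter hP hs hθ φ (Additive.ofMul g) = F p - F (Φ g p) := by
  change potential hs φ (Classical.arbitrary P) - potential hs φ (Φ g (Classical.arbitrary P)) = _
  rw [potential_sub_action_eq hP hθ φ.2.1 (contMDiff_potential hs φ)
      (differential_potential hs φ) g (Classical.arbitrary P) p]
  have h := sub_eq_sub_of_differential_eq (contMDiff_potential hs φ) hF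
    ((differential_potential hs φ).trans hd.symm) p (Φ g p)
  linarith

/-- The homomorphism from Hamiltonian automorphisms to characters of the structure group. -/
def fluxHom (hP : IsPrincipalBundle E B L Φ pr) (hs : IsSmoothOneForm θ)
    (hθ : IsInvariantOneForm Φ θ) :
    hamAutGroup Φ hs →* Multiplicative (Additive O →+ ℝ) :=
  MonoidHom.mk' (fun φ ↦ Multiplicative.ofAdd (fluxCharacter hP hs hθ φ)) fun φ ψ ↦ by
    rw [← ofAdd_add]
    congr 1
    ext g
    have h1 := fluxCharacter_apply hP hs hθ (φ * ψ)
      (((contMDiff_potential hs φ).comp ψ.1.contMDiff).add (contMDiff_potential hs ψ))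
      (differential_potential_mul ((contMDiff_potential hs φ).mdifferentiable (by simp))
        ((contMDiff_potential hs ψ).mdifferentiable (by simp)) (differential_potential hs φ)
        (differential_potential hs ψ)) g (Classical.arbitrary P)
    -- The constant of `φ` is evaluated at the image point under `ψ`, to match the summand `F_φ ∘ ψ`
    -- of the primitive of the product.
    have h2 := fluxCharacter_apply hP hs hθ φ (contMDiff_potential hs φ)
      (differential_potential hs φ) g (ψ.1 (Classical.arbitrary P))
    have h3 := fluxCharacter_apply hP hs hθ ψ (contMDiff_potential hs ψ)
      (differential_potential hs ψ) g (Classical.arbitrary P)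
    change fluxCharacter hP hs hθ (φ * ψ) (Additive.ofMul g) =
      fluxCharacter hP hs hθ φ (Additive.ofMul g) + fluxCharacter hP hs hθ ψ (Additive.ofMul g)
    rw [h1, h2, h3, ← ψ.2.1 g]
    simp only [Pi.add_apply, Function.comp_apply]
    ring

theorem fluxHom_apply (hP : IsPrincipalBundle E B L Φ pr) (hs : IsSmoothOneForm θ)
    (hθ : IsInvariantOneForm Φ θ) (φ : hamAutGroup Φ hs) {F : P → ℝ}
    (hF : ContMDiff 𝓘(ℝ, E) 𝓘(ℝ, ℝ) ∞ F) (hd : differential F = pullback φ.1 θ - θ) (g : O)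
    (p : P) : (fluxHom hP hs hθ φ).toAdd (Additive.ofMul g) = F p - F (Φ g p) :=
  fluxCharacter_apply hP hs hθ φ hF hd g p

theorem mem_map_ker_fluxHom_iff (hP : IsPrincipalBundle E B L Φ pr) (hs : IsSmoothOneForm θ)
    (hθ : IsInvariantOneForm Φ θ) (φ : Diff E P) :
    φ ∈ (fluxHom hP hs hθ).ker.map (hamAutGroup Φ hs).subtype ↔
      φ ∈ hamAutGroup Φ hs ∧ ∃ F : P → ℝ, ContMDiff 𝓘(ℝ, E) 𝓘(ℝ, ℝ) ∞ F ∧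
        differential F = pullback φ θ - θ ∧ ∀ g p, F (Φ g p) = F p := by
  constructor
  · rintro ⟨φ, hφ, rfl⟩
    refine ⟨φ.2, potential hs φ, contMDiff_potential hs φ, differential_potential hs φ,
      fun g p ↦ ?_⟩
    have h := fluxHom_apply hP hs hθ φ (contMDiff_potential hs φ) (differential_potential hs φ) g p
    rw [MonoidHom.mem_ker.1 hφ] at h
    exact (sub_eq_zero.1 h.symm).symm
  · rintro ⟨hφ, F, hF, hd, hinv⟩
    refine ⟨⟨φ, hφ⟩, MonoidHom.mem_ker.2 ?_, rfl⟩
    refine congrArg Multiplicative.ofAdd (AddMonoidHom.ext fun g ↦ ?_)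
    have h := fluxHom_apply hP hs hθ ⟨φ, hφ⟩ hF hd g.toMul (Classical.arbitrary P)
    rw [hinv, sub_self] at h
    exact h

/-- The velocity of an equivariant isotopy is an invariant vector field. -/
theorem HasVelocityAt.equivariant (hP : IsPrincipalBundle E B L Φ pr) {ψ : ℝ → Diff E P}
    (hψ : ∀ t, ψ t ∈ Aut E Φ) {t : ℝ} {X : VectorField E P} (hX : HasVelocityAt ψ t X) (g : O)
    (q : P) : (X (Φ g q) : E) = mfderiv 𝓘(ℝ, E) 𝓘(ℝ, E) (Φ g) q (X q) := by
  obtain ⟨p, rfl⟩ : ∃ p, ψ t p = q := (ψ t).surjective q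
  have h1 := hX (Φ g p)
  have h2 := (hP.mdifferentiable_action g (ψ t p)).hasMFDerivAt.comp t (hX p)
  have h3 := h1.congr_of_eventuallyEq (f₁ := Φ g ∘ fun s ↦ ψ s p)
    (Eventually.of_forall fun s ↦ (hψ s g p).symm)
  have h4 := congrArg (fun A : ℝ →L[ℝ] E ↦ A 1) (hasMFDerivAt_unique h3 h2)
  have h5 : (X (ψ t (Φ g p)) : E) = mfderiv 𝓘(ℝ, E) 𝓘(ℝ, E) (Φ g) (ψ t p) (X (ψ t p)) := by
    have e1 : ((1 : ℝ →L[ℝ] ℝ).smulRight (X (ψ t (Φ g p)) : E)) 1 = X (ψ t (Φ g p)) := by simp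
    have e2 : ((1 : ℝ →L[ℝ] ℝ).smulRight (X (ψ t p) : E)) 1 = X (ψ t p) := by simp
    refine e1.symm.trans (h4.trans ?_)
    exact congrArg (mfderiv 𝓘(ℝ, E) 𝓘(ℝ, E) (Φ g) (ψ t p)) e2
  rw [← h5]
  exact congrArg (fun q ↦ (X q : E)) (hψ t g p).symm

theorem HasVelocityAt.unique {ψ : ℝ → Diff E P} {t : ℝ} {X Y : VectorField E P}
    (hX : HasVelocityAt ψ t X) (hY : HasVelocityAt ψ t Y) : X = Y := by
  funext q
  obtain ⟨p, rfl⟩ : ∃ p, ψ t p = q := (ψ t).surjective q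
  have h4 := congrArg (fun A : ℝ →L[ℝ] E ↦ A 1) (hasMFDerivAt_unique (hX p) (hY p))
  have e : ∀ v : E, ((1 : ℝ →L[ℝ] ℝ).smulRight v) 1 = v := fun v ↦ by simp
  exact (e (X (ψ t p))).symm.trans (h4.trans (e (Y (ψ t p))))

/-- Each member of the curve has an invariant primitive. The recovered Hamiltonian at time zero is
built from `θ`, the equivariant velocity and these primitives, hence is invariant. -/
theorem formalLieAlgebra_ker_subset (hP : IsPrincipalBundle E B L Φ pr) (hs : IsSmoothOneForm θ)
    (hθ : IsInvariantOneForm Φ θ) :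
    formalLieAlgebra ((fluxHom hP hs hθ).ker.map (hamAutGroup Φ hs).subtype) ⊆
      invariantHamiltonianVectorFields Φ θ := by
  rintro X ⟨ψ, hψ, hker, -, hX⟩
  have hker' := fun t ↦ (mem_map_ker_fluxHom_iff hP hs hθ (ψ t)).1 (hker t)
  have hAut : ∀ t, ψ t ∈ Aut E Φ := fun t ↦ (hker' t).1.1
  choose F₀ hF₀ hd₀ hinv₀ using fun t ↦ (hker' t).2
  obtain ⟨Y, hY⟩ := hψ.exists_velocity
  -- The primitives are chosen separately at each time, so nothing is known about their dependence
  -- on `t`. Subtracting the value at a base point makes the family smooth and keeps each member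
  -- invariant.
  have hF : IsPotentialFamily θ ψ fun t p ↦ F₀ t p - F₀ t (Classical.arbitrary P) := by
    refine .of_slices hs hψ (fun t ↦ (hF₀ t).sub contMDiff_const) (fun t ↦ ?_)
      (p₀ := Classical.arbitrary P) (fun t ↦ sub_self _)
    rw [← hd₀ t]
    have h := differential_sub ((hF₀ t).mdifferentiable (by simp))
      (contMDiff_const (c := F₀ t (Classical.arbitrary P))
        (I := 𝓘(ℝ, E)) (M := P) (I' := 𝓘(ℝ, ℝ)) (n := ∞) |>.mdifferentiable (by simp))
    rw [differential_const, sub_zero] at h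
    exact h
  rw [hX.unique (hY 0)]
  refine ⟨recoveredHamiltonian θ Y ψ _ 0,
    contMDiff_slice (contMDiff_recoveredHamiltonian hs hψ hY hF.smooth) 0, fun g q ↦ ?_,
    isHamiltonianVectorField_recoveredHamiltonian hs hψ hY hF 0⟩
  have h1 : (ψ 0).symm (Φ g q) = Φ g ((ψ 0).symm q) := (Aut E Φ).inv_mem (hAut 0) g q
  have h2 : θ (Φ g q) (Y 0 (Φ g q)) = θ q (Y 0 q) := by
    have h3 : θ (Φ g q) (Y 0 (Φ g q)) = pullback (Φ g) θ q (Y 0 q) :=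
      congrArg (θ (Φ g q)) ((hY 0).equivariant hP hAut g q)
    rw [h3, hθ g]
  rw [recoveredHamiltonian, recoveredHamiltonian, h1, h2]
  simp only [hinv₀]

end FluxHomomorphism

/-! ### Smooth vector fields, completeness and flows -/

section VectorFields

variable {E : Type*} [NormedAddCommGroup E] [NormedSpace ℝ E] [FiniteDimensional ℝ E]
  {P : Type*} [TopologicalSpace P] [ChartedSpace E P] [IsManifold 𝓘(ℝ, E) ∞ P]
  {X : VectorField E P}

/-- Smoothness of a vector field, as a section of the tangent bundle. -/
def IsSmoothField (X : VectorField E P) : Prop :=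
  ContMDiff 𝓘(ℝ, E) 𝓘(ℝ, E).tangent ∞ (fun p ↦ (⟨p, X p⟩ : TangentBundle 𝓘(ℝ, E) P))

/-- The expression of a vector field in the chart centred at `x`. -/
def chartField (X : VectorField E P) (x : P) (y : E) : E :=
  chartDeriv x ((extChartAt 𝓘(ℝ, E) x).symm y) (X ((extChartAt 𝓘(ℝ, E) x).symm y))

/-- The trivialization of the tangent bundle at `x` is the derivative of the chart centred at `x`.
-/
theorem contMDiffAt_field_iff {x q : P} (hq : q ∈ (extChartAt 𝓘(ℝ, E) x).source) :
    ContMDiffAt 𝓘(ℝ, E) 𝓘(ℝ, E).tangent ∞ (fun p ↦ (⟨p, X p⟩ : TangentBundle 𝓘(ℝ, E) P)) q ↔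
      ContMDiffAt 𝓘(ℝ, E) 𝓘(ℝ, E) ∞ (fun p ↦ chartDeriv x p (X p)) q := by
  have hq' : q ∈ (trivializationAt E (TangentSpace 𝓘(ℝ, E) : P → Type _) x).baseSet := by
    rwa [TangentBundle.trivializationAt_baseSet, ← extChartAt_source 𝓘(ℝ, E)]
  refine ((trivializationAt E (TangentSpace 𝓘(ℝ, E) : P → Type _) x).contMDiffAt_section_iff
    (s := X) hq').trans (Filter.EventuallyEq.contMDiffAt_iff ?_)
  filter_upwards [(isOpen_extChartAt_source (I := 𝓘(ℝ, E)) x).mem_nhds hq] with p hp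
  rw [extChartAt_source] at hp
  have hp' : p ∈ (trivializationAt E (TangentSpace 𝓘(ℝ, E) : P → Type _) x).baseSet := by
    rwa [TangentBundle.trivializationAt_baseSet]
  rw [← (trivializationAt E (TangentSpace 𝓘(ℝ, E) : P → Type _) x).continuousLinearMapAt_apply_of_mem
    (R := ℝ) hp', TangentBundle.continuousLinearMapAt_trivializationAt hp]
  rfl

theorem IsSmoothField.contDiffAt_chartField (hX : IsSmoothField X) {x : P} {y : E}
    (hy : y ∈ (extChartAt 𝓘(ℝ, E) x).target) : ContDiffAt ℝ ∞ (chartField X x) y :=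
  contMDiffAt_iff_contDiffAt.1 (((contMDiffAt_field_iff
    ((extChartAt 𝓘(ℝ, E) x).map_target hy)).1 hX.contMDiffAt).comp y (contMDiffAt_chart_symm hy))

theorem isSmoothField_of_chartField
    (h : ∀ x : P, ContDiffAt ℝ ∞ (chartField X x) (extChartAt 𝓘(ℝ, E) x x)) : IsSmoothField X := by
  intro x
  have hx : x ∈ (extChartAt 𝓘(ℝ, E) x).source := mem_extChartAt_source x
  refine (contMDiffAt_field_iff hx).2 ?_
  refine ((h x).contMDiffAt.comp x (contMDiffAt_chart hx)).congr_of_eventuallyEq ?_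
  filter_upwards [(isOpen_extChartAt_source (I := 𝓘(ℝ, E)) x).mem_nhds hx] with p hp
  simp only [Function.comp_apply, chartField]
  rw [(extChartAt 𝓘(ℝ, E) x).left_inv hp]

theorem IsSmoothField.congr_of_eventuallyEq {Y : P → VectorField E P}
    (hY : ∀ q, IsSmoothField (Y q)) (h : ∀ q, ∀ᶠ p in 𝓝 q, X p = Y q p) : IsSmoothField X := by
  intro q
  refine (hY q q).congr_of_eventuallyEq ?_
  filter_upwards [h q] with p hp
  rw [hp]

theorem isSmoothField_zero : IsSmoothField (0 : VectorField E P) :=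
  contMDiff_zeroSection ℝ (TangentSpace 𝓘(ℝ, E) : P → Type _)

theorem IsSmoothField.const_smul (hX : IsSmoothField X) (a : ℝ) : IsSmoothField (a • X) :=
  ContMDiff.const_smul_section hX

theorem IsSmoothField.of_le_one (hX : IsSmoothField X) : ContMDiff 𝓘(ℝ, E) 𝓘(ℝ, E).tangent 1
    (fun p ↦ (⟨p, X p⟩ : TangentBundle 𝓘(ℝ, E) P)) :=
  ContMDiff.of_le hX (by simp)

theorem chartSymmDeriv_chartField {x : P} {y : E} (hy : y ∈ (extChartAt 𝓘(ℝ, E) x).target) :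
    chartSymmDeriv x y (chartField X x y) = X ((extChartAt 𝓘(ℝ, E) x).symm y) :=
  chartSymmDeriv_chartDeriv hy _

/-- Integral curves of `τ X`, for `τ` small, exist on `(-2, 2)` and depend smoothly on the scale
`τ` and the initial point. -/
theorem IsSmoothField.exists_local_integralCurves (hX : IsSmoothField X) (x : P) :
    ∃ c : ℝ × P → ℝ → P,
      ContMDiffAt (𝓘(ℝ, ℝ).prod 𝓘(ℝ, E)) 𝓘(ℝ, E) ∞ (fun z ↦ c z 1) (0, x) ∧
      ∀ᶠ z in 𝓝 ((0 : ℝ), x), c z 0 = z.2 ∧ IsMIntegralCurveOn (c z) (z.1 • X) (Ioo (-2) 2) := by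
  have hx : x ∈ (extChartAt 𝓘(ℝ, E) x).source := mem_extChartAt_source x
  have hy := (extChartAt 𝓘(ℝ, E) x).map_source hx
  set y₀ := extChartAt 𝓘(ℝ, E) x x with hy₀
  obtain ⟨V, hV, U, hU, hyU, hUt, hVU⟩ := exists_contDiff_eqOn_nhds_of_isCompact
    (f := chartField X x) (isOpen_chart_target x) (isCompact_singleton (x := y₀))
    (singleton_subset_iff.2 hy) fun y hy ↦ (hX.contDiffAt_chartField hy).contDiffWithinAt
  obtain ⟨r, hr0, hr⟩ := Metric.isOpen_iff.1 hU y₀ (singleton_subset_iff.1 hyU)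
  obtain ⟨S, hS, hSr⟩ := exists_smooth_localFlow hV y₀
  have h4 : ContMDiffAt (𝓘(ℝ, ℝ).prod 𝓘(ℝ, E)) 𝓘(ℝ, ℝ × E) ∞
      (fun z : ℝ × P ↦ (z.1, extChartAt 𝓘(ℝ, E) x z.2)) (0, x) :=
    ContMDiffAt.prodMk_space contMDiffAt_fst ((contMDiffAt_chart hx).comp (0, x) contMDiffAt_snd)
  have h5 : ∀ᶠ z in 𝓝 ((0 : ℝ), x), S (z.1, extChartAt 𝓘(ℝ, E) x z.2) 0 =
      extChartAt 𝓘(ℝ, E) x z.2 ∧ ∀ s ∈ Ioo (-2 : ℝ) 2,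
        HasDerivAt (S (z.1, extChartAt 𝓘(ℝ, E) x z.2))
          (z.1 • V (S (z.1, extChartAt 𝓘(ℝ, E) x z.2) s)) s ∧
        S (z.1, extChartAt 𝓘(ℝ, E) x z.2) s ∈ Metric.ball y₀ r :=
    h4.continuousAt.eventually (hSr r hr0)
  refine ⟨fun z s ↦ (extChartAt 𝓘(ℝ, E) x).symm (S (z.1, extChartAt 𝓘(ℝ, E) x z.2) s), ?_, ?_⟩
  · have h6 : S (0, y₀) 1 ∈ (extChartAt 𝓘(ℝ, E) x).target :=
      hUt (hr (((hSr r hr0).self_of_nhds.2 1 (by norm_num)).2))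
    exact (contMDiffAt_chart_symm h6).comp (0, x) (ContMDiffAt.comp (0, x) hS.contMDiffAt h4)
  · filter_upwards [h5, (continuousAt_snd (p := ((0 : ℝ), x))).eventually_mem
      ((isOpen_extChartAt_source (I := 𝓘(ℝ, E)) x).mem_nhds hx)] with z hz hz2
    refine ⟨?_, fun s hs ↦ ?_⟩
    · simp only [hz.1]
      exact (extChartAt 𝓘(ℝ, E) x).left_inv hz2
    · obtain ⟨h7, h8⟩ := hz.2 s hs
      have h9 := hUt (hr h8)
      rw [hVU (hr h8)] at h7
      refine (hasMFDerivAt_chart_symm_comp h9 h7).hasMFDerivWithinAt.congr_mfderiv ?_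
      refine congrArg (fun v : E ↦ (1 : ℝ →L[ℝ] ℝ).smulRight v) ?_
      rw [map_smul, chartSymmDeriv_chartField h9]
      rfl

/-- Near each point, integral curves exist for a uniform time. -/
theorem IsSmoothField.exists_uniform_time (hX : IsSmoothField X) (x : P) :
    ∃ ε > 0, ∀ᶠ q in 𝓝 x, ∃ γ : ℝ → P, γ 0 = q ∧ IsMIntegralCurveOn γ X (Ioo (-ε) ε) := by
  obtain ⟨c, -, hc⟩ := hX.exists_local_integralCurves x
  obtain ⟨A, hA, W, hW, hAW⟩ := Filter.eventually_prod_iff.1 (nhds_prod_eq (x := (0 : ℝ)) (y := x) ▸ hc)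
  obtain ⟨ε, hε, hεA⟩ := Metric.eventually_nhds_iff.1 hA
  refine ⟨ε / 2, by positivity, hW.mono fun q hq ↦ ?_⟩
  have hε2 : A (ε / 2) := hεA (by rw [Real.dist_eq, sub_zero, abs_of_pos] <;> linarith)
  obtain ⟨h0, h1⟩ := hAW hε2 hq
  -- A curve of `(ε / 2) • X` on `(-2, 2)` becomes, after slowing time by the factor `ε / 2`, a
  -- curve of `X` on `(-ε, ε)`.
  refine ⟨c (ε / 2, q) ∘ (· * (ε / 2)⁻¹), by simpa using h0, ?_⟩
  have h2 := h1.comp_mul (ε / 2)⁻¹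
  have hne : ε / 2 ≠ 0 := by positivity
  simp only [smul_smul, inv_mul_cancel₀ hne, one_smul] at h2
  refine h2.mono fun t ht ↦ ?_
  have hpos : 0 < ε / 2 := by positivity
  constructor
  · rw [← div_eq_mul_inv, lt_div_iff₀ hpos]
    linarith [ht.1]
  · rw [← div_eq_mul_inv, div_lt_iff₀ hpos]
    linarith [ht.2]

/-- Completeness of a vector field. -/
def IsCompleteField (X : VectorField E P) : Prop :=
  ∀ x : P, ∃ γ : ℝ → P, γ 0 = x ∧ IsMIntegralCurve γ X

theorem IsSmoothField.integralCurve_eq [T2Space P] (hX : IsSmoothField X) {γ γ' : ℝ → P}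
    (hγ : IsMIntegralCurve γ X) (hγ' : IsMIntegralCurve γ' X) {t : ℝ} (h : γ t = γ' t) : γ = γ' :=
  isMIntegralCurve_Ioo_eq_of_contMDiff_boundaryless hX.of_le_one hγ hγ' h

/-- The flow of a complete vector field. -/
def fieldFlow (hc : IsCompleteField X) (t : ℝ) (x : P) : P := (hc x).choose t

theorem fieldFlow_zero (hc : IsCompleteField X) (x : P) : fieldFlow hc 0 x = x :=
  (hc x).choose_spec.1

theorem isMIntegralCurve_fieldFlow (hc : IsCompleteField X) (x : P) :
    IsMIntegralCurve (fun t ↦ fieldFlow hc t x) X :=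
  (hc x).choose_spec.2

theorem fieldFlow_add [T2Space P] (hX : IsSmoothField X) (hc : IsCompleteField X) (s t : ℝ)
    (x : P) : fieldFlow hc (s + t) x = fieldFlow hc s (fieldFlow hc t x) :=
  congrFun (hX.integralCurve_eq (t := 0) ((isMIntegralCurve_fieldFlow hc x).comp_add t)
    (isMIntegralCurve_fieldFlow hc (fieldFlow hc t x)) (by simp [fieldFlow_zero])) s

/-- Flowing along `X` for time `τ` is flowing along `τ • X` for time one. By uniqueness this is the
smooth local solution evaluated at `1`, an interior point of `(-2, 2)`. -/
theorem contMDiffAt_fieldFlow_zero [T2Space P] (hX : IsSmoothField X) (hc : IsCompleteField X)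
    (x : P) : ContMDiffAt (𝓘(ℝ, ℝ).prod 𝓘(ℝ, E)) 𝓘(ℝ, E) ∞
      (fun z : ℝ × P ↦ fieldFlow hc z.1 z.2) (0, x) := by
  obtain ⟨c, hcs, hci⟩ := hX.exists_local_integralCurves x
  refine hcs.congr_of_eventuallyEq ?_
  filter_upwards [hci] with z hz
  have h1 : IsMIntegralCurveOn ((fun t ↦ fieldFlow hc t z.2) ∘ (· * z.1)) (z.1 • X)
      (Ioo (-2) 2) :=
    ((isMIntegralCurve_fieldFlow hc z.2).comp_mul z.1).isMIntegralCurveOn _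
  have h2 := isMIntegralCurveOn_Ioo_eqOn_of_contMDiff_boundaryless (t₀ := 0) (by norm_num)
    (hX.const_smul z.1).of_le_one h1 hz.2 (by simp [fieldFlow_zero, hz.1])
  have h3 := h2 (x := 1) (by norm_num)
  simpa using h3

/-- For fixed `x`, the times at which the flow is smooth near `(t, x)` form an open and closed set
containing zero; the group law carries smoothness from time zero onwards. -/
theorem contMDiff_fieldFlow [T2Space P] (hX : IsSmoothField X) (hc : IsCompleteField X) :
    ContMDiff (𝓘(ℝ, ℝ).prod 𝓘(ℝ, E)) 𝓘(ℝ, E) ∞ (fun z : ℝ × P ↦ fieldFlow hc z.1 z.2) := by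
  -- At a finite order, regularity at a point implies regularity at all nearby points; this is what
  -- openness needs.
  refine contMDiff_infty.2 fun n ↦ ?_
  rintro ⟨T, x⟩
  have : IsManifold 𝓘(ℝ, E) n P := IsManifold.of_le (n := ∞) (by exact_mod_cast le_top)
  have hev : ∀ z : ℝ × P, ContMDiffAt (𝓘(ℝ, ℝ).prod 𝓘(ℝ, E)) 𝓘(ℝ, E) n
      (fun z : ℝ × P ↦ fieldFlow hc z.1 z.2) z → ∀ᶠ w in 𝓝 z,
      ContMDiffAt (𝓘(ℝ, ℝ).prod 𝓘(ℝ, E)) 𝓘(ℝ, E) n (fun z : ℝ × P ↦ fieldFlow hc z.1 z.2) w :=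
    fun z hz ↦ (contMDiffAt_iff_contMDiffAt_nhds (by simp)).1 hz
  have h0 : ∀ x, ContMDiffAt (𝓘(ℝ, ℝ).prod 𝓘(ℝ, E)) 𝓘(ℝ, E) n
      (fun z : ℝ × P ↦ fieldFlow hc z.1 z.2) (0, x) := fun x ↦
    (contMDiffAt_fieldFlow_zero hX hc x).of_le (by exact_mod_cast le_top)
  let A : Set ℝ := {t | ContMDiffAt (𝓘(ℝ, ℝ).prod 𝓘(ℝ, E)) 𝓘(ℝ, E) n
    (fun z : ℝ × P ↦ fieldFlow hc z.1 z.2) (t, x)}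
  have hopen : IsOpen A := by
    refine isOpen_iff_mem_nhds.2 fun t ht ↦ ?_
    exact (Continuous.prodMk_left x).continuousAt.eventually (hev _ ht)
  have hclosed : IsClosed A := by
    -- For good `s` close to `t`, the flow factors near `(t, x)` as the flow for the short time `z.1
    -- - s` after the flow for time `s`, and `(t - s, fieldFlow hc s x)` is close to `(0, fieldFlow
    -- hc t x)`.
    refine isClosed_iff_frequently.2 fun t ht ↦ ?_
    have h1 : ContinuousAt (fun s ↦ (t - s, fieldFlow hc s x)) t :=
      ContinuousAt.prodMk (by fun_prop) (isMIntegralCurve_fieldFlow hc x t).continuousAt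
    have h2 : ∀ᶠ s in 𝓝 t, ContMDiffAt (𝓘(ℝ, ℝ).prod 𝓘(ℝ, E)) 𝓘(ℝ, E) n
        (fun z : ℝ × P ↦ fieldFlow hc z.1 z.2) (t - s, fieldFlow hc s x) :=
      h1.eventually (by simpa using hev _ (h0 (fieldFlow hc t x)))
    obtain ⟨s, hsA, hs⟩ := (ht.and_eventually h2).exists
    have h3 : ContMDiffAt 𝓘(ℝ, E) 𝓘(ℝ, E) n (fun q ↦ fieldFlow hc s q) x :=
      ContMDiffAt.comp x hsA (contMDiffAt_const.prodMk contMDiffAt_id)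
    have h4 : ContMDiffAt (𝓘(ℝ, ℝ).prod 𝓘(ℝ, E)) (𝓘(ℝ, ℝ).prod 𝓘(ℝ, E)) n
        (fun z : ℝ × P ↦ (z.1 - s, fieldFlow hc s z.2)) (t, x) :=
      (contMDiffAt_fst.sub contMDiffAt_const).prodMk (h3.comp (t, x) contMDiffAt_snd)
    refine (ContMDiffAt.comp (t, x) hs h4).congr_of_eventuallyEq (Eventually.of_forall fun z ↦ ?_)
    simp only [Function.comp_apply]
    rw [← fieldFlow_add hX, sub_add_cancel]
  have hA : A = univ := IsClopen.eq_univ ⟨hclosed, hopen⟩ ⟨0, h0 x⟩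
  have hT : T ∈ A := by
    rw [hA]
    exact mem_univ T
  exact hT

/-- A smooth complete vector field generates a smooth curve of diffeomorphisms. -/
theorem IsSmoothField.exists_flow [T2Space P] (hX : IsSmoothField X) (hc : IsCompleteField X) :
    ∃ ψ : ℝ → Diff E P, IsSmoothCurve ψ ∧ ψ 0 = 1 ∧ ∀ t, HasVelocityAt ψ t X := by
  have hs := contMDiff_fieldFlow hX hc
  have hinv : ∀ t x, fieldFlow hc (-t) (fieldFlow hc t x) = x := fun t x ↦ by
    rw [← fieldFlow_add hX, neg_add_cancel, fieldFlow_zero]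
  have hinv' : ∀ t x, fieldFlow hc t (fieldFlow hc (-t) x) = x := fun t x ↦ by
    rw [← fieldFlow_add hX, add_neg_cancel, fieldFlow_zero]
  let ψ : ℝ → Diff E P := fun t ↦
    { toFun := fieldFlow hc t
      invFun := fieldFlow hc (-t)
      left_inv := hinv t
      right_inv := hinv' t
      contMDiff_toFun := hs.comp (contMDiff_const.prodMk contMDiff_id)
      contMDiff_invFun := hs.comp (contMDiff_const.prodMk contMDiff_id) }
  refine ⟨ψ, ⟨hs, hs.comp (contMDiff_fst.neg.prodMk contMDiff_snd)⟩, ?_, fun t p ↦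
    isMIntegralCurve_fieldFlow hc p t⟩
  exact Diffeomorph.ext fun x ↦ fieldFlow_zero hc x

theorem isMIntegralCurve_of_hasVelocityAt {ψ : ℝ → Diff E P} (h : ∀ t, HasVelocityAt ψ t X)
    (p : P) : IsMIntegralCurve (fun t ↦ ψ t p) X := fun t ↦ h t p

/-- A vector field is complete if each of its nonzero values is attained by a complete field which
coincides with it outside its zeros. -/
theorem isCompleteField_of_pieces [T2Space P]
    (h : ∀ x, X x ≠ 0 → ∃ Y : VectorField E P, IsSmoothField Y ∧ IsCompleteField Y ∧ Y x = X x ∧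
      ∀ q, Y q ≠ 0 → Y q = X q) : IsCompleteField X := by
  intro x
  by_cases hx : X x = 0
  · exact ⟨fun _ ↦ x, rfl, isMIntegralCurve_const hx⟩
  obtain ⟨Y, hY, hYc, hYx, hYX⟩ := h x hx
  obtain ⟨γ, hγ0, hγ⟩ := hYc x
  refine ⟨γ, hγ0, fun t ↦ ?_⟩
  -- An integral curve of `Y` meeting a zero of `Y` is constant, which is impossible as `Y x = X x ≠
  -- 0`. So the curve stays where `Y` and `X` agree.
  have hne : Y (γ t) ≠ 0 := by
    intro h0
    have h1 := hY.integralCurve_eq (t := t) hγ (isMIntegralCurve_const h0) rfl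
    have h2 : γ t = x := by rw [← hγ0, congrFun h1 0]
    rw [h2, hYx] at h0
    exact hx h0
  rw [← hYX _ hne]
  exact hγ t

end VectorFields

/-! ### Existence and smoothness of Hamiltonian vector fields -/

section HamiltonianFields

variable {E : Type*} [NormedAddCommGroup E] [NormedSpace ℝ E] [FiniteDimensional ℝ E]
  {P : Type*} [TopologicalSpace P] [ChartedSpace E P] [IsManifold 𝓘(ℝ, E) ∞ P]
  {θ : OneForm E P}

/-- The expression of the form `-dθ` in the chart centred at `x`. -/
def symplChart (θ : OneForm E P) (x : P) (y : E) : E →L[ℝ] E →L[ℝ] ℝ :=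
  (fderiv ℝ (chartExpr θ x) y).flip - fderiv ℝ (chartExpr θ x) y

theorem symplForm_eq_chart (hθ : IsSmoothOneForm θ) {q x : P}
    (hx : q ∈ (extChartAt 𝓘(ℝ, E) x).source) (u v : TangentSpace 𝓘(ℝ, E) q) :
    symplForm θ q u v =
      symplChart θ x (extChartAt 𝓘(ℝ, E) x q) (chartDeriv x q u) (chartDeriv x q v) := by
  rw [symplForm, extDerivOneForm_eq_chart hθ hx, vectorExtDeriv, neg_sub]
  rfl

set_option synthInstance.maxHeartbeats 200000 in
set_option maxHeartbeats 800000 in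
theorem contDiffAt_symplChart (hθ : IsSmoothOneForm θ) {x : P} {y : E}
    (hy : y ∈ (extChartAt 𝓘(ℝ, E) x).target) : ContDiffAt ℝ ∞ (symplChart θ x) y := by
  have h1 : ContDiffAt ℝ ∞ (chartExpr θ x) y :=
    (contDiffOn_chartExpr hθ x).contDiffAt ((isOpen_chart_target x).mem_nhds hy)
  have h2 : ContDiffAt ℝ ∞ (fderiv ℝ (chartExpr θ x)) y := h1.fderiv_right (m := ∞) (by simp)
  exact ((ContinuousLinearMap.flipₗᵢ ℝ E E ℝ).toContinuousLinearEquiv.contDiff.contDiffAt.comp y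
    h2).sub h2

/-- Nondegeneracy gives injectivity, and `E` has the same finite dimension as its dual. -/
theorem IsExactSymplectic.isInvertible_symplChart (hω : IsExactSymplectic θ) {x : P} {y : E}
    (hy : y ∈ (extChartAt 𝓘(ℝ, E) x).target) : (symplChart θ x y).IsInvertible := by
  have hq := (extChartAt 𝓘(ℝ, E) x).map_target hy
  have hinj : Function.Injective (symplChart θ x y : E →ₗ[ℝ] E →L[ℝ] ℝ) := by
    refine (injective_iff_map_eq_zero _).2 fun w hw ↦ ?_
    obtain ⟨u, rfl⟩ := chartDeriv_surjective hq w
    have hu : u = 0 := by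
      refine hω.nondegenerate _ u fun v ↦ ?_
      rw [symplForm_eq_chart hω.smooth hq, (extChartAt 𝓘(ℝ, E) x).right_inv hy]
      exact congrArg (fun A : E →L[ℝ] ℝ ↦ A _) hw
    rw [hu, map_zero]
  have hrank : Module.finrank ℝ E = Module.finrank ℝ (E →L[ℝ] ℝ) := by
    rw [← (LinearMap.toContinuousLinearMap (𝕜 := ℝ) (E := E) (F' := ℝ)).finrank_eq]
    exact (Subspace.dual_finrank_eq (K := ℝ) (V := E)).symm
  refine ⟨(LinearMap.linearEquivOfInjective _ hinj hrank).toContinuousLinearEquiv, ?_⟩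
  ext u v
  rfl

theorem symplForm_sub_left (p : P) (u u' v : TangentSpace 𝓘(ℝ, E) p) :
    symplForm θ p (u - u') v = symplForm θ p u v - symplForm θ p u' v := by
  simp only [symplForm, extDerivOneForm_eq, vectorExtDeriv, map_sub, sub_apply]
  ring

theorem symplForm_add_left (p : P) (u u' v : TangentSpace 𝓘(ℝ, E) p) :
    symplForm θ p (u + u') v = symplForm θ p u v + symplForm θ p u' v := by
  simp only [symplForm, extDerivOneForm_eq, vectorExtDeriv, map_add, add_apply]
  ring

theorem symplForm_smul_left (p : P) (a : ℝ) (u v : TangentSpace 𝓘(ℝ, E) p) :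
    symplForm θ p (a • u) v = a * symplForm θ p u v := by
  simp only [symplForm, extDerivOneForm_eq, vectorExtDeriv, map_smul, smul_apply,
    smul_eq_mul]
  ring

theorem IsExactSymplectic.eq_of_symplForm_eq (hω : IsExactSymplectic θ) {p : P}
    {u u' : TangentSpace 𝓘(ℝ, E) p} (h : ∀ v, symplForm θ p u v = symplForm θ p u' v) : u = u' :=
  sub_eq_zero.1 (hω.nondegenerate p _ fun v ↦ by rw [symplForm_sub_left, h, sub_self])

theorem IsExactSymplectic.eq_zero_of_eventually (hω : IsExactSymplectic θ) {h : P → ℝ}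
    {X : VectorField E P} (hX : IsHamiltonianVectorField θ h X) {q : P}
    (h0 : ∀ᶠ p in 𝓝 q, h p = 0) : ∀ᶠ p in 𝓝 q, X p = 0 := by
  filter_upwards [h0.eventually_nhds] with p hp
  refine hω.nondegenerate p _ fun v ↦ ?_
  rw [hX p v]
  have h1 : mfderiv 𝓘(ℝ, E) 𝓘(ℝ, ℝ) h p = 0 := by
    rw [Filter.EventuallyEq.mfderiv_eq (f₁ := h) (f := fun _ ↦ (0 : ℝ)) hp, mfderiv_const]
    rfl
  rw [differential, mvfderiv, h1]
  rfl

/-- Hamiltonian vector fields exist and are smooth. -/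
theorem IsExactSymplectic.exists_hamiltonianField (hω : IsExactSymplectic θ) {h : P → ℝ}
    (hh : ContMDiff 𝓘(ℝ, E) 𝓘(ℝ, ℝ) ∞ h) :
    ∃ X : VectorField E P, IsSmoothField X ∧ IsHamiltonianVectorField θ h X := by
  have hex : ∀ q : P, ∃ u : TangentSpace 𝓘(ℝ, E) q, ∀ v, symplForm θ q u v = differential h q v := by
    intro q
    have hq : q ∈ (extChartAt 𝓘(ℝ, E) q).source := mem_extChartAt_source q
    obtain ⟨A, hA⟩ := hω.isInvertible_symplChart ((extChartAt 𝓘(ℝ, E) q).map_source hq)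
    obtain ⟨u, hu⟩ := chartDeriv_surjective hq
      (A.symm (chartExpr (differential h) q (extChartAt 𝓘(ℝ, E) q q)))
    refine ⟨u, fun v ↦ ?_⟩
    rw [symplForm_eq_chart hω.smooth hq, hu, ← hA, ← chartExpr_chartDeriv _ hq]
    exact congrArg (fun B : E →L[ℝ] ℝ ↦ B _) (A.apply_symm_apply _)
  choose X hX using hex
  refine ⟨X, isSmoothField_of_chartField fun x ↦ ?_, hX⟩
  have hx : x ∈ (extChartAt 𝓘(ℝ, E) x).source := mem_extChartAt_source x
  have hy := (extChartAt 𝓘(ℝ, E) x).map_source hx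
  have h1 : ContDiffAt ℝ ∞ (chartExpr (differential h) x) (extChartAt 𝓘(ℝ, E) x x) := by
    have h2 : ContDiffAt ℝ ∞ (h ∘ (extChartAt 𝓘(ℝ, E) x).symm) (extChartAt 𝓘(ℝ, E) x x) :=
      contMDiffAt_iff_contDiffAt.1 (hh.contMDiffAt.comp _ (contMDiffAt_chart_symm hy))
    refine (h2.fderiv_right (m := ∞) (by simp)).congr_of_eventuallyEq ?_
    filter_upwards [(isOpen_chart_target x).mem_nhds hy] with z hz
    exact (fderiv_comp_chart_symm (hh.mdifferentiable (by simp)) hz).symm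
  -- In the chart the field is the inverse of the symplectic operator applied to `dh`, and operator
  -- inversion is smooth at invertible operators.
  have h3 : ContDiffAt ℝ ∞ (fun y ↦ (symplChart θ x y).inverse) (extChartAt 𝓘(ℝ, E) x x) := by
    obtain ⟨A, hA⟩ := hω.isInvertible_symplChart hy
    have h4 : ContDiffAt ℝ ∞ ContinuousLinearMap.inverse
        (symplChart θ x (extChartAt 𝓘(ℝ, E) x x)) := by
      rw [← hA]
      exact contDiffAt_map_inverse A
    exact h4.comp _ (contDiffAt_symplChart hω.smooth hy)
  refine (h3.clm_apply h1).congr_of_eventuallyEq ?_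
  filter_upwards [(isOpen_chart_target x).mem_nhds hy] with y hy
  have hq := (extChartAt 𝓘(ℝ, E) x).map_target hy
  have h5 : symplChart θ x y (chartField X x y) = chartExpr (differential h) x y := by
    ext w
    obtain ⟨v, rfl⟩ := chartDeriv_surjective hq w
    have h6 := hX _ v
    rw [symplForm_eq_chart hω.smooth hq, ← chartExpr_chartDeriv _ hq,
      (extChartAt 𝓘(ℝ, E) x).right_inv hy] at h6
    exact h6
  obtain ⟨A, hA⟩ := hω.isInvertible_symplChart hy
  rw [← h5, ← hA, ContinuousLinearMap.inverse_equiv]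
  exact (A.symm_apply_apply _).symm

end HamiltonianFields

/-! ### Invariant fields on principal bundles and their completeness -/

section PrincipalBundles

variable {E : Type*} [NormedAddCommGroup E] [NormedSpace ℝ E] [FiniteDimensional ℝ E]
  {P : Type*} [TopologicalSpace P] [ChartedSpace E P] [IsManifold 𝓘(ℝ, E) ∞ P]
  {B : Type*} [NormedAddCommGroup B] [NormedSpace ℝ B]
  {M : Type*} [TopologicalSpace M] [ChartedSpace B M]
  {L : Type*} [NormedAddCommGroup L] [NormedSpace ℝ L]
  {O : Type*} [TopologicalSpace O] [ChartedSpace L O] [Group O]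
  {Φ : O → P → P} {pr : P → M} {θ : OneForm E P}

theorem IsPrincipalBundle.proj_action (hP : IsPrincipalBundle E B L Φ pr) (g : O) (p : P) :
    pr (Φ g p) = pr p := by
  obtain ⟨U, e, -, hU, hs, -, -, -, he, hg⟩ := hP.locally_trivial (pr p)
  have hp : p ∈ e.source := by rwa [hs]
  obtain ⟨h1, h2⟩ := hg g p hp
  rw [← he _ h1, h2, he p hp]

theorem IsPrincipalBundle.exists_proj_eq (hP : IsPrincipalBundle E B L Φ pr) (m : M) :
    ∃ p, pr p = m := by
  obtain ⟨U, e, -, hU, -, ht, -, -, he, -⟩ := hP.locally_trivial m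
  have hm : (m, (1 : O)) ∈ e.target := by
    rw [ht]
    exact ⟨hU, mem_univ _⟩
  refine ⟨e.symm (m, 1), ?_⟩
  rw [← he _ (e.map_target hm), e.right_inv hm]

theorem IsPrincipalBundle.exists_action_eq (hP : IsPrincipalBundle E B L Φ pr) {p q : P}
    (h : pr p = pr q) : ∃ g, Φ g q = p := by
  obtain ⟨U, e, -, hU, hs, -, -, -, he, hg⟩ := hP.locally_trivial (pr p)
  have hp : p ∈ e.source := by rwa [hs]
  have hq : q ∈ e.source := by
    rw [hs, mem_preimage, ← h]
    exact hU
  refine ⟨(e q).2⁻¹ * (e p).2, ?_⟩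
  obtain ⟨h1, h2⟩ := hg ((e q).2⁻¹ * (e p).2) q hq
  refine e.injOn h1 hp ?_
  rw [h2, mul_inv_cancel_left, he q hq, ← h, ← he p hp]

/-- The projection is open: a trivialization provides a local section through `p`. -/
theorem IsPrincipalBundle.eventually_exists_mem (hP : IsPrincipalBundle E B L Φ pr) {p : P}
    {W : Set P} (hW : W ∈ 𝓝 p) : ∀ᶠ m in 𝓝 (pr p), ∃ q ∈ W, pr q = m := by
  obtain ⟨U, e, hUo, hU, hs, ht, -, -, he, -⟩ := hP.locally_trivial (pr p)
  have hp : p ∈ e.source := by rwa [hs]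
  have hmem : ∀ m ∈ U, (m, (e p).2) ∈ e.target := fun m hm ↦ by
    rw [ht]
    exact ⟨hm, mem_univ _⟩
  have hep : (pr p, (e p).2) = e p := by rw [← he p hp]
  have h1 : ContinuousAt (fun m ↦ e.symm (m, (e p).2)) (pr p) :=
    ContinuousAt.comp (g := e.symm) (e.continuousAt_symm (hmem _ hU))
      (Continuous.prodMk_left _).continuousAt
  have h2 : e.symm (pr p, (e p).2) = p := by rw [hep, e.left_inv hp]
  filter_upwards [h1.eventually_mem (by rwa [h2]), hUo.mem_nhds hU] with m hm hmU
  refine ⟨_, hm, ?_⟩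
  rw [← he _ (e.map_target (hmem m hmU)), e.right_inv (hmem m hmU)]

/-- The action of a group element, as a diffeomorphism. -/
def IsPrincipalBundle.actionDiff (hP : IsPrincipalBundle E B L Φ pr) (g : O) : Diff E P where
  toFun := Φ g
  invFun := Φ g⁻¹
  left_inv p := by rw [← hP.action_mul, mul_inv_cancel, hP.action_one]
  right_inv p := by rw [← hP.action_mul, inv_mul_cancel, hP.action_one]
  contMDiff_toFun := hP.contMDiff_action g
  contMDiff_invFun := hP.contMDiff_action g⁻¹

/-- Invariance of a vector field under the action. -/
def IsInvariantField (Φ : O → P → P) (X : VectorField E P) : Prop :=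
  ∀ g q, X (Φ g q) = mfderiv 𝓘(ℝ, E) 𝓘(ℝ, E) (Φ g) q (X q)

theorem IsInvariantField.oneForm_apply {X : VectorField E P} (hX : IsInvariantField Φ X)
    (hθ : IsInvariantOneForm Φ θ) (g : O) (q : P) : θ (Φ g q) (X (Φ g q)) = θ q (X q) := by
  rw [hX g q, ← pullback_apply, hθ g]

/-- Both `-dθ` and `dh` are invariant, so both sides of the claimed equality have the same
contraction with the form; nondegeneracy then identifies them. -/
theorem isInvariantField_of_hamiltonian (hP : IsPrincipalBundle E B L Φ pr)
    (hω : IsExactSymplectic θ) (hθ : IsInvariantOneForm Φ θ) {h : P → ℝ}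
    (hh : ContMDiff 𝓘(ℝ, E) 𝓘(ℝ, ℝ) ∞ h) (hinv : ∀ g p, h (Φ g p) = h p) {X : VectorField E P}
    (hX : IsHamiltonianVectorField θ h X) : IsInvariantField Φ X := by
  intro g q
  refine hω.eq_of_symplForm_eq fun v ↦ ?_
  obtain ⟨w, hw⟩ : ∃ w, mfderiv 𝓘(ℝ, E) 𝓘(ℝ, E) (Φ g) q w = v :=
    (hP.actionDiff g).exists_mfderiv_eq q v
  have h1 := extDerivOneForm_pullback hω.smooth (hP.contMDiff_action g) q (X q) w
  have h2 := hX q w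
  have h3 : differential (h ∘ Φ g) q w = pullback (Φ g) (differential h) q w := by
    rw [differential_comp (hh.mdifferentiable (by simp)) (hP.mdifferentiable_action g)]
  have h4 : h ∘ Φ g = h := funext fun p ↦ hinv g p
  rw [h4, pullback_apply, hw] at h3
  rw [hθ g, hw] at h1
  rw [symplForm, h1, h3] at h2
  rw [hX]
  exact h2.symm

theorem IsInvariantField.integralCurveOn {X : VectorField E P} (hX : IsInvariantField Φ X)
    (hP : IsPrincipalBundle E B L Φ pr) {γ : ℝ → P} {s : Set ℝ} (hγ : IsMIntegralCurveOn γ X s)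
    (g : O) : IsMIntegralCurveOn (Φ g ∘ γ) X s := by
  intro t ht
  refine ((hP.mdifferentiable_action g (γ t)).hasMFDerivAt.comp_hasMFDerivWithinAt t
    (hγ t ht)).congr_mfderiv ?_
  ext
  change mfderiv 𝓘(ℝ, E) 𝓘(ℝ, E) (Φ g) (γ t) ((1 : ℝ) • X (γ t)) =
    ((1 : ℝ) • X (Φ g (γ t)) : TangentSpace 𝓘(ℝ, E) (Φ g (γ t)))
  rw [one_smul, one_smul, hX g]

/-- An invariant vector field supported over a compact subset of the base is complete. -/
theorem IsInvariantField.isCompleteField [T2Space P] {X : VectorField E P}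
    (hX : IsInvariantField Φ X)
    (hP : IsPrincipalBundle E B L Φ pr) (hs : IsSmoothField X) {K : Set M} (hK : IsCompact K)
    (h0 : ∀ p, pr p ∉ K → X p = 0) : IsCompleteField X := by
  obtain ⟨ε, hε, h⟩ : ∃ ε > 0, ∀ p, pr p ∈ K →
      ∃ γ : ℝ → P, γ 0 = p ∧ IsMIntegralCurveOn γ X (Ioo (-ε) ε) := by
    refine hK.induction_on (p := fun s ↦ ∃ ε > 0, ∀ p, pr p ∈ s →
      ∃ γ : ℝ → P, γ 0 = p ∧ IsMIntegralCurveOn γ X (Ioo (-ε) ε)) ?_ ?_ ?_ ?_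
    · exact ⟨1, one_pos, fun p hp ↦ hp.elim⟩
    · rintro s t hst ⟨ε, hε, h⟩
      exact ⟨ε, hε, fun p hp ↦ h p (hst hp)⟩
    · rintro s t ⟨ε, hε, h⟩ ⟨ε', hε', h'⟩
      refine ⟨min ε ε', lt_min hε hε', fun p hp ↦ ?_⟩
      rcases hp with hp | hp
      · obtain ⟨γ, hγ0, hγ⟩ := h p hp
        exact ⟨γ, hγ0, hγ.mono (Ioo_subset_Ioo (neg_le_neg (min_le_left _ _)) (min_le_left _ _))⟩
      · obtain ⟨γ, hγ0, hγ⟩ := h' p hp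
        exact ⟨γ, hγ0, hγ.mono (Ioo_subset_Ioo (neg_le_neg (min_le_right _ _)) (min_le_right _ _))⟩
    · intro m _
      obtain ⟨q, rfl⟩ := hP.exists_proj_eq m
      obtain ⟨ε, hε, h⟩ := hs.exists_uniform_time q
      refine ⟨_, mem_nhdsWithin_of_mem_nhds (hP.eventually_exists_mem h), ε, hε, fun p hp ↦ ?_⟩
      obtain ⟨q', ⟨γ, hγ0, hγ⟩, hq'⟩ := hp
      obtain ⟨g, hg⟩ := hP.exists_action_eq hq'.symm
      exact ⟨Φ g ∘ γ, by simp [hγ0, hg], hX.integralCurveOn hP hγ g⟩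
  refine exists_isMIntegralCurve_of_isMIntegralCurveOn hs.of_le_one hε fun p ↦ ?_
  by_cases hp : pr p ∈ K
  · exact h p hp
  · exact ⟨fun _ ↦ p, rfl, (isMIntegralCurve_const (h0 p hp)).isMIntegralCurveOn _⟩

/-- An invariant vector field vanishing near arbitrarily high levels of an exhaustion function on
the base is complete. -/
theorem IsInvariantField.isCompleteField_of_levels [T2Space P] {X : VectorField E P}
    (hX : IsInvariantField Φ X) (hP : IsPrincipalBundle E B L Φ pr) (hs : IsSmoothField X)
    {f : M → ℝ} (hf : Continuous f) (hK : ∀ b, ∃ K, IsCompact K ∧ f ⁻¹' Iic b ⊆ K)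
    (hlev : ∀ s, ∃ b > s, ∀ q, f (pr q) = b → ∀ᶠ p in 𝓝 q, X p = 0) : IsCompleteField X := by
  classical
  refine isCompleteField_of_pieces fun x hx ↦ ?_
  obtain ⟨b, hb, hb0⟩ := hlev (f (pr x))
  obtain ⟨K, hKc, hKb⟩ := hK b
  have hfc : Continuous fun q ↦ f (pr q) := hf.comp hP.smooth_proj.continuous
  -- Cutting `X` off sharply at the level `b` keeps it smooth, since `X` vanishes near that level,
  -- and invariant, since the level depends only on the base point. Its support now lies over a
  -- compact set.
  let Y : VectorField E P := fun q ↦ if f (pr q) < b then X q else 0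
  have hYs : IsSmoothField Y := by
    refine IsSmoothField.congr_of_eventuallyEq (Y := fun q ↦ if f (pr q) < b then X else 0)
      (fun q ↦ ?_) fun q ↦ ?_
    · split_ifs
      · exact hs
      · exact isSmoothField_zero
    · rcases lt_trichotomy (f (pr q)) b with hq | hq | hq
      · filter_upwards [hfc.continuousAt.eventually_lt_const hq] with p hp
        simp [Y, hp, hq]
      · filter_upwards [hb0 q hq] with p hp
        simp [Y, hq, hp]
      · filter_upwards [hfc.continuousAt.eventually_const_lt hq] with p hp
        simp [Y, hp.not_gt, hq.not_gt]
  have hYi : IsInvariantField Φ Y := by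
    intro g q
    simp only [Y, hP.proj_action]
    split_ifs
    · exact hX g q
    · exact (map_zero _).symm
  refine ⟨Y, hYs, hYi.isCompleteField hP hYs hKc fun p hp ↦ if_neg fun hlt ↦ hp (hKb hlt.le),
    if_pos hb, fun q hq ↦ ?_⟩
  by_cases hqb : f (pr q) < b
  · exact if_pos hqb
  · exact absurd (if_neg hqb) hq

end PrincipalBundles

/-! ### Flows as Hamiltonian isotopies and products of curves -/

section Isotopies

variable {E : Type*} [NormedAddCommGroup E] [NormedSpace ℝ E] [FiniteDimensional ℝ E]
  {P : Type*} [TopologicalSpace P] [ChartedSpace E P] [IsManifold 𝓘(ℝ, E) ∞ P]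
  {θ : OneForm E P}

theorem IsHamiltonianVectorField.const_smul {h : P → ℝ} {X : VectorField E P}
    (hX : IsHamiltonianVectorField θ h X) (hh : ContMDiff 𝓘(ℝ, E) 𝓘(ℝ, ℝ) ∞ h) (a : ℝ) :
    IsHamiltonianVectorField θ (fun p ↦ a * h p) (a • X) := by
  intro p v
  have h1 : differential (E := E) (fun p ↦ a * h p) p = a • differential h p := by
    have h2 := const_smul_mfderiv (hh.mdifferentiable (by simp) p) a
    ext w
    exact congrArg (fun A ↦ A w) h2
  rw [h1, Pi.smul_apply, symplForm_smul_left, hX p v]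
  rfl

theorem IsHamiltonianVectorField.add {h k : P → ℝ} {X Y : VectorField E P}
    (hX : IsHamiltonianVectorField θ h X) (hY : IsHamiltonianVectorField θ k Y)
    (hh : ContMDiff 𝓘(ℝ, E) 𝓘(ℝ, ℝ) ∞ h) (hk : ContMDiff 𝓘(ℝ, E) 𝓘(ℝ, ℝ) ∞ k) :
    IsHamiltonianVectorField θ (h + k) (X + Y) := by
  intro p v
  rw [differential_add (hh.mdifferentiable (by simp)) (hk.mdifferentiable (by simp)),
    Pi.add_apply, symplForm_add_left, hX p v, hY p v]
  rfl

/-- The flow maps of a complete Hamiltonian field are Hamiltonian diffeomorphisms. -/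
theorem isHamiltonianDiffeo_of_flow {h : P → ℝ} {X : VectorField E P}
    (hh : ContMDiff 𝓘(ℝ, E) 𝓘(ℝ, ℝ) ∞ h) (hX : IsHamiltonianVectorField θ h X)
    {ψ : ℝ → Diff E P} (hψ : IsSmoothCurve ψ) (h0 : ψ 0 = 1) (hv : ∀ t, HasVelocityAt ψ t X)
    (t : ℝ) : IsHamiltonianDiffeo θ (ψ t) := by
  have hlin : ContMDiff (𝓘(ℝ, ℝ).prod 𝓘(ℝ, E)) (𝓘(ℝ, ℝ).prod 𝓘(ℝ, E)) ∞
      (fun z : ℝ × P ↦ (z.1 * t, z.2)) :=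
    (contMDiff_fst.mul contMDiff_const).prodMk contMDiff_snd
  -- The time change `s ↦ s * t` makes `ψ t` a time-one map and multiplies the Hamiltonian by `t`.
  refine ⟨fun _ p ↦ t * h p, fun _ ↦ t • X, fun s ↦ ψ (s * t),
    contMDiff_const.mul (hh.comp contMDiff_snd), fun _ ↦ hX.const_smul hh t,
    ⟨hψ.smooth.comp hlin, hψ.smooth_symm.comp hlin⟩,
    fun s p ↦ ((isMIntegralCurve_of_hasVelocityAt hv p).comp_mul t) s, by simp [h0], by simp⟩

/-- The velocity at the identity of a product of curves is the sum of the velocities. -/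
theorem HasVelocityAt.mul_of_eq_one {ψ ψ' : ℝ → Diff E P} {X Y : VectorField E P}
    (hψ : IsSmoothCurve ψ) (h0 : ψ 0 = 1) (hX : HasVelocityAt ψ 0 X)
    (hY : HasVelocityAt ψ' 0 Y) : HasVelocityAt (fun t ↦ ψ t * ψ' t) 0 (X + Y) := by
  intro p
  have hd : MDifferentiableAt (𝓘(ℝ, ℝ).prod 𝓘(ℝ, E)) 𝓘(ℝ, E) (fun x : ℝ × P ↦ ψ x.1 x.2)
      (0, ψ' 0 p) := hψ.smooth.mdifferentiable (by simp) _
  have hc : HasMFDerivAt 𝓘(ℝ, ℝ) (𝓘(ℝ, ℝ).prod 𝓘(ℝ, E)) (fun s : ℝ ↦ (s, ψ' s p)) 0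
      ((ContinuousLinearMap.id ℝ ℝ).prod ((1 : ℝ →L[ℝ] ℝ).smulRight (Y (ψ' 0 p) : E))) :=
    (hasMFDerivAt_id (I := 𝓘(ℝ, ℝ)) (0 : ℝ)).prodMk (hY p)
  have h1 := hd.hasMFDerivAt.comp (0 : ℝ) hc
  let y : E := Y (ψ' 0 p)
  have h0q : (ψ 0 : P → P) = id := by rw [h0]; rfl
  refine h1.congr_mfderiv ?_
  refine ContinuousLinearMap.ext fun (a : ℝ) ↦ ?_
  -- The chain rule splits the derivative into a time part, giving `X`, and a space part, which is
  -- the identity applied to `Y` because `ψ 0 = 1`.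
  have h2 := mfderiv_prod_eq_add_apply (v := ((a, a • y) : ℝ × E)) hd
  refine Eq.trans h2 ?_
  have h3 : mfderiv 𝓘(ℝ, ℝ) 𝓘(ℝ, E) (fun s ↦ ψ s (ψ' 0 p)) 0 =
      (1 : ℝ →L[ℝ] ℝ).smulRight (X (ψ 0 (ψ' 0 p))) := (hX (ψ' 0 p)).mfderiv
  have h4 : mfderiv 𝓘(ℝ, E) 𝓘(ℝ, E) (fun q ↦ ψ 0 q) (ψ' 0 p) =
      ContinuousLinearMap.id ℝ (TangentSpace 𝓘(ℝ, E) (ψ' 0 p)) := by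
    have : (fun q ↦ ψ 0 q) = (id : P → P) := h0q
    rw [this, mfderiv_id]
  change (mfderiv 𝓘(ℝ, ℝ) 𝓘(ℝ, E) (fun s ↦ ψ s (ψ' 0 p)) 0 a : E) +
    mfderiv 𝓘(ℝ, E) 𝓘(ℝ, E) (fun q ↦ ψ 0 q) (ψ' 0 p) (a • y) =
    a • ((X (ψ 0 (ψ' 0 p)) : E) + Y (ψ 0 (ψ' 0 p)))
  rw [h3, h4, smul_add]
  have h5 : (Y (ψ 0 (ψ' 0 p)) : E) = Y (ψ' 0 p) :=
    congrArg (fun q ↦ (Y q : E)) (congrFun h0q (ψ' 0 p))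
  rw [h5]
  rfl

end Isotopies

/-! ### Smooth exhaustion functions -/

section Exhaustion

variable {B : Type*} [NormedAddCommGroup B] [NormedSpace ℝ B] [FiniteDimensional ℝ B]
  {M : Type*} [TopologicalSpace M] [ChartedSpace B M] [IsManifold 𝓘(ℝ, B) ∞ M]
  [T2Space M] [SecondCountableTopology M]

variable (B M) in
/-- Every manifold carries a smooth exhaustion function. -/
theorem exists_smooth_exhaustion : ∃ f : M → ℝ, ContMDiff 𝓘(ℝ, B) 𝓘(ℝ, ℝ) ∞ f ∧
    ∀ b, ∃ K, IsCompact K ∧ f ⁻¹' Iic b ⊆ K := by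
  have : LocallyCompactSpace M := Manifold.locallyCompact_of_finiteDimensional 𝓘(ℝ, B)
  let K := CompactExhaustion.choice M
  -- The condition `f x ∈ T x` says that `f ≥ n` off `K n`, which confines sublevel sets. It is
  -- convex and locally solved by constants, so a partition of unity solves it globally.
  let T : M → Set ℝ := fun x ↦ {c : ℝ | ∀ n : ℕ, x ∉ K n → (n : ℝ) ≤ c}
  have hT : ∀ x, Convex ℝ (T x) := by
    intro x a ha c hc s t hs ht hst n hn
    calc (n : ℝ) = s * n + t * n := by rw [← add_mul, hst, one_mul]
      _ ≤ s * a + t * c := add_le_add (mul_le_mul_of_nonneg_left (ha n hn) hs)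
        (mul_le_mul_of_nonneg_left (hc n hn) ht)
  have hloc : ∀ x, ∃ c : ℝ, ∀ᶠ y in 𝓝 x, c ∈ T y := by
    intro x
    refine ⟨((K.find x + 1 : ℕ) : ℝ), ?_⟩
    filter_upwards [isOpen_interior.mem_nhds (K.subset_interior_succ _ (K.mem_find x))] with y hy
    intro n hn
    have : n < K.find x + 1 := by
      by_contra hle
      exact hn (K.subset (not_lt.1 hle) (interior_subset hy))
    exact_mod_cast this.le
  obtain ⟨f, hf⟩ := exists_contMDiffMap_forall_mem_convex_of_local_const (n := (⊤ : ℕ∞)) 𝓘(ℝ, B)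
    hT hloc
  refine ⟨f, f.contMDiff, fun b ↦ ?_⟩
  obtain ⟨n, hn⟩ := exists_nat_gt b
  refine ⟨K n, K.isCompact n, fun x hx ↦ ?_⟩
  by_contra hxn
  exact absurd (hf x n hxn) (not_le.2 (lt_of_le_of_lt hx hn))

end Exhaustion

/-! ### Realizing invariant Hamiltonian fields by curves in the kernel -/

section FormalLieAlgebra

variable {E : Type*} [NormedAddCommGroup E] [NormedSpace ℝ E] [FiniteDimensional ℝ E]
  {P : Type*} [TopologicalSpace P] [ChartedSpace E P] [IsManifold 𝓘(ℝ, E) ∞ P] [T2Space P]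
  [ConnectedSpace P]
  {B : Type*} [NormedAddCommGroup B] [NormedSpace ℝ B]
  {M : Type*} [TopologicalSpace M] [ChartedSpace B M]
  {L : Type*} [NormedAddCommGroup L] [NormedSpace ℝ L]
  {O : Type*} [TopologicalSpace O] [ChartedSpace L O] [Group O]
  {Φ : O → P → P} {pr : P → M} {θ : OneForm E P}

theorem IsInvariantField.flow_mem_Aut {X : VectorField E P}
    (hX : IsInvariantField Φ X) (hP : IsPrincipalBundle E B L Φ pr) (hs : IsSmoothField X)
    {ψ : ℝ → Diff E P} (h0 : ψ 0 = 1) (hv : ∀ t, HasVelocityAt ψ t X) (t : ℝ) :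
    ψ t ∈ Aut E Φ := by
  intro g p
  have h1 : IsMIntegralCurve (Φ g ∘ fun t ↦ ψ t p) X := by
    rw [isMIntegralCurve_iff_isMIntegralCurveOn]
    exact hX.integralCurveOn hP ((isMIntegralCurve_of_hasVelocityAt hv p).isMIntegralCurveOn _) g
  have h2 := hs.integralCurve_eq (t := 0) (isMIntegralCurve_of_hasVelocityAt hv (Φ g p)) h1
    (by simp only [Function.comp_apply, h0]; rfl)
  exact congrFun h2 t

/-- The flow of a complete Hamiltonian field with invariant Hamiltonian consists of special
Hamiltonian automorphisms. -/
theorem flow_mem_ker_fluxHom (hP : IsPrincipalBundle E B L Φ pr) (hω : IsExactSymplectic θ)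
    (hθ : IsInvariantOneForm Φ θ) {h : P → ℝ} (hh : ContMDiff 𝓘(ℝ, E) 𝓘(ℝ, ℝ) ∞ h)
    (hinv : ∀ g p, h (Φ g p) = h p) {X : VectorField E P} (hs : IsSmoothField X)
    (hX : IsHamiltonianVectorField θ h X) {ψ : ℝ → Diff E P} (hψ : IsSmoothCurve ψ)
    (h0 : ψ 0 = 1) (hv : ∀ t, HasVelocityAt ψ t X) (t : ℝ) :
    ψ t ∈ (fluxHom hP hω.smooth hθ).ker.map (hamAutGroup Φ hω.smooth).subtype := by
  have hXi := isInvariantField_of_hamiltonian hP hω hθ hh hinv hX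
  have hA := hXi.flow_mem_Aut hP hs h0 hv
  have hF := isPotentialFamily_timePrimitive hω.smooth (h := fun _ ↦ h) (X := fun _ ↦ X)
    (hh.comp contMDiff_snd) (fun _ ↦ hX) hψ hv h0
  refine (mem_map_ker_fluxHom_iff hP hω.smooth hθ (ψ t)).2
    ⟨⟨hA t, isHamiltonianDiffeo_of_flow hh hX hψ h0 hv t⟩, _, contMDiff_slice hF.smooth t,
      hF.differential_eq t, fun g p ↦ ?_⟩
  -- The action density is invariant because `θ(X)` and `h` are and the flow is equivariant; hence
  -- so is the primitive obtained by integrating it.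
  have h1 : ∀ s, actionDensity θ (fun _ ↦ h) (fun _ ↦ X) ψ s (Φ g p) =
      actionDensity θ (fun _ ↦ h) (fun _ ↦ X) ψ s p := by
    intro s
    rw [actionDensity, actionDensity, hA s g p, hinv, hXi.oneForm_apply hθ]
  simp only [timePrimitive, h1]

/-- Existence of special Hamiltonian isotopies with Hamiltonian vanishing near high levels of an
exhaustion function. -/
theorem exists_curve_of_levels (hP : IsPrincipalBundle E B L Φ pr) (hω : IsExactSymplectic θ)
    (hθ : IsInvariantOneForm Φ θ) {f : M → ℝ} (hf : Continuous f)
    (hK : ∀ b, ∃ K, IsCompact K ∧ f ⁻¹' Iic b ⊆ K) {h : P → ℝ}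
    (hh : ContMDiff 𝓘(ℝ, E) 𝓘(ℝ, ℝ) ∞ h) (hinv : ∀ g p, h (Φ g p) = h p)
    (hlev : ∀ s, ∃ b > s, ∀ q, f (pr q) = b → ∀ᶠ p in 𝓝 q, h p = 0) :
    ∃ (X : VectorField E P) (ψ : ℝ → Diff E P), IsHamiltonianVectorField θ h X ∧
      IsSmoothCurve ψ ∧ ψ 0 = 1 ∧ HasVelocityAt ψ 0 X ∧
      ∀ t, ψ t ∈ (fluxHom hP hω.smooth hθ).ker.map (hamAutGroup Φ hω.smooth).subtype := by
  obtain ⟨X, hs, hX⟩ := hω.exists_hamiltonianField hh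
  have hXi := isInvariantField_of_hamiltonian hP hω hθ hh hinv hX
  have hc : IsCompleteField X := hXi.isCompleteField_of_levels hP hs hf hK fun s ↦ by
    obtain ⟨b, hb, h0⟩ := hlev s
    exact ⟨b, hb, fun q hq ↦ hω.eq_zero_of_eventually hX (h0 q hq)⟩
  obtain ⟨ψ, hψ, h0, hv⟩ := hs.exists_flow hc
  exact ⟨X, ψ, hX, hψ, h0, hv 0, flow_mem_ker_fluxHom hP hω hθ hh hinv hs hX hψ h0 hv⟩

theorem exists_gt_sin_eq (s c : ℝ) (hc : c ∈ Icc (-1 : ℝ) 1) : ∃ b > s, Real.sin b = c := by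
  obtain ⟨n, hn⟩ := exists_nat_gt ((s - Real.arcsin c) / (2 * Real.pi))
  refine ⟨Real.arcsin c + n * (2 * Real.pi), ?_, ?_⟩
  · rw [div_lt_iff₀ Real.two_pi_pos] at hn
    linarith
  · rw [Real.sin_add_nat_mul_two_pi, Real.sin_arcsin hc.1 hc.2]

/-- The field itself may be incomplete, so it is written as a sum of two complete ones. The product
of their flows is a curve in the kernel but in general not a flow; only its velocity at zero is
prescribed. -/
theorem subset_formalLieAlgebra_ker [FiniteDimensional ℝ B] [IsManifold 𝓘(ℝ, B) ∞ M] [T2Space M]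
    [SecondCountableTopology M] (hP : IsPrincipalBundle E B L Φ pr) (hω : IsExactSymplectic θ)
    (hθ : IsInvariantOneForm Φ θ) :
    invariantHamiltonianVectorFields Φ θ ⊆
      formalLieAlgebra ((fluxHom hP hω.smooth hθ).ker.map (hamAutGroup Φ hω.smooth).subtype) := by
  rintro X ⟨h, hh, hinv, hX⟩
  obtain ⟨f, hf, hK⟩ := exists_smooth_exhaustion B M
  -- `c` is zero where `sin ≤ -1/2` and one where `sin ≥ 1/2`, and both happen near arbitrarily
  -- large arguments. So each of `c(f) h` and `(1 - c(f)) h` vanishes near arbitrarily high levels.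
  let c : ℝ → ℝ := fun s ↦ Real.smoothTransition (Real.sin s + 1 / 2)
  have hc : ContDiff ℝ ∞ c :=
    (Real.smoothTransition.contDiff (n := ⊤)).comp (Real.contDiff_sin.add contDiff_const)
  have hfp : ContMDiff 𝓘(ℝ, E) 𝓘(ℝ, ℝ) ∞ (fun p ↦ f (pr p)) := hf.comp hP.smooth_proj
  have hcf : ContMDiff 𝓘(ℝ, E) 𝓘(ℝ, ℝ) ∞ (fun p ↦ c (f (pr p))) := hc.contMDiff.comp hfp
  have hsin : Continuous fun p ↦ Real.sin (f (pr p)) := Real.continuous_sin.comp hfp.continuous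
  have hh₁ : ContMDiff 𝓘(ℝ, E) 𝓘(ℝ, ℝ) ∞ (fun p ↦ c (f (pr p)) * h p) := hcf.mul hh
  have hh₂ : ContMDiff 𝓘(ℝ, E) 𝓘(ℝ, ℝ) ∞ (fun p ↦ (1 - c (f (pr p))) * h p) :=
    (contMDiff_const.sub hcf).mul hh
  obtain ⟨X₁, ψ₁, hX₁, hψ₁, h0₁, hv₁, hker₁⟩ := exists_curve_of_levels hP hω hθ hf.continuous hK
    hh₁ (fun g p ↦ by rw [hP.proj_action, hinv]) fun s ↦ by
      obtain ⟨b, hb, hsb⟩ := exists_gt_sin_eq s (-1) (by norm_num)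
      refine ⟨b, hb, fun q hq ↦ ?_⟩
      have hq' : Real.sin (f (pr q)) < -1 / 2 := by rw [hq, hsb]; norm_num
      filter_upwards [hsin.continuousAt.eventually_lt_const hq'] with p hp
      have hcp : c (f (pr p)) = 0 := Real.smoothTransition.zero_of_nonpos (by linarith)
      rw [hcp, zero_mul]
  obtain ⟨X₂, ψ₂, hX₂, hψ₂, h0₂, hv₂, hker₂⟩ := exists_curve_of_levels hP hω hθ hf.continuous hK
    hh₂ (fun g p ↦ by rw [hP.proj_action, hinv]) fun s ↦ by
      obtain ⟨b, hb, hsb⟩ := exists_gt_sin_eq s 1 (by norm_num)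
      refine ⟨b, hb, fun q hq ↦ ?_⟩
      have hq' : 1 / 2 < Real.sin (f (pr q)) := by rw [hq, hsb]; norm_num
      filter_upwards [hsin.continuousAt.eventually_const_lt hq'] with p hp
      have hcp : c (f (pr p)) = 1 := Real.smoothTransition.one_of_one_le (by linarith)
      rw [hcp, sub_self, zero_mul]
  have hsum : X = X₁ + X₂ := by
    funext p
    refine hω.eq_of_symplForm_eq fun v ↦ ?_
    rw [hX p v, hX₁.add hX₂ hh₁ hh₂ p v]
    have : (fun p ↦ c (f (pr p)) * h p) + (fun p ↦ (1 - c (f (pr p))) * h p) = h := by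
      funext p
      simp only [Pi.add_apply]
      ring
    rw [this]
  refine ⟨fun t ↦ ψ₁ t * ψ₂ t, hψ₁.mul hψ₂, fun t ↦ mul_mem (hker₁ t) (hker₂ t), by
    simp only [h0₁, h0₂, mul_one], ?_⟩
  rw [hsum]
  exact hv₁.mul_of_eq_one hψ₁ h0₁ hv₂

end FormalLieAlgebra

end PrincipalHam

end

theorem theorem5p2
    {E : Type*} [NormedAddCommGroup E] [NormedSpace ℝ E] [FiniteDimensional ℝ E]
    {P : Type*} [TopologicalSpace P] [ChartedSpace E P] [IsManifold 𝓘(ℝ, E) ∞ P]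
    [T2Space P] [SecondCountableTopology P] [ConnectedSpace P]
    {B : Type*} [NormedAddCommGroup B] [NormedSpace ℝ B] [FiniteDimensional ℝ B]
    {M : Type*} [TopologicalSpace M] [ChartedSpace B M] [IsManifold 𝓘(ℝ, B) ∞ M]
    [T2Space M] [SecondCountableTopology M]
    {L : Type*} [NormedAddCommGroup L] [NormedSpace ℝ L] [FiniteDimensional ℝ L]
    {O : Type*} [TopologicalSpace O] [ChartedSpace L O] [Group O] [LieGroup 𝓘(ℝ, L) ∞ O]
    (Φ : O → P → P) (pr : P → M) (hP : PrincipalHam.IsPrincipalBundle E B L Φ pr)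
    (θ : PrincipalHam.OneForm E P) (hω : PrincipalHam.IsExactSymplectic θ)
    (hθ : PrincipalHam.IsInvariantOneForm Φ θ) :
    ∃ A : Subgroup (PrincipalHam.Diff E P),
      (A : Set (PrincipalHam.Diff E P)) = PrincipalHam.hamAut Φ θ ∧
      ∃ Ψ : A →* Multiplicative (Additive O →+ ℝ),
        (∀ φ : A,
          (∃ F : P → ℝ, ContMDiff 𝓘(ℝ, E) 𝓘(ℝ, ℝ) ∞ F ∧
            PrincipalHam.differential F = PrincipalHam.pullback φ.1 θ - θ) ∧
          ∀ F : P → ℝ, ContMDiff 𝓘(ℝ, E) 𝓘(ℝ, ℝ) ∞ F →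
            PrincipalHam.differential F = PrincipalHam.pullback φ.1 θ - θ →
            ∀ (g : O) (p : P),
              (Ψ φ).toAdd (Additive.ofMul g) = F p - F (Φ g p)) ∧
        PrincipalHam.formalLieAlgebra (Ψ.ker.map A.subtype) =
          PrincipalHam.invariantHamiltonianVectorFields Φ θ := by
  -- The carrier of the intersection of the two subgroups unfolds to `hamAut`.
  refine ⟨PrincipalHam.hamAutGroup Φ hω.smooth, rfl, PrincipalHam.fluxHom hP hω.smooth hθ,
    fun φ ↦ ⟨PrincipalHam.exists_potential hω.smooth φ.2.2, fun F hF hd g p ↦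
      PrincipalHam.fluxHom_apply hP hω.smooth hθ φ hF hd g p⟩, ?_⟩
  exact (PrincipalHam.formalLieAlgebra_ker_subset hP hω.smooth hθ).antisymm
    (PrincipalHam.subset_formalLieAlgebra_ker hP hω hθ)
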